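/- **Setting.** Let $\mathcal X$ be a finite set of inputs. Let $U_x^{(0)},\dots,U_x^{(L)}$ ($x\in\mathcal X$) be unitaries in the $n$-qubit Clifford group, let $P_1,\dots,P_L$ be self-adjoint elements of the $n$-qubit Pauli group $\mathbf P_n=\{\lambda\,\sigma_{i_1}\otimes\cdots\otimes\sigma_{i_n}:\lambda\in\{\pm1,\pm i\}\}$, and let $O=\sum_{k=1}^m c_kQ_k$ with $c_k\in[-1,1]$ and self-adjoint $Q_k\in\mathbf P_n$. For $\theta\in\mathbb R^L$ set $$U_{x,\theta}=U_x^{(L)}e^{-i\frac{\theta_L}{2}P_L}\cdots U_x^{(1)}e^{-i\frac{\theta_1}{2}P_1}U_x^{(0)},\qquad f_\theta(x)=\langle 0^n|U_{x,\theta}^\dagger\,O\,U_{x,\theta}|0^n\rangle .$$ Let $K(x,x')=\mathbb E_\theta\big[\nabla_\theta f_\theta(x)^T\nabla_\theta f_\theta(x')\big]$ be the analytic neural tangent kernel, where the entries of $\theta$ are iid uniform on $[0,2\pi)$. Let $x^{(1)},\dots,x^{(d)}\in\mathcal X$ be training inputs with labels $Y\in\mathbb R^d$ ($d=d_{\rm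 train}$), write $K(x,X_{\rm train}^T)=(K(x,x^{(i)}))_i$ (a row vector) and $K_{\rm train}=(K(x^{(i)},x^{(j)}))_{i,j}$. Assume that $\mathbb E_\theta f_\theta(x)=0$ for all $x\in\mathcal X$ and that $K_{\rm train}$ is invertible. Let $$\mu_\infty(x)=K(x,X_{\rm train}^T)K_{\rm train}^{-1}Y ;$$ for every learning rate $\eta>0$ it is the limit for $t\to\infty$ of the trained mean $\mu_t(x)=K(x,X_{\rm train}^T)K_{\rm train}^{-1}(1-e^{-t\eta K_{\rm train}})Y$. **Algorithm.** Draw $N$ iid samples $\theta^{(1)},\dots,\theta^{(N)}$, each uniform on $\{0,\frac\pi2,\pi,\frac{3\pi}2\}^L$, compute (for the needed pairs of inputs) $$\tilde K(x,x')=\frac1{4N}\sum_{j=1}^N\sum_{i=1}^L\big(f_{\theta^{(j)}+\frac\pi2e_i}(x)-f_{\theta^{(j)}-\frac\pi2e_i}(x)\big)\big(f_{\theta^{(j)}+\frac\pi2e_i}(x')-f_{\theta^{(j)}-\frac\pi2e_i}(x')\big)$$ and output $\tilde\mu_\infty(x)=\tilde K(x,X_{\rm train}^T)\tilde K_{\rm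 train}^{-1}Y$. **Theorem.** Let $R=2L\sqrt d\,m^2\|K_{\rm train}^{-1}Y\|_2$ and $$N(\epsilon,\delta)=\frac{24R^2+4R\epsilon}{3\epsilon^2}\log\frac{2(1+d)}{\delta}+\frac{2(1+\sqrt2)^4L^4d^3m^8\|K_{\rm train}^{-1}\|_{\rm op}^4\|Y\|_2^2}{3\epsilon^2}\log\frac{4d}{\delta}.$$ Let $0<\epsilon<\frac L2\sqrt d\,m^2\|Y\|_2\|K_{\rm train}^{-1}\|_{\rm op}$ and $\delta>0$. (a) For every $x\in\mathcal X$ and every natural number $N\ge N(\epsilon,\delta)$, with probability at least $1-\delta$ the matrix $\tilde K_{\rm train}$ is invertible and $|\tilde\mu_\infty(x)-\mu_\infty(x)|<\epsilon$. (b) For every natural number $N\ge N(\epsilon,\delta/|\mathcal X|)$, with probability at least $1-\delta$ (with the same samples for all $x$) the matrix $\tilde K_{\rm train}$ is invertible and $|\tilde\mu_\infty(x)-\mu_\infty(x)|<\epsilon$ for all $x\in\mathcal X$. *Cost.* The algorithm requires $O\big(NL^2d\,(mn^2+d^2)\big)$ elementary operations: there are a single program for a probabilistic real random access machine (unit cost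 for Boolean gates, real arithmetic and comparison, index operations, branching, loop control and random draws from $\{0,1,2,3\}$; Clifford gates given by their tableaux and self-adjoint Pauli operators by their bits) and a constant $C$ such that, for all networks and training data as above, all $x\in\mathcal X$, all $n,L,m,d,N\ge1$ and all random draws, the program draws $N$ samples, makes at most $C\,N L^2 d\,(mn^2+d^2)$ steps and, if $\tilde K_{\rm train}$ is invertible, outputs $\tilde\mu_\infty(x)$. -/

import Mathlib

open MeasureTheory ProbabilityTheory Filter
open scoped Matrix Topology ProbabilityTheory

noncomputable section

namespace QNTK

/-! ## Pauli group, Clifford group -/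

/-- Operators on `(ℂ²)^{⊗ n}`, as matrices in the computational basis (indexed by bit strings). -/
abbrev Op (n : ℕ) := Matrix (Fin n → Fin 2) (Fin n → Fin 2) ℂ

/-- The Pauli matrices `σ₀, σ₁, σ₂, σ₃`. -/
def pauli : Fin 4 → Matrix (Fin 2) (Fin 2) ℂ :=
  ![!![1, 0; 0, 1], !![0, 1; 1, 0], !![0, -Complex.I; Complex.I, 0], !![1, 0; 0, -1]]

/-- The tensor product `σ_{s 0} ⊗ ⋯ ⊗ σ_{s (n-1)}`. -/
def pauliString {n : ℕ} (s : Fin n → Fin 4) : Op n :=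
  Matrix.of fun a b => ∏ j, pauli (s j) (a j) (b j)

/-- The `n`-qubit Pauli group, as a set of operators. -/
def pauliGroup (n : ℕ) : Set (Op n) :=
  {P | ∃ u : ℂ, (u = 1 ∨ u = -1 ∨ u = Complex.I ∨ u = -Complex.I) ∧
    ∃ s : Fin n → Fin 4, P = u • pauliString s}

/-- The `n`-qubit Clifford group, as a set of operators: unitaries that map the Pauli group
into itself under conjugation. -/
def cliffordGroup (n : ℕ) : Set (Op n) :=
  {U | U ∈ Matrix.unitaryGroup (Fin n → Fin 2) ℂ ∧
    ∀ P ∈ pauliGroup n, U * P * Uᴴ ∈ pauliGroup n}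

/-- The parametric gate `exp(-i (t/2) P)`. -/
def rotation {n : ℕ} (P : Op n) (t : ℝ) : Op n :=
  NormedSpace.exp ((-(Complex.I * ((t : ℂ) / 2))) • P)

/-! ## The parametric circuit and its model function -/

/-- A quantum neural network on `n` qubits with `L` parameters: input-dependent Clifford gates
`U x 0, …, U x L`, self-adjoint Pauli generators `P 0, …, P (L-1)`, and an observable
`∑ k, c k • Q k` with `m` self-adjoint Pauli operators `Q k` and coefficients in `[-1, 1]`. -/
structure Network (𝒳 : Type*) (n L m : ℕ) where
  U : 𝒳 → Fin (L + 1) → Op n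
  U_mem : ∀ x l, U x l ∈ cliffordGroup n
  P : Fin L → Op n
  P_mem : ∀ l, P l ∈ pauliGroup n
  P_herm : ∀ l, (P l).IsHermitian
  c : Fin m → ℝ
  c_mem : ∀ k, c k ∈ Set.Icc (-1 : ℝ) 1
  Q : Fin m → Op n
  Q_mem : ∀ k, Q k ∈ pauliGroup n
  Q_herm : ∀ k, (Q k).IsHermitian

namespace Network

variable {𝒳 : Type*} {n L m : ℕ} (W : Network 𝒳 n L m)

/-- `U_{x,θ} = U_x^{(L)} e^{-i θ_L P_L / 2} ⋯ U_x^{(1)} e^{-i θ_1 P_1 / 2} U_x^{(0)}`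
(the parameters `θ_1, …, θ_L` are indexed here by `0, …, L-1`). -/
def circuit (x : 𝒳) (θ : Fin L → ℝ) : Op n :=
  (List.ofFn fun l : Fin L => W.U x l.succ * rotation (W.P l) (θ l)).reverse.prod * W.U x 0

/-- The measured observable `O`. -/
def observable : Op n := ∑ k, (W.c k : ℂ) • W.Q k

/-- The model function `f_θ(x) = ⟨0ⁿ| U_{x,θ}† O U_{x,θ} |0ⁿ⟩`. This entry of a self-adjoint
matrix is a real number. -/
def model (θ : Fin L → ℝ) (x : 𝒳) : ℝ :=
  (((W.circuit x θ)ᴴ * W.observable * W.circuit x θ) 0 0).re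

/-- The partial derivative `∂_{θ_i} f_θ(x)`. -/
def partialDeriv (θ : Fin L → ℝ) (i : Fin L) (x : 𝒳) : ℝ :=
  deriv (fun t => W.model (Function.update θ i t) x) (θ i)

/-- The empirical neural tangent kernel `∇_θ f_θ(x)ᵀ ∇_θ f_θ(x')`. -/
def empiricalNTK (θ : Fin L → ℝ) (x x' : 𝒳) : ℝ :=
  ∑ i, W.partialDeriv θ i x * W.partialDeriv θ i x'

end Network

/-- The law of the parameters at initialization: iid uniform on `[0, 2π)`. -/
def initLaw (L : ℕ) : Measure (Fin L → ℝ) :=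
  Measure.pi fun _ => (volume : Measure ℝ)[|Set.Ico 0 (2 * Real.pi)]

/-- `N` samples of the `L` parameters; the entry `k : Fin 4` stands for the angle `k π / 2`. -/
abbrev Samples (N L : ℕ) := Fin N → Fin L → Fin 4

/-- The angles of a sample. -/
def angles {L : ℕ} (s : Fin L → Fin 4) : Fin L → ℝ :=
  fun i => ((s i : ℕ) : ℝ) * (Real.pi / 2)

/-- The law of `N` iid samples, each uniform on `{0, π/2, π, 3π/2}^L`. -/
def sampleLaw (N L : ℕ) : Measure (Samples N L) :=
  Measure.pi fun _ => Measure.pi fun _ => uniformOn (Set.univ : Set (Fin 4))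

namespace Network

variable {𝒳 : Type*} {n L m : ℕ} (W : Network 𝒳 n L m)

/-- The analytic neural tangent kernel `K(x, x')`. -/
def ntk (x x' : 𝒳) : ℝ := ∫ θ, W.empiricalNTK θ x x' ∂(initLaw L)

/-- The finite difference `f_{θ + (π/2) e_i}(x) - f_{θ - (π/2) e_i}(x)`. -/
def shiftDiff (θ : Fin L → ℝ) (i : Fin L) (x : 𝒳) : ℝ :=
  W.model (θ + Pi.single i (Real.pi / 2)) x - W.model (θ - Pi.single i (Real.pi / 2)) x

/-- The estimate `K̃(x, x')` of the analytic kernel from the samples `S`. -/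
def ntkEstimate {N : ℕ} (S : Samples N L) (x x' : 𝒳) : ℝ :=
  1 / (4 * (N : ℝ)) *
    ∑ j, ∑ i, W.shiftDiff (angles (S j)) i x * W.shiftDiff (angles (S j)) i x'

end Network

/-! ## The trained mean -/

section Training

variable {𝒳 : Type*} {d : ℕ}

/-- The matrix `K(X_train, X_trainᵀ)`. -/
def trainMatrix (K : 𝒳 → 𝒳 → ℝ) (X : Fin d → 𝒳) : Matrix (Fin d) (Fin d) ℝ :=
  Matrix.of fun i j => K (X i) (X j)

/-- The mean `K(x, X_trainᵀ) K_train⁻¹ (1 - e^{-t η K_train}) Y` at training time `t`, with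
learning rate `η`. -/
def meanAtTime (K : 𝒳 → 𝒳 → ℝ) (X : Fin d → 𝒳) (Y : Fin d → ℝ) (η t : ℝ) (x : 𝒳) : ℝ :=
  (fun i => K x (X i)) ⬝ᵥ
    (((trainMatrix K X)⁻¹ * (1 - NormedSpace.exp ((-(t * η)) • trainMatrix K X))) *ᵥ Y)

/-- The mean `K(x, X_trainᵀ) K_train⁻¹ Y`: this is `μ_∞(x)` for the analytic kernel and
`μ̃_∞(x)` for its estimate. -/
def meanInfty (K : 𝒳 → 𝒳 → ℝ) (X : Fin d → 𝒳) (Y : Fin d → ℝ) (x : 𝒳) : ℝ :=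
  (fun i => K x (X i)) ⬝ᵥ ((trainMatrix K X)⁻¹ *ᵥ Y)

/-- The Euclidean norm of a vector. -/
def norm₂ (v : Fin d → ℝ) : ℝ := ‖WithLp.toLp 2 v‖

/-- The operator norm of a matrix with respect to the Euclidean norm. -/
def normOp (A : Matrix (Fin d) (Fin d) ℝ) : ℝ := ‖Matrix.toEuclideanCLM (𝕜 := ℝ) A‖

/-- The upper limit of the admissible accuracies. -/
def accuracyThreshold (L m : ℕ) (Ktrain : Matrix (Fin d) (Fin d) ℝ) (Y : Fin d → ℝ) : ℝ :=
  (L : ℝ) / 2 * √(d : ℝ) * (m : ℝ) ^ 2 * norm₂ Y * normOp Ktrain⁻¹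

/-- `R = 2 L √d m² ‖K_train⁻¹ Y‖₂`. -/
def radius (L m : ℕ) (Ktrain : Matrix (Fin d) (Fin d) ℝ) (Y : Fin d → ℝ) : ℝ :=
  2 * (L : ℝ) * √(d : ℝ) * (m : ℝ) ^ 2 * norm₂ (Ktrain⁻¹ *ᵥ Y)

/-- The number of samples for accuracy `ε` and failure probability `δ`. -/
def sampleCount (L m : ℕ) (Ktrain : Matrix (Fin d) (Fin d) ℝ) (Y : Fin d → ℝ) (ε δ : ℝ) : ℝ :=
  (24 * radius L m Ktrain Y ^ 2 + 4 * radius L m Ktrain Y * ε) / (3 * ε ^ 2) *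
      Real.log (2 * (1 + (d : ℝ)) / δ) +
    2 * (1 + √2) ^ 4 * (L : ℝ) ^ 4 * (d : ℝ) ^ 3 * (m : ℝ) ^ 8 * normOp Ktrain⁻¹ ^ 4 *
        norm₂ Y ^ 2 / (3 * ε ^ 2) *
      Real.log (4 * (d : ℝ) / δ)

end Training

/-! ## A probabilistic real random access machine with a step count

The memory consists of index registers (natural numbers, changed only by copying, by `± 1` and by
loops), of arrays of bits and of arrays of reals. A cell of an array is addressed by a fixed-length
tuple of index registers and constants. A program is a fixed finite text; every elementary
operation costs one step: a Boolean gate, an arithmetic operation or comparison of reals, an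
operation on an index register, a random draw, a branching, and the control of each round of a
loop. -/

namespace RealRAM

/-- An index: a constant or the content of an index register. -/
inductive Ix where
  | const (k : ℕ)
  | reg (v : ℕ)

/-- A cell of an array: the number of the array and the address of the cell in it. -/
structure Cell where
  arr : ℕ
  adr : List Ix

/-- The arithmetic operations on reals. -/
inductive Arith where
  | add | sub | mul | div

/-- Programs. -/
inductive Prog where
  | skip
  | seq (p q : Prog)
  /-- index register `v := e` -/
  | setIdx (v : ℕ) (e : Ix)
  /-- index register `v := v + 1` -/
  | incIdx (v : ℕ)
  /-- index register `v := v - 1`, or `0` if `v = 0` -/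
  | decIdx (v : ℕ)
  /-- bit cell `a := g b c` for a Boolean gate `g` -/
  | gate (g : Bool → Bool → Bool) (a b c : Cell)
  /-- real cell `a := z` -/
  | const (a : Cell) (z : ℤ)
  /-- real cell `a := b o c` -/
  | arith (o : Arith) (a b c : Cell)
  /-- bit cell `a := (b < c)` for real cells `b`, `c` -/
  | less (a b c : Cell)
  /-- draw a random element of `{0, 1, 2, 3}` and write its binary digits into the bit cells
  `a` (units) and `b` (twos) -/
  | draw (a b : Cell)
  | ifBit (a : Cell) (p q : Prog)
  /-- branch on `e < f` for indices `e`, `f` -/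
  | ifIdx (e f : Ix) (p q : Prog)
  /-- `for v = 0, …, e - 1 do p`, where `e` is evaluated once, at the start -/
  | loop (v : ℕ) (e : Ix) (p : Prog)

/-- The memory. -/
structure Mem where
  idx : ℕ → ℕ
  bit : ℕ → List ℕ → Bool
  real : ℕ → List ℕ → ℝ

/-- The memory, with the number of random draws and the number of steps made so far. -/
structure State extends Mem where
  draws : ℕ
  steps : ℕ

/-- Value of an index. -/
def Ix.eval (s : State) : Ix → ℕ
  | .const k => k
  | .reg v => s.idx v

/-- Address of a cell. -/
def Cell.eval (s : State) (a : Cell) : List ℕ := a.adr.map (Ix.eval s)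

/-- The operations on reals; division by `0` returns `0`. -/
def Arith.eval : Arith → ℝ → ℝ → ℝ
  | .add, r, r' => r + r'
  | .sub, r, r' => r - r'
  | .mul, r, r' => r * r'
  | .div, r, r' => r / r'

namespace State

def tick (s : State) : State := { s with steps := s.steps + 1 }

def setIdx (s : State) (v k : ℕ) : State := { s with idx := Function.update s.idx v k }

def getBit (s : State) (a : Cell) : Bool := s.bit a.arr (a.eval s)

def getReal (s : State) (a : Cell) : ℝ := s.real a.arr (a.eval s)

def setBit (s : State) (a : Cell) (b : Bool) : State :=
  { s with bit := Function.update s.bit a.arr (Function.update (s.bit a.arr) (a.eval s) b) }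

def setReal (s : State) (a : Cell) (r : ℝ) : State :=
  { s with real := Function.update s.real a.arr (Function.update (s.real a.arr) (a.eval s) r) }

end State

open Classical in
/-- Execution of a program when the sequence of random draws is `ω`. -/
def run (ω : ℕ → Fin 4) : Prog → State → State
  | .skip, s => s
  | .seq p q, s => run ω q (run ω p s)
  | .setIdx v e, s => (s.setIdx v (e.eval s)).tick
  | .incIdx v, s => (s.setIdx v (s.idx v + 1)).tick
  | .decIdx v, s => (s.setIdx v (s.idx v - 1)).tick
  | .gate g a b c, s => (s.setBit a (g (s.getBit b) (s.getBit c))).tick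
  | .const a z, s => (s.setReal a (z : ℝ)).tick
  | .arith o a b c, s => (s.setReal a (o.eval (s.getReal b) (s.getReal c))).tick
  | .less a b c, s => (s.setBit a (decide (s.getReal b < s.getReal c))).tick
  | .draw a b, s =>
      let k := ω s.draws
      let s' := (s.setBit a (Nat.testBit k 0)).setBit b (Nat.testBit k 1)
      { s' with draws := s.draws + 1 }.tick
  | .ifBit a p q, s => if s.getBit a = true then run ω p s.tick else run ω q s.tick
  | .ifIdx e f p q, s => if e.eval s < f.eval s then run ω p s.tick else run ω q s.tick
  | .loop v e p, s =>
      (List.range (e.eval s)).foldl (fun s' k => run ω p (s'.setIdx v k).tick) s.tick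

/-- The initial state with a given memory. -/
def Mem.start (μ : Mem) : State := { μ with draws := 0, steps := 0 }

end RealRAM

/-! ## The input of the algorithm

A self-adjoint Pauli operator is given by a sign and by two bits `(z, x)` for each qubit.
A Clifford gate `V` is given by its tableau: the self-adjoint Pauli operators `V Z_k V†` and
`V X_k V†`, where `Z_k` and `X_k` are `σ₃` and `σ₁` on qubit `k`. -/

/-- The label of the Pauli matrix with bits `z`, `x`. -/
def pauliLabel : Bool → Bool → Fin 4
  | false, false => 0
  | false, true => 1
  | true, true => 2
  | true, false => 3

/-- The self-adjoint Pauli operator with sign bit `sgn` and bits `z`, `x`. -/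
def signedPauli {n : ℕ} (sgn : Bool) (z x : Fin n → Bool) : Op n :=
  (if sgn then (-1 : ℂ) else 1) • pauliString fun j => pauliLabel (z j) (x j)

/-- The Pauli operator that acts on qubit `k` as `σ₃` (for `g = 0`) or as `σ₁` (for `g = 1`). -/
def generator {n : ℕ} (g : Fin 2) (k : Fin n) : Op n :=
  pauliString (Function.update (fun _ => 0) k (if g = 0 then 3 else 1))

/-- The inputs whose circuits the algorithm needs: training inputs at positions `0, …, d - 1`
and the query `x` at position `d`. -/
def inputPoint {𝒳 : Type*} {d : ℕ} (X : Fin d → 𝒳) (x : 𝒳) : Fin (d + 1) → 𝒳 :=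
  Fin.snoc (α := fun _ => 𝒳) X x

/-- The memory `μ` contains a network, the training data, the number of samples and the query:
* index registers `0, …, 4`: the sizes `n, L, m, d, N`;
* bit arrays `0` and `1`: bits and signs of the tableaux of the gates `U x l`;
* bit arrays `2` and `3`: bits and signs of the generators `P l`;
* bit arrays `4` and `5`: bits and signs of the terms `Q k` of the observable;
* real arrays `0` and `1`: the coefficients `c k` and the training labels.

The rest of the memory is arbitrary. -/
structure IsInput {𝒳 : Type*} {n L m d : ℕ} (W : Network 𝒳 n L m) (X : Fin d → 𝒳)
    (Y : Fin d → ℝ) (N : ℕ) (x : 𝒳) (μ : RealRAM.Mem) : Prop where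
  size_n : μ.idx 0 = n
  size_L : μ.idx 1 = L
  size_m : μ.idx 2 = m
  size_d : μ.idx 3 = d
  size_N : μ.idx 4 = N
  tableau : ∀ (p : Fin (d + 1)) (l : Fin (L + 1)) (g : Fin 2) (k : Fin n),
    W.U (inputPoint X x p) l * generator g k * (W.U (inputPoint X x p) l)ᴴ =
      signedPauli (μ.bit 1 [p, l, g, k])
        (fun j => μ.bit 0 [p, l, g, k, 0, j]) (fun j => μ.bit 0 [p, l, g, k, 1, j])
  gen : ∀ l : Fin L,
    W.P l = signedPauli (μ.bit 3 [l]) (fun j => μ.bit 2 [l, 0, j]) (fun j => μ.bit 2 [l, 1, j])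
  obs : ∀ k : Fin m,
    W.Q k = signedPauli (μ.bit 5 [k]) (fun j => μ.bit 4 [k, 0, j]) (fun j => μ.bit 4 [k, 1, j])
  coeff : ∀ k : Fin m, μ.real 0 [k] = W.c k
  label : ∀ i : Fin d, μ.real 1 [i] = Y i

/-- The samples that consist of the first `N * L` random draws. -/
def drawnSamples (N L : ℕ) (ω : ℕ → Fin 4) : Samples N L := fun j i => ω (j * L + i)

/-- The program `A` carries out the estimation of `μ_∞` with at most
`C * (N * L ^ 2 * d * (m * n ^ 2 + d ^ 2))` elementary operations: on every input (with all sizes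
positive) and for all random draws it respects this bound, draws exactly `N` samples, and, unless the matrix
that has to be inverted is singular, leaves `μ̃_∞(x)`, computed from the drawn samples, in real array `2`. -/
def Estimates (A : RealRAM.Prog) (C : ℕ) {𝒳 : Type*} {n L m d : ℕ} (W : Network 𝒳 n L m)
    (X : Fin d → 𝒳) (Y : Fin d → ℝ) : Prop :=
  ∀ (N : ℕ) (x : 𝒳) (μ : RealRAM.Mem) (ω : ℕ → Fin 4),
    1 ≤ n → 1 ≤ L → 1 ≤ m → 1 ≤ d → 1 ≤ N → IsInput W X Y N x μ →
      (RealRAM.run ω A μ.start).steps ≤ C * (N * L ^ 2 * d * (m * n ^ 2 + d ^ 2)) ∧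
      (RealRAM.run ω A μ.start).draws = N * L ∧
      (IsUnit (trainMatrix (W.ntkEstimate (drawnSamples N L ω)) X) →
        (RealRAM.run ω A μ.start).real 2 [] =
          meanInfty (W.ntkEstimate (drawnSamples N L ω)) X Y x)

end QNTK

end

open QNTK

/-!
The proof has an analytic part, a probabilistic part and a part on the machine.

*The kernel is a finite average.* A Pauli rotation is `cos (t / 2) - i sin (t / 2) P`, so the model
function is a trigonometric polynomial of degree at most one in each parameter
(`Network.isTrigPoly_model`). This gives the parameter shift rule (`IsTrigPoly.deriv_update`), and it
makes averages of products of two such functions over the four points `0, π/2, π, 3π/2` in each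
parameter agree with averages over `[0, 2π)` (`IsTrigPoly.integral_mul_eq`). Hence the estimate of
the kernel is an unbiased mean of iid terms bounded by `L m²` (`Network.ntk_eq_integral_gridNTK`,
`Network.abs_gridNTK_le`). The training matrices of both kernels are Gram matrices, so they are
positive definite as soon as they are invertible; for the analytic kernel this gives the limit of
the trained mean (`tendsto_meanAtTime`).

*Accuracy.* Put `α = K⁻¹ Y` for the training matrix `K`. If `K'` is close enough to `K` to be
invertible, then `k' K'⁻¹ Y - k K⁻¹ Y = (k' - k) α - k' K'⁻¹ (K' - K) α`
(`isUnit_and_abs_dotProduct_inv_sub_lt`). The scalars `(k' - k) α` and `((K' - K) α) i` and the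
entries of `K' - K` are centred sample means, and Hoeffding's inequality
(`sampleLaw_abs_mean_sub_ge_le`) with a union bound gives the failure probability
(`Network.sampleLaw_failure_le`). A second union bound treats all queries at once.

*The program.* At grid angles every gate is a Clifford gate, so a term of the observable is
conjugated by the circuit within the Pauli group (`RealRAM.regOp_layers`). The operator is kept as a
phase and bits `x`, `z` of `X^x Z^z`. Conjugation `V† Q V` by a gate with known tableau needs no
inverse tableau: `Q` is multiplied by rows of the tableau until it commutes with all of them, and the
rows used spell out `V† Q V` (`RealRAM.regOp_cliffProg`); this takes `O(n²)` steps. The linear system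
is solved by orthogonalisation with respect to the bilinear form of the matrix, which needs no
pivoting because the matrix is positive definite (`Eliminated.pivot_ne_zero`), and the trained mean
does not see the factor `4 N` between the accumulated matrix and the estimate
(`RealRAM.meanInfty_smul`). Running times are bounded through a syntactic cost function
(`RealRAM.run_steps_le`), and a syntactic frame rule (`RealRAM.frame_run`) says what a program leaves
unchanged.

Memory beyond the input. Index registers: `5` the number `d + 1` of input points, `6` the sample,
`7` the differentiated parameter, `8` the input point, `9` the term of the observable, `10` and `11`
the layer, `12` and `13` qubits, `14` to `16` rows and columns. Bit arrays: `6` and `7` the samples,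
`8` to `11` phase and bits of the Pauli register, `12` and `13` the rows used by a Clifford gate, `14`
a flag, `15` and `16` scratch. Real arrays: `2` the output, `3` the value of the model function, `4`
the finite differences, `5` scratch, `6` the accumulated kernel, `7` the orthogonalised vectors, `8`
and `9` the pivot and the coefficient of an elimination step.
-/

noncomputable section

namespace QNTK

/-! ### Pauli operators in symplectic form -/

/-- The tensor product `A 0 ⊗ ⋯ ⊗ A (n-1)` of single-qubit operators. -/
def tens {n : ℕ} (A : Fin n → Matrix (Fin 2) (Fin 2) ℂ) : Op n :=
  Matrix.of fun a b => ∏ j, A j (a j) (b j)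

theorem tens_mul {n : ℕ} (A B : Fin n → Matrix (Fin 2) (Fin 2) ℂ) :
    tens A * tens B = tens fun j => A j * B j := by
  ext a b
  simp only [tens, Matrix.mul_apply, Matrix.of_apply, ← Finset.prod_mul_distrib]
  rw [Finset.prod_univ_sum, Fintype.piFinset_univ]

theorem tens_smul {n : ℕ} (c : Fin n → ℂ) (A : Fin n → Matrix (Fin 2) (Fin 2) ℂ) :
    (tens fun j => c j • A j) = (∏ j, c j) • tens A := by
  ext a b
  simp [tens, Finset.prod_mul_distrib]

theorem tens_one {n : ℕ} : tens (fun _ : Fin n => (1 : Matrix (Fin 2) (Fin 2) ℂ)) = 1 := by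
  ext a b
  simp only [tens, Matrix.of_apply, Matrix.one_apply, Finset.prod_ite_zero, Finset.mem_univ,
    true_implies, Finset.prod_const_one, funext_iff]

theorem tens_conjTranspose {n : ℕ} (A : Fin n → Matrix (Fin 2) (Fin 2) ℂ) :
    (tens A)ᴴ = tens fun j => (A j)ᴴ := by
  ext a b
  simp [tens, Matrix.conjTranspose_apply]

/-- `(-1)^b`. -/
def sg (b : Bool) : ℂ := if b then -1 else 1

/-- `i^b`. -/
def ipow (b : Bool) : ℂ := if b then Complex.I else 1

/-- The phase `i^(u + 2 w)`. -/
def phase (u w : Bool) : ℂ := ipow u * sg w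

theorem phase_xor_sign (u w c : Bool) : phase u (xor w c) = phase u w * sg c := by
  cases u <;> cases w <;> cases c <;> simp [phase, sg, ipow]

theorem phase_xor_i (u w c : Bool) : phase (xor u c) (xor w (u && c)) = phase u w * ipow c := by
  cases u <;> cases w <;> cases c <;> simp [phase, sg, ipow]

theorem phase_ne_zero (u w : Bool) : phase u w ≠ 0 := by
  cases u <;> cases w <;> simp [phase, sg, ipow]

/-- The single-qubit operator `X^x Z^z`. -/
def xzMatrix : Bool → Bool → Matrix (Fin 2) (Fin 2) ℂ
  | false, false => !![1, 0; 0, 1]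
  | false, true => !![1, 0; 0, -1]
  | true, false => !![0, 1; 1, 0]
  | true, true => !![0, -1; 1, 0]

/-- The order `X` before `Z` is a normal form; the sign comes from moving `Z` past `X`. -/
theorem xzMatrix_mul (x z x' z' : Bool) :
    xzMatrix x z * xzMatrix x' z' = sg (z && x') • xzMatrix (xor x x') (xor z z') := by
  cases x <;> cases z <;> cases x' <;> cases z' <;> simp [xzMatrix, sg]

theorem pauli_pauliLabel (z x : Bool) :
    pauli (pauliLabel z x) = ipow (x && z) • xzMatrix x z := by
  cases x <;> cases z <;> simp [xzMatrix, ipow, pauli, pauliLabel]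

theorem pauli_mul_self (s : Fin 4) : pauli s * pauli s = 1 := by
  fin_cases s <;> simp [pauli, Matrix.one_fin_two]

theorem pauli_conjTranspose (s : Fin 4) : (pauli s)ᴴ = pauli s := by
  fin_cases s <;> ext i j <;> fin_cases i <;> fin_cases j <;>
    simp [pauli, Matrix.conjTranspose_apply]

theorem pauliString_eq_tens {n : ℕ} (s : Fin n → Fin 4) :
    pauliString s = tens fun j => pauli (s j) := rfl

theorem pauliString_mul_self {n : ℕ} (s : Fin n → Fin 4) : pauliString s * pauliString s = 1 := by
  simp [pauliString_eq_tens, tens_mul, pauli_mul_self, tens_one]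

theorem pauliString_conjTranspose {n : ℕ} (s : Fin n → Fin 4) :
    (pauliString s)ᴴ = pauliString s := by
  simp [pauliString_eq_tens, tens_conjTranspose, pauli_conjTranspose]

theorem mul_self_of_mem_pauliGroup {n : ℕ} {P : Op n} (h : P ∈ pauliGroup n)
    (hP : P.IsHermitian) : P * P = 1 := by
  obtain ⟨u, hu, s, rfl⟩ := h
  nth_rw 1 [← hP.eq]
  rw [Matrix.conjTranspose_smul, pauliString_conjTranspose, Matrix.smul_mul, Matrix.mul_smul,
    pauliString_mul_self, smul_smul]
  rcases hu with rfl | rfl | rfl | rfl <;> simp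

theorem mem_unitary_of_mem_pauliGroup {n : ℕ} {P : Op n} (h : P ∈ pauliGroup n)
    (hP : P.IsHermitian) : P ∈ Matrix.unitaryGroup (Fin n → Fin 2) ℂ := by
  rw [Matrix.mem_unitaryGroup_iff, Matrix.star_eq_conjTranspose, hP.eq,
    mul_self_of_mem_pauliGroup h hP]

/-- The operator `X^x Z^z = X^{x 0} Z^{z 0} ⊗ ⋯ ⊗ X^{x (n-1)} Z^{z (n-1)}`. -/
def xzOp {n : ℕ} (x z : Fin n → Bool) : Op n := tens fun j => xzMatrix (x j) (z j)

theorem xzOp_mul {n : ℕ} (x z x' z' : Fin n → Bool) :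
    xzOp x z * xzOp x' z' =
      (∏ j, sg (z j && x' j)) • xzOp (fun j => xor (x j) (x' j)) (fun j => xor (z j) (z' j)) := by
  simp only [xzOp, tens_mul, xzMatrix_mul, tens_smul]

theorem xzOp_false {n : ℕ} : xzOp (fun _ : Fin n => false) (fun _ => false) = 1 := by
  simp only [xzOp, xzMatrix, ← Matrix.one_fin_two, tens_one]

theorem signedPauli_eq {n : ℕ} (sgn : Bool) (z x : Fin n → Bool) :
    signedPauli sgn z x = (sg sgn * ∏ j, ipow (x j && z j)) • xzOp x z := by
  simp only [signedPauli, pauliString_eq_tens, pauli_pauliLabel, tens_smul, smul_smul, xzOp, sg]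

theorem signedPauli_mul_self {n : ℕ} (sgn : Bool) (z x : Fin n → Bool) :
    signedPauli sgn z x * signedPauli sgn z x = 1 := by
  simp only [signedPauli, Matrix.smul_mul, Matrix.mul_smul, pauliString_mul_self, smul_smul]
  cases sgn <;> simp

theorem xzOp_mul_signedPauli {n : ℕ} (x z : Fin n → Bool) (sgn : Bool) (z' x' : Fin n → Bool) :
    xzOp x z * signedPauli sgn z' x' =
      (sg sgn * ∏ j, (ipow (x' j && z' j) * sg (z j && x' j))) •
        xzOp (fun j => xor (x j) (x' j)) (fun j => xor (z j) (z' j)) := by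
  rw [signedPauli_eq, Matrix.mul_smul, xzOp_mul, smul_smul, Finset.prod_mul_distrib, mul_assoc]

/-- The commutation sign of two Pauli operators is given by the symplectic form of their bits. -/
theorem xzOp_mul_signedPauli_comm {n : ℕ} (x z : Fin n → Bool) (sgn : Bool)
    (z' x' : Fin n → Bool) :
    xzOp x z * signedPauli sgn z' x' =
      (∏ j, sg (xor (x j && z' j) (z j && x' j))) • (signedPauli sgn z' x' * xzOp x z) := by
  have h : ∀ j, sg (z j && x' j) = sg (xor (x j && z' j) (z j && x' j)) * sg (z' j && x j) := by
    intro j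
    cases x j <;> cases z j <;> cases x' j <;> cases z' j <;> simp [sg]
  simp only [signedPauli_eq, Matrix.mul_smul, Matrix.smul_mul, xzOp_mul, smul_smul]
  congr 1
  · rw [Finset.prod_congr rfl fun j _ => h j, Finset.prod_mul_distrib]
    ring
  · congr 1 <;> funext j <;> apply Bool.xor_comm

theorem xzMatrix_apply (x z : Bool) (a b : Fin 2) :
    xzMatrix x z a b = if a = b + (if x then 1 else 0) then sg (z && b == 1) else 0 := by
  cases x <;> cases z <;> fin_cases a <;> fin_cases b <;> simp [xzMatrix, sg]

theorem xzOp_apply {n : ℕ} (x z : Fin n → Bool) (a b : Fin n → Fin 2) :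
    xzOp x z a b = if a = b + (fun j => if x j then 1 else 0) then
      ∏ j, sg (z j && b j == 1) else 0 := by
  simp only [xzOp, tens, Matrix.of_apply, xzMatrix_apply, Finset.prod_ite_zero, Finset.mem_univ,
    true_implies, funext_iff, Pi.add_apply]

theorem xzOp_zero_zero {n : ℕ} (x z : Fin n → Bool) :
    xzOp x z 0 0 = if ∀ j, x j = false then 1 else 0 := by
  have e : (0 : Fin n → Fin 2) = 0 + (fun j => if x j then 1 else 0) ↔ ∀ j, x j = false := by
    rw [zero_add, funext_iff]
    refine forall_congr' fun j => ?_
    cases x j <;> simp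
  rw [xzOp_apply, if_congr e rfl rfl]
  simp [sg]

theorem generator_zero {n : ℕ} (k : Fin n) :
    generator 0 k = xzOp (fun _ => false) (Function.update (fun _ => false) k true) := by
  rw [generator, pauliString_eq_tens, xzOp]
  congr 1
  funext j
  by_cases h : j = k
  · subst h; simp [pauli, xzMatrix]
  · simp [h, pauli, xzMatrix]

theorem generator_one {n : ℕ} (k : Fin n) :
    generator 1 k = xzOp (Function.update (fun _ => false) k true) (fun _ => false) := by
  rw [generator, pauliString_eq_tens, xzOp]
  congr 1
  funext j
  by_cases h : j = k
  · subst h; simp [pauli, xzMatrix]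
  · simp [h, pauli, xzMatrix]

/-- The Pauli generators have trivial commutant: an operator that commutes with all `Z_k` is
diagonal, and if it also commutes with all `X_k`, its diagonal is constant. -/
theorem eq_smul_one_of_commute_generator {n : ℕ} (M : Op n)
    (h : ∀ g k, M * generator g k = generator g k * M) : M = M 0 0 • (1 : Op n) := by
  have hoff : ∀ a b, a ≠ b → M a b = 0 := by
    intro a b hab
    obtain ⟨k, hk⟩ := Function.ne_iff.1 hab
    have hz : ∀ c d : Fin n → Fin 2, generator 0 k c d = if c = d then sg (d k == 1) else 0 := by
      intro c d
      rw [generator_zero, xzOp_apply]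
      have h0 : (fun _ : Fin n => if (false : Bool) = true then (1 : Fin 2) else 0) = 0 := by
        funext; simp
      rw [h0, add_zero]
      congr 1
      rw [Finset.prod_eq_single k (fun j _ hj => by simp [hj, sg]) (by simp)]
      simp
    have := congrFun (congrFun (h 0 k) a) b
    simp only [Matrix.mul_apply, hz, mul_ite, mul_zero, ite_mul, zero_mul, Finset.sum_ite_eq',
      Finset.sum_ite_eq, Finset.mem_univ, if_true] at this
    generalize a k = u at *
    generalize b k = v at *
    fin_cases u <;> fin_cases v <;> simp [sg] at hk this <;>
      simpa [self_eq_neg, neg_eq_self] using this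
  have hx : ∀ (k : Fin n) (a : Fin n → Fin 2), M (a + Pi.single k 1) (a + Pi.single k 1) = M a a := by
    intro k a
    have hg : ∀ c d : Fin n → Fin 2, generator 1 k c d = if c = d + Pi.single k 1 then 1 else 0 := by
      intro c d
      rw [generator_one, xzOp_apply]
      have h0 : (fun j : Fin n => if Function.update (fun _ => false) k true j = true then
          (1 : Fin 2) else 0) = Pi.single k 1 := by
        funext j
        by_cases hj : j = k
        · subst hj; simp
        · simp [hj]
      rw [h0]
      simp [sg]
    have h2 : ∀ e : Fin n → Fin 2, e + e = 0 := by
      intro e; funext j; simp only [Pi.add_apply, Pi.zero_apply]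
      generalize e j = v; fin_cases v <;> rfl
    have := congrFun (congrFun (h 1 k) (a + Pi.single k 1)) a
    simp only [Matrix.mul_apply, hg, mul_ite, mul_zero, ite_mul, zero_mul, mul_one, one_mul,
      Finset.sum_ite_eq', Finset.mem_univ, if_true, add_left_inj, Finset.sum_ite_eq] at this
    exact this
  have hd : ∀ s : Finset (Fin n), M (fun j => if j ∈ s then 1 else 0) (fun j => if j ∈ s then 1 else 0)
      = M 0 0 := by
    intro s
    induction s using Finset.induction_on with
    | empty => simp; rfl
    | insert k s hk ih =>
      rw [← ih, ← hx k]
      congr 1 <;>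
      · funext j
        by_cases hj : j = k
        · subst hj; simp [hk]
        · simp [hj]
  ext a b
  by_cases hab : a = b
  · subst hab
    have ha : a = fun j => if j ∈ Finset.univ.filter (fun j => a j = 1) then 1 else 0 := by
      funext j
      simp only [Finset.mem_filter, Finset.mem_univ, true_and]
      generalize a j = v; fin_cases v <;> simp
    have := hd (Finset.univ.filter (fun j => a j = 1))
    rw [← ha] at this
    simp [this]
  · simp [hoff a b hab, hab]

/-- If a Pauli operator commutes with all conjugates `V Z_k V†` and `V X_k V†` of the generators, it
is a scalar; then its bits vanish, and the scalar is its phase. -/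
theorem smul_xzOp_eq_of_commute {n : ℕ} (V : Op n) (hV : V ∈ Matrix.unitaryGroup (Fin n → Fin 2) ℂ)
    (c : ℂ) (x z : Fin n → Bool)
    (h : ∀ g k, (xzOp x z) * (V * generator g k * Vᴴ) = (V * generator g k * Vᴴ) * xzOp x z)
    : c • xzOp x z = c • (1 : Op n) := by
  have h1 : Vᴴ * V = 1 := (Matrix.mem_unitaryGroup_iff').1 hV
  have h2 : V * Vᴴ = 1 := (Matrix.mem_unitaryGroup_iff).1 hV
  have h3 := eq_smul_one_of_commute_generator (Vᴴ * xzOp x z * V) (by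
    intro g k
    have e := congrArg (fun A => Vᴴ * A * V) (h g k)
    calc Vᴴ * xzOp x z * V * generator g k
        = Vᴴ * xzOp x z * V * generator g k * (Vᴴ * V) := by rw [h1, mul_one]
      _ = Vᴴ * (xzOp x z * (V * generator g k * Vᴴ)) * V := by simp only [mul_assoc]
      _ = Vᴴ * (V * generator g k * Vᴴ * xzOp x z) * V := e
      _ = (Vᴴ * V) * (generator g k * (Vᴴ * xzOp x z * V)) := by simp only [mul_assoc]
      _ = _ := by rw [h1, one_mul])
  set l := (Vᴴ * xzOp x z * V) 0 0 with hl
  have h4 : xzOp x z = l • (1 : Op n) := by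
    calc xzOp x z = (V * Vᴴ) * xzOp x z * (V * Vᴴ) := by rw [h2, one_mul, mul_one]
      _ = V * (Vᴴ * xzOp x z * V) * Vᴴ := by simp only [mul_assoc]
      _ = _ := by rw [h3, Matrix.mul_smul, mul_one, Matrix.smul_mul, h2]
  have hx : l ≠ 0 := by
    intro h0
    rw [h0, zero_smul] at h4
    have : xzOp x z (0 + fun j => if x j then 1 else 0) 0 = 0 := by rw [h4]; rfl
    rw [xzOp_apply, if_pos rfl] at this
    simp [sg] at this
  have h5 := congrFun (congrFun h4 0) 0
  rw [xzOp_zero_zero] at h5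
  simp only [Matrix.smul_apply, Matrix.one_apply_eq, smul_eq_mul, mul_one] at h5
  split_ifs at h5
  · rw [h4, ← h5, one_smul]
  · exact absurd h5.symm hx

/-- The operator `A^b`. -/
def bpow {n : ℕ} (b : Bool) (A : Op n) : Op n := if b then A else 1

/-- Setting the bits of qubit `k` amounts to multiplication by the generators of that qubit, without a
phase in this order of the factors. -/
theorem bpow_mul_bpow_mul_xzOp {n : ℕ} (x z : Fin n → Bool) (k : Fin n) (hx : x k = false)
    (hz : z k = false) (a b : Bool) :
    bpow b (generator 1 k) * bpow a (generator 0 k) * xzOp x z =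
      xzOp (Function.update x k b) (Function.update z k a) := by
  have e1 : bpow b (generator 1 k) =
      xzOp (Function.update (fun _ => false) k b) (fun _ => false) := by
    cases b
    · simp [bpow, xzOp_false]
    · simp [bpow, generator_one]
  have e0 : bpow a (generator 0 k) =
      xzOp (fun _ => false) (Function.update (fun _ => false) k a) := by
    cases a
    · simp [bpow, xzOp_false]
    · simp [bpow, generator_zero]
  rw [e1, e0, xzOp_mul, Matrix.smul_mul, xzOp_mul, smul_smul]
  have p1 : ∏ j : Fin n, sg (false && false) = 1 := by simp [sg]
  have p2 : ∏ j : Fin n, sg ((xor false (Function.update (fun _ => false) k a j)) && x j) = 1 := by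
    apply Finset.prod_eq_one
    intro j _
    by_cases hj : j = k
    · subst hj; simp [hx, sg]
    · simp [hj, sg]
  rw [p1, p2, mul_one, one_smul]
  congr 1 <;> funext j <;> by_cases hj : j = k <;> simp [hj, hx, hz]

/-! ### Rotations -/

/-- Euler's formula for the exponential of an involution, from the even and the odd part of the
series. -/
theorem rotation_eq {n : ℕ} {P : Op n} (hP : P * P = 1) (t : ℝ) :
    rotation P t = ((Real.cos (t / 2) : ℝ) : ℂ) • (1 : Op n) +
      (-(Complex.I * (Real.sin (t / 2) : ℝ))) • P := by
  have he : ∀ k, P ^ (2 * k) = 1 := fun k => by rw [pow_mul, pow_two, hP, one_pow]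
  rw [rotation, NormedSpace.exp_eq_tsum ℂ]
  refine HasSum.tsum_eq ?_
  have hc := (Complex.hasSum_cos' (-((t : ℂ) / 2))).smul_const (1 : Op n)
  have hs := ((Complex.hasSum_sin' (-((t : ℂ) / 2))).mul_left Complex.I).smul_const P
  refine HasSum.even_add_odd ?_ ?_
  · have e : ((Real.cos (t / 2) : ℝ) : ℂ) = Complex.cos (-((t : ℂ) / 2)) := by
      push_cast
      rw [Complex.cos_neg]
    rw [e]
    refine Eq.mp (congrArg (fun f => HasSum f _) (funext fun k => ?_)) hc
    symm
    rw [smul_pow, he, smul_smul]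
    congr 1
    rw [div_eq_mul_inv, mul_comm]
    congr 2
    ring
  · have e : -(Complex.I * (Real.sin (t / 2) : ℝ)) = Complex.I * Complex.sin (-((t : ℂ) / 2)) := by
      push_cast
      rw [Complex.sin_neg]
      ring
    rw [e]
    refine Eq.mp (congrArg (fun f => HasSum f _) (funext fun k => ?_)) hs
    symm
    rw [smul_pow, pow_succ P, he, one_mul, smul_smul]
    congr 1
    rw [show -(Complex.I * ((t : ℂ) / 2)) = -((t : ℂ) / 2) * Complex.I by ring]
    field_simp [Complex.I_ne_zero]

theorem conjTranspose_rotation {n : ℕ} {P : Op n} (hP : P * P = 1) (hH : P.IsHermitian) (t : ℝ) :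
    (rotation P t)ᴴ = ((Real.cos (t / 2) : ℝ) : ℂ) • (1 : Op n) +
      (Complex.I * (Real.sin (t / 2) : ℝ)) • P := by
  rw [rotation_eq hP, Matrix.conjTranspose_add, Matrix.conjTranspose_smul,
    Matrix.conjTranspose_smul, Matrix.conjTranspose_one, hH.eq]
  simp only [RCLike.star_def, Complex.conj_ofReal, map_neg, map_mul, Complex.conj_I, neg_mul,
    neg_neg]

theorem cos_sq_add_sin_sq_complex (t : ℝ) :
    ((Real.cos t : ℝ) : ℂ) * (Real.cos t : ℝ) + ((Real.sin t : ℝ) : ℂ) * (Real.sin t : ℝ) = 1 := by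
  have := Real.cos_sq_add_sin_sq t
  rw [pow_two, pow_two] at this
  exact_mod_cast this

theorem rotation_mem_unitary {n : ℕ} {P : Op n} (hP : P * P = 1) (hH : P.IsHermitian) (t : ℝ) :
    rotation P t ∈ Matrix.unitaryGroup (Fin n → Fin 2) ℂ := by
  rw [Matrix.mem_unitaryGroup_iff, Matrix.star_eq_conjTranspose, conjTranspose_rotation hP hH,
    rotation_eq hP]
  simp only [add_mul, mul_add, Matrix.smul_mul, Matrix.mul_smul, hP, one_mul, mul_one, smul_smul]
  have h1 := cos_sq_add_sin_sq_complex (t / 2)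
  generalize ((Real.cos (t / 2) : ℝ) : ℂ) = c at *
  generalize ((Real.sin (t / 2) : ℝ) : ℂ) = s at *
  have e : (c * c) • (1 : Op n) + (Complex.I * s * -(Complex.I * s)) • (1 : Op n) = 1 := by
    rw [← add_smul, show c * c + Complex.I * s * -(Complex.I * s)
      = c * c - Complex.I * Complex.I * (s * s) by ring, Complex.I_mul_I]
    rw [show c * c - -1 * (s * s) = 1 by linear_combination h1, one_smul]
  have e' : (c * -(Complex.I * s)) • P + (Complex.I * s * c) • P = 0 := by
    rw [← add_smul]; ring_nf; simp
  calc _ = ((c * c) • (1 : Op n) + (Complex.I * s * -(Complex.I * s)) • (1 : Op n)) +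
        ((c * -(Complex.I * s)) • P + (Complex.I * s * c) • P) := by
        simp only [mul_comm]; abel
    _ = 1 := by rw [e, e', add_zero]

theorem rotation_conj_of_commute {n : ℕ} {P Q : Op n} (hP : P * P = 1) (hH : P.IsHermitian)
    (h : Q * P = P * Q) (t : ℝ) : (rotation P t)ᴴ * Q * rotation P t = Q := by
  have hu := (Matrix.mem_unitaryGroup_iff').1 (rotation_mem_unitary hP hH t)
  have hc : Q * rotation P t = rotation P t * Q := by
    rw [rotation_eq hP]
    simp only [add_mul, mul_add, Matrix.smul_mul, Matrix.mul_smul, one_mul, mul_one, h]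
  rw [mul_assoc, hc, ← mul_assoc, ← Matrix.star_eq_conjTranspose, hu, one_mul]

/-- An anticommuting operator is rotated by the full angle. -/
theorem rotation_conj_of_anticommute {n : ℕ} {P Q : Op n} (hP : P * P = 1) (hH : P.IsHermitian)
    (h : Q * P = -(P * Q)) (t : ℝ) : (rotation P t)ᴴ * Q * rotation P t =
      ((Real.cos t : ℝ) : ℂ) • Q + (-(Complex.I * (Real.sin t : ℝ))) • (Q * P) := by
  have h' : P * Q = -(Q * P) := by rw [h, neg_neg]
  rw [conjTranspose_rotation hP hH, rotation_eq hP]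
  have hc : Real.cos t = Real.cos (t / 2) * Real.cos (t / 2) - Real.sin (t / 2) * Real.sin (t / 2) := by
    rw [← Real.cos_add]; ring_nf
  have hs : Real.sin t = 2 * Real.sin (t / 2) * Real.cos (t / 2) := by
    rw [← Real.sin_two_mul]; ring_nf
  rw [hc, hs]
  push_cast
  generalize Complex.cos ((t : ℂ) / 2) = c
  generalize Complex.sin ((t : ℂ) / 2) = s
  have hpq : Q * P * P = Q := by rw [mul_assoc, hP, mul_one]
  simp only [add_mul, mul_add, Matrix.smul_mul, Matrix.mul_smul, one_mul, mul_one, h', smul_smul,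
    neg_mul, hpq, smul_neg]
  match_scalars
  · linear_combination (s * s) * Complex.I_mul_I
  · ring

/-! ### The model function as a trigonometric polynomial -/

/-- Expansion of an ordered product of two-term sums. -/
theorem ofFn_sum_reverse_prod {R : Type*} [Ring R] [Algebra ℂ R] {L : ℕ} (h : Fin L → Fin 2 → ℂ)
    (A : Fin L → Fin 2 → R) :
    (List.ofFn fun l => ∑ b, h l b • A l b).reverse.prod =
      ∑ s : Fin L → Fin 2, (∏ l, h l (s l)) • (List.ofFn fun l => A l (s l)).reverse.prod := by
  induction L with
  | zero => simp
  | succ L ih =>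
    rw [List.ofFn_succ, List.reverse_cons, List.prod_append, List.prod_singleton, ih,
      ← (Fin.consEquiv fun _ => Fin 2).sum_comp, Fintype.sum_prod_type, Finset.mul_sum]
    refine Finset.sum_congr rfl fun b _ => ?_
    rw [Finset.sum_mul]
    refine Finset.sum_congr rfl fun s _ => ?_
    simp only [Fin.consEquiv_apply, Fin.prod_univ_succ, Fin.cons_zero, Fin.cons_succ,
      List.ofFn_succ, List.reverse_cons, List.prod_append, List.prod_singleton]
    rw [smul_mul_smul_comm, mul_comm]

/-- The products of half-angle functions that occur in a matrix element of a rotated operator. -/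
def trigFactor (b b' : Fin 2) (t : ℝ) : ℝ :=
  if b = b' then (if b = 0 then (1 + Real.cos t) / 2 else (1 - Real.cos t) / 2) else Real.sin t / 2

/-- Trigonometric polynomials in `L` angles that have degree at most one in each angle. -/
def IsTrigPoly {L : ℕ} (F : (Fin L → ℝ) → ℝ) : Prop :=
  ∃ a : (Fin L → Fin 2) × (Fin L → Fin 2) → ℝ,
    ∀ θ, F θ = ∑ σ, a σ * ∏ l, trigFactor (σ.1 l) (σ.2 l) (θ l)

namespace Network

variable {𝒳 : Type*} {n L m : ℕ} (W : Network 𝒳 n L m)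

theorem P_mul_self (l : Fin L) : W.P l * W.P l = 1 :=
  mul_self_of_mem_pauliGroup (W.P_mem l) (W.P_herm l)

/-- Expand each rotation into its cosine and its sine part, in the circuit and in its adjoint: the
products of half-angle functions in one parameter are the functions
`trigFactor`, up to phases. -/
theorem isTrigPoly_model (x : 𝒳) : IsTrigPoly fun θ => W.model θ x := by
  let h : ℝ → Fin 2 → ℂ := fun t b =>
    if b = 0 then ((Real.cos (t / 2) : ℝ) : ℂ) else -(Complex.I * (Real.sin (t / 2) : ℝ))
  let C : (Fin L → Fin 2) → Op n := fun s =>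
    (List.ofFn fun l : Fin L => W.U x l.succ * (if s l = 0 then 1 else W.P l)).reverse.prod * W.U x 0
  have hC : ∀ θ, W.circuit x θ = ∑ s : Fin L → Fin 2, (∏ l, h (θ l) (s l)) • C s := by
    intro θ
    have : (fun l : Fin L => W.U x l.succ * rotation (W.P l) (θ l)) = fun l : Fin L =>
        ∑ b : Fin 2, h (θ l) b • (W.U x l.succ * (if b = 0 then 1 else W.P l)) := by
      funext l
      rw [rotation_eq (W.P_mul_self l)]
      simp [h, mul_add]
    rw [circuit, this, ofFn_sum_reverse_prod (fun l => h (θ l))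
      (fun l b => W.U x l.succ * (if b = 0 then 1 else W.P l)), Finset.sum_mul]
    refine Finset.sum_congr rfl fun s _ => ?_
    rw [Matrix.smul_mul]
  -- the constant phase of the product of two half-angle functions
  let u : Fin 2 → Fin 2 → ℂ := fun b b' =>
    if b = b' then 1 else if b = 0 then -Complex.I else Complex.I
  have hu : ∀ t b b', star (h t b) * h t b' = u b b' * (trigFactor b b' t : ℝ) := by
    intro t b b'
    have hc : Real.cos t = Real.cos (t / 2) ^ 2 - Real.sin (t / 2) ^ 2 := by
      rw [← Real.cos_two_mul']; ring_nf
    have hs : Real.sin t = 2 * Real.sin (t / 2) * Real.cos (t / 2) := by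
      rw [← Real.sin_two_mul]; ring_nf
    have h1 : Real.cos (t / 2) ^ 2 = 1 - Real.sin (t / 2) ^ 2 := Real.cos_sq' _
    have h1' : Complex.cos ((t : ℂ) / 2) ^ 2 = 1 - Complex.sin ((t : ℂ) / 2) ^ 2 := by
      exact_mod_cast congrArg (fun r : ℝ => (r : ℂ)) h1
    fin_cases b <;> fin_cases b' <;>
      simp only [h, u, trigFactor, hc, hs, Fin.zero_eta, Fin.mk_one, if_true, RCLike.star_def,
        Complex.conj_ofReal, map_neg, map_mul, Complex.conj_I, Fin.isValue, one_ne_zero,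
        zero_ne_one, if_false] <;> push_cast
    · linear_combination (1 / 2 : ℂ) * h1'
    · ring
    · ring
    · linear_combination (1 / 2 : ℂ) * h1' - Complex.sin ((t : ℂ) / 2) ^ 2 * Complex.I_mul_I
  refine ⟨fun σ => ((∏ l, u (σ.1 l) (σ.2 l)) * ((C σ.1)ᴴ * W.observable * C σ.2) 0 0).re, ?_⟩
  intro θ
  simp only [model]
  rw [hC θ, Matrix.conjTranspose_sum, Finset.sum_mul, Finset.sum_mul, Fintype.sum_prod_type,
    Matrix.sum_apply, Complex.re_sum]
  refine Finset.sum_congr rfl fun s _ => ?_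
  rw [Finset.mul_sum, Matrix.sum_apply, Complex.re_sum]
  refine Finset.sum_congr rfl fun s' _ => ?_
  rw [Matrix.conjTranspose_smul, Matrix.smul_mul, Matrix.smul_mul, Matrix.mul_smul, smul_smul,
    Matrix.smul_apply, smul_eq_mul, star_prod, ← Finset.prod_mul_distrib,
    Finset.prod_congr rfl (fun l _ => hu (θ l) (s l) (s' l)), Finset.prod_mul_distrib,
    ← Complex.ofReal_prod]
  rw [show ∀ a r b : ℂ, a * r * b = r * (a * b) from fun _ _ _ => by ring, Complex.re_ofReal_mul,
    mul_comm]

theorem circuit_mem_unitary (x : 𝒳) (θ : Fin L → ℝ) :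
    W.circuit x θ ∈ Matrix.unitaryGroup (Fin n → Fin 2) ℂ := by
  refine mul_mem (Submonoid.list_prod_mem _ fun A hA => ?_) (W.U_mem x 0).1
  rw [List.mem_reverse, List.mem_ofFn] at hA
  obtain ⟨l, rfl⟩ := hA
  exact mul_mem (W.U_mem x l.succ).1 (rotation_mem_unitary (W.P_mul_self l) (W.P_herm l) _)

theorem model_eq_sum (θ : Fin L → ℝ) (x : 𝒳) :
    W.model θ x = ∑ k, W.c k * (((W.circuit x θ)ᴴ * W.Q k * W.circuit x θ) 0 0).re := by
  simp only [model, observable, Finset.mul_sum, Finset.sum_mul, Matrix.mul_smul, Matrix.smul_mul,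
    Matrix.sum_apply, Complex.re_sum, Matrix.smul_apply, smul_eq_mul, Complex.re_ofReal_mul]

theorem abs_model_le (θ : Fin L → ℝ) (x : 𝒳) : |W.model θ x| ≤ m := by
  rw [model_eq_sum]
  calc |∑ k, W.c k * (((W.circuit x θ)ᴴ * W.Q k * W.circuit x θ) 0 0).re|
      ≤ ∑ k, |W.c k * (((W.circuit x θ)ᴴ * W.Q k * W.circuit x θ) 0 0).re| :=
        Finset.abs_sum_le_sum_abs _ _
    _ ≤ ∑ _k : Fin m, (1 : ℝ) := by
        refine Finset.sum_le_sum fun k _ => ?_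
        have hc : |W.c k| ≤ 1 := abs_le.2 (W.c_mem k)
        have hV : (W.circuit x θ)ᴴ * W.Q k * W.circuit x θ ∈
            Matrix.unitaryGroup (Fin n → Fin 2) ℂ :=
          mul_mem (mul_mem (Unitary.star_mem (W.circuit_mem_unitary x θ))
            (mem_unitary_of_mem_pauliGroup (W.Q_mem k) (W.Q_herm k))) (W.circuit_mem_unitary x θ)
        have h1 := (Complex.abs_re_le_norm _).trans (entry_norm_bound_of_unitary hV 0 0)
        rw [abs_mul]
        exact mul_le_one₀ hc (abs_nonneg _) h1
    _ = m := by simp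

theorem abs_shiftDiff_le (θ : Fin L → ℝ) (i : Fin L) (x : 𝒳) : |W.shiftDiff θ i x| ≤ 2 * m := by
  have h1 := W.abs_model_le (θ + Pi.single i (Real.pi / 2)) x
  have h2 := W.abs_model_le (θ - Pi.single i (Real.pi / 2)) x
  rw [shiftDiff]
  exact (abs_sub _ _).trans (by linarith)

end Network

/-! ### Parameter shifts and exact averages over the grid -/

/-- The translates of the factors stay in the span of `1`, `cos` and `sin`. -/
theorem trigFactor_add (b b' : Fin 2) (v : ℝ) :
    ∃ A B C : ℝ, ∀ t, trigFactor b b' (t + v) = A + B * Real.cos t + C * Real.sin t := by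
  unfold trigFactor
  split_ifs
  · exact ⟨1 / 2, Real.cos v / 2, -Real.sin v / 2, fun t => by rw [Real.cos_add]; ring⟩
  · exact ⟨1 / 2, -Real.cos v / 2, Real.sin v / 2, fun t => by rw [Real.cos_add]; ring⟩
  · exact ⟨0, Real.sin v / 2, Real.cos v / 2, fun t => by rw [Real.sin_add]; ring⟩

theorem abs_trigFactor_le (b b' : Fin 2) (t : ℝ) : |trigFactor b b' t| ≤ 1 := by
  have h1 := Real.cos_le_one t
  have h2 := Real.neg_one_le_cos t
  have h3 := Real.sin_le_one t
  have h4 := Real.neg_one_le_sin t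
  unfold trigFactor
  split_ifs <;> rw [abs_le] <;> constructor <;> linarith

theorem continuous_trigFactor (b b' : Fin 2) : Continuous (trigFactor b b') := by
  unfold trigFactor
  split_ifs <;> fun_prop

/-- The parameter shift rule for a single factor. -/
theorem hasDerivAt_trigFactor (b b' : Fin 2) (t : ℝ) :
    HasDerivAt (trigFactor b b')
      ((trigFactor b b' (t + Real.pi / 2) - trigFactor b b' (t - Real.pi / 2)) / 2) t := by
  unfold trigFactor
  split_ifs
  · refine (((Real.hasDerivAt_cos t).const_add 1).div_const 2).congr_deriv ?_
    rw [Real.cos_add_pi_div_two, Real.cos_sub_pi_div_two]; ring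
  · refine (((Real.hasDerivAt_cos t).const_sub 1).div_const 2).congr_deriv ?_
    rw [Real.cos_add_pi_div_two, Real.cos_sub_pi_div_two]; ring
  · refine ((Real.hasDerivAt_sin t).div_const 2).congr_deriv ?_
    rw [Real.sin_add_pi_div_two, Real.sin_sub_pi_div_two]; ring

theorem trigFactor_add_int_mul_two_pi (b b' : Fin 2) (t : ℝ) (k : ℤ) :
    trigFactor b b' (t + k * (2 * Real.pi)) = trigFactor b b' t := by
  simp only [trigFactor, Real.cos_add_int_mul_two_pi, Real.sin_add_int_mul_two_pi]

theorem prod_comp_update {L : ℕ} (g : Fin L → ℝ → ℝ) (θ : Fin L → ℝ) (i : Fin L) (t : ℝ) :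
    ∏ l, g l (Function.update θ i t l) = g i t * ∏ l ∈ Finset.univ.erase i, g l (θ l) := by
  rw [← Finset.mul_prod_erase _ _ (Finset.mem_univ i), Function.update_self]
  congr 1
  refine Finset.prod_congr rfl fun l hl => ?_
  rw [Function.update_of_ne (Finset.ne_of_mem_erase hl)]

theorem add_single_eq_update {L : ℕ} (θ : Fin L → ℝ) (i : Fin L) (v : ℝ) :
    θ + Pi.single i v = Function.update θ i (θ i + v) := by
  funext l
  by_cases h : l = i
  · subst h; simp
  · simp [h]

theorem sub_single_eq_update {L : ℕ} (θ : Fin L → ℝ) (i : Fin L) (v : ℝ) :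
    θ - Pi.single i v = Function.update θ i (θ i - v) := by
  rw [sub_eq_add_neg, ← Pi.single_neg, add_single_eq_update, sub_eq_add_neg]

/-- The angle `e` has, under the law `μ`, the same moments up to degree two as a uniformly
distributed angle. -/
structure HasUniformMoments {Ω : Type*} [MeasurableSpace Ω] (μ : Measure Ω) (e : Ω → ℝ) : Prop where
  measurable : Measurable e
  integral_mul : ∀ A B C A' B' C' : ℝ,
    ∫ ω, (A + B * Real.cos (e ω) + C * Real.sin (e ω)) *
      (A' + B' * Real.cos (e ω) + C' * Real.sin (e ω)) ∂μ = A * A' + (B * B' + C * C') / 2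

namespace IsTrigPoly

variable {L : ℕ} {F G : (Fin L → ℝ) → ℝ}

/-- The parameter shift rule. -/
theorem deriv_update (hF : IsTrigPoly F) (θ : Fin L → ℝ) (i : Fin L) :
    deriv (fun t => F (Function.update θ i t)) (θ i) =
      (F (θ + Pi.single i (Real.pi / 2)) - F (θ - Pi.single i (Real.pi / 2))) / 2 := by
  obtain ⟨a, ha⟩ := hF
  rw [add_single_eq_update, sub_single_eq_update]
  simp only [ha]
  simp only [fun (σ : (Fin L → Fin 2) × (Fin L → Fin 2)) t =>
    prod_comp_update (fun l => trigFactor (σ.1 l) (σ.2 l)) θ i t]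
  refine HasDerivAt.deriv ?_
  rw [← Finset.sum_sub_distrib, Finset.sum_div]
  refine HasDerivAt.fun_sum fun σ _ => ?_
  refine (((hasDerivAt_trigFactor (σ.1 i) (σ.2 i) (θ i)).mul_const _).const_mul (a σ)).congr_deriv ?_
  ring

theorem eq_of_int_shift (hF : IsTrigPoly F) {θ θ' : Fin L → ℝ}
    (h : ∀ l, ∃ k : ℤ, θ' l = θ l + k * (2 * Real.pi)) : F θ' = F θ := by
  obtain ⟨a, ha⟩ := hF
  rw [ha, ha]
  refine Finset.sum_congr rfl fun σ _ => ?_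
  congr 1
  refine Finset.prod_congr rfl fun l _ => ?_
  obtain ⟨k, hk⟩ := h l
  rw [hk, trigFactor_add_int_mul_two_pi]

theorem mul_expand {Ω : Type*} {a b : (Fin L → Fin 2) × (Fin L → Fin 2) → ℝ}
    (ha : ∀ θ, F θ = ∑ σ, a σ * ∏ l, trigFactor (σ.1 l) (σ.2 l) (θ l))
    (hb : ∀ θ, G θ = ∑ σ, b σ * ∏ l, trigFactor (σ.1 l) (σ.2 l) (θ l))
    (v w : Fin L → ℝ) (e : Ω → ℝ) :
    (fun ω : Fin L → Ω => F ((fun l => e (ω l)) + v) * G ((fun l => e (ω l)) + w)) =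
      fun ω => ∑ σ, ∑ τ, (a σ * b τ) * ∏ l, (trigFactor (σ.1 l) (σ.2 l) (e (ω l) + v l) *
        trigFactor (τ.1 l) (τ.2 l) (e (ω l) + w l)) := by
  funext ω
  rw [ha, hb, Finset.sum_mul_sum]
  refine Finset.sum_congr rfl fun σ _ => Finset.sum_congr rfl fun τ _ => ?_
  rw [Finset.prod_mul_distrib]
  simp only [Pi.add_apply]
  ring

section Integral

variable {Ω : Type*} [MeasurableSpace Ω] {μ : Measure Ω} [IsProbabilityMeasure μ] {e : Ω → ℝ}

theorem integrable_trigFactor_mul (he : Measurable e) (b b' c c' : Fin 2) (v w : ℝ) :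
    Integrable (fun ω => trigFactor b b' (e ω + v) * trigFactor c c' (e ω + w)) μ := by
  refine Integrable.of_bound (C := 1) ?_ (Eventually.of_forall fun ω => ?_)
  · exact (((continuous_trigFactor b b').measurable.comp (he.add_const v)).mul
      ((continuous_trigFactor c c').measurable.comp (he.add_const w))).aestronglyMeasurable
  · rw [Real.norm_eq_abs, abs_mul]
    exact mul_le_one₀ (abs_trigFactor_le _ _ _) (abs_nonneg _) (abs_trigFactor_le _ _ _)

theorem integrable_prod_trigFactor (he : Measurable e)
    (σ τ : (Fin L → Fin 2) × (Fin L → Fin 2)) (v w : Fin L → ℝ) :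
    Integrable (fun ω : Fin L → Ω => ∏ l, (trigFactor (σ.1 l) (σ.2 l) (e (ω l) + v l) *
      trigFactor (τ.1 l) (τ.2 l) (e (ω l) + w l))) (Measure.pi fun _ => μ) :=
  Integrable.fintype_prod_dep
    (f := fun l ω => trigFactor (σ.1 l) (σ.2 l) (e ω + v l) *
      trigFactor (τ.1 l) (τ.2 l) (e ω + w l))
    fun _ => integrable_trigFactor_mul he _ _ _ _ _ _

theorem integrable_mul (hF : IsTrigPoly F) (hG : IsTrigPoly G) (he : Measurable e)
    (v w : Fin L → ℝ) :
    Integrable (fun ω : Fin L → Ω => F ((fun l => e (ω l)) + v) * G ((fun l => e (ω l)) + w))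
      (Measure.pi fun _ => μ) := by
  obtain ⟨a, ha⟩ := hF
  obtain ⟨b, hb⟩ := hG
  rw [mul_expand ha hb]
  refine integrable_finsetSum _ fun σ _ => integrable_finsetSum _ fun τ _ => Integrable.const_mul ?_ _
  exact integrable_prod_trigFactor he σ τ v w

theorem integral_expand {a b : (Fin L → Fin 2) × (Fin L → Fin 2) → ℝ}
    (ha : ∀ θ, F θ = ∑ σ, a σ * ∏ l, trigFactor (σ.1 l) (σ.2 l) (θ l))
    (hb : ∀ θ, G θ = ∑ σ, b σ * ∏ l, trigFactor (σ.1 l) (σ.2 l) (θ l))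
    (he : Measurable e) (v w : Fin L → ℝ) :
    ∫ ω : Fin L → Ω, F ((fun l => e (ω l)) + v) * G ((fun l => e (ω l)) + w)
        ∂(Measure.pi fun _ => μ) =
      ∑ σ, ∑ τ, (a σ * b τ) * ∏ l, ∫ ω, trigFactor (σ.1 l) (σ.2 l) (e ω + v l) *
        trigFactor (τ.1 l) (τ.2 l) (e ω + w l) ∂μ := by
  have hint : ∀ σ τ : (Fin L → Fin 2) × (Fin L → Fin 2), Integrable (fun ω : Fin L → Ω =>
      (a σ * b τ) * ∏ l, (trigFactor (σ.1 l) (σ.2 l) (e (ω l) + v l) *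
        trigFactor (τ.1 l) (τ.2 l) (e (ω l) + w l))) (Measure.pi fun _ => μ) := fun σ τ =>
    (integrable_prod_trigFactor he σ τ v w).const_mul _
  rw [mul_expand ha hb, integral_finsetSum _ fun σ _ => integrable_finsetSum _ fun τ _ => hint σ τ]
  refine Finset.sum_congr rfl fun σ _ => ?_
  rw [integral_finsetSum _ fun τ _ => hint σ τ]
  refine Finset.sum_congr rfl fun τ _ => ?_
  rw [integral_const_mul]
  congr 1
  exact integral_fintype_prod_eq_prod (fun l ω => trigFactor (σ.1 l) (σ.2 l) (e ω + v l) *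
    trigFactor (τ.1 l) (τ.2 l) (e ω + w l))

/-- Integrals of products of two trigonometric polynomials of degree at most one in each
variable depend on the law of an angle only through its moments up to degree two. -/
theorem integral_mul_eq {Ω' : Type*} [MeasurableSpace Ω'] {μ' : Measure Ω'}
    [IsProbabilityMeasure μ'] {e' : Ω' → ℝ} (hμ : HasUniformMoments μ e)
    (hμ' : HasUniformMoments μ' e') (hF : IsTrigPoly F) (hG : IsTrigPoly G) (v w : Fin L → ℝ) :
    ∫ ω : Fin L → Ω, F ((fun l => e (ω l)) + v) * G ((fun l => e (ω l)) + w)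
        ∂(Measure.pi fun _ => μ) =
      ∫ ω : Fin L → Ω', F ((fun l => e' (ω l)) + v) * G ((fun l => e' (ω l)) + w)
        ∂(Measure.pi fun _ => μ') := by
  obtain ⟨a, ha⟩ := hF
  obtain ⟨b, hb⟩ := hG
  rw [integral_expand ha hb hμ.measurable, integral_expand ha hb hμ'.measurable]
  refine Finset.sum_congr rfl fun σ _ => Finset.sum_congr rfl fun τ _ => ?_
  congr 1
  refine Finset.prod_congr rfl fun l _ => ?_
  obtain ⟨A, B, C, hA⟩ := trigFactor_add (σ.1 l) (σ.2 l) (v l)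
  obtain ⟨A', B', C', hA'⟩ := trigFactor_add (τ.1 l) (τ.2 l) (w l)
  simp only [hA, hA', hμ.integral_mul, hμ'.integral_mul]

end Integral

end IsTrigPoly

/-- The uniform law on `[0, 2π)`. -/
def angleLaw : Measure ℝ := (volume : Measure ℝ)[|Set.Ico 0 (2 * Real.pi)]

/-- The uniform law on the four grid points. -/
def gridLaw : Measure (Fin 4) := uniformOn (Set.univ : Set (Fin 4))

instance : IsProbabilityMeasure angleLaw := by
  refine cond_isProbabilityMeasure_of_finite ?_ ?_
  · rw [Real.volume_Ico]; simp [Real.pi_pos]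
  · rw [Real.volume_Ico]; exact ENNReal.ofReal_ne_top

instance : IsProbabilityMeasure gridLaw :=
  isProbabilityMeasure_uniformOn Set.finite_univ Set.univ_nonempty

theorem integral_angleLaw (f : ℝ → ℝ) :
    ∫ t, f t ∂angleLaw = (∫ t in (0 : ℝ)..(2 * Real.pi), f t) / (2 * Real.pi) := by
  have h2 : (0 : ℝ) ≤ 2 * Real.pi := by positivity
  rw [angleLaw, ProbabilityTheory.cond, integral_smul_measure, Real.volume_Ico, sub_zero,
    ENNReal.toReal_inv, ENNReal.toReal_ofReal h2, integral_Ico_eq_integral_Ioc,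
    intervalIntegral.integral_of_le h2, smul_eq_mul, div_eq_inv_mul]

theorem integral_gridLaw (f : Fin 4 → ℝ) : ∫ k, f k ∂gridLaw = (∑ k, f k) / 4 := by
  rw [integral_fintype (Integrable.of_finite)]
  have : ∀ k : Fin 4, gridLaw.real {k} = 1 / 4 := by
    intro k
    rw [gridLaw, measureReal_def, uniformOn_univ]
    simp
  simp only [this, smul_eq_mul, ← Finset.mul_sum]
  ring

theorem hasUniformMoments_angleLaw : HasUniformMoments angleLaw fun t => t := by
  refine ⟨measurable_id, fun A B C A' B' C' => ?_⟩
  rw [integral_angleLaw]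
  have e : ∀ t : ℝ, (A + B * Real.cos t + C * Real.sin t) * (A' + B' * Real.cos t + C' * Real.sin t) =
      A * A' + (A * B' + A' * B) * Real.cos t + (A * C' + A' * C) * Real.sin t +
      (B * B') * Real.cos t ^ 2 + (C * C') * Real.sin t ^ 2 +
      (B * C' + B' * C) * (Real.sin t * Real.cos t) := fun t => by ring
  have hi : ∀ f : ℝ → ℝ, Continuous f → IntervalIntegrable f volume 0 (2 * Real.pi) :=
    fun f hf => hf.intervalIntegrable _ _
  simp only [e]
  rw [intervalIntegral.integral_add (hi _ (by fun_prop)) (hi _ (by fun_prop)),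
    intervalIntegral.integral_add (hi _ (by fun_prop)) (hi _ (by fun_prop)),
    intervalIntegral.integral_add (hi _ (by fun_prop)) (hi _ (by fun_prop)),
    intervalIntegral.integral_add (hi _ (by fun_prop)) (hi _ (by fun_prop)),
    intervalIntegral.integral_add (hi _ (by fun_prop)) (hi _ (by fun_prop))]
  simp only [intervalIntegral.integral_const_mul, integral_cos, integral_sin, integral_cos_sq,
    integral_sin_sq, integral_sin_mul_cos₁, intervalIntegral.integral_const]
  have := Real.pi_pos
  simp only [Real.sin_two_pi, Real.cos_two_pi, Real.sin_zero, Real.cos_zero, smul_eq_mul]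
  field_simp
  ring

theorem hasUniformMoments_gridLaw :
    HasUniformMoments gridLaw fun k => ((k : ℕ) : ℝ) * (Real.pi / 2) := by
  refine ⟨measurable_of_finite _, fun A B C A' B' C' => ?_⟩
  rw [integral_gridLaw]
  have c2 : Real.cos (2 * (Real.pi / 2)) = -1 := by rw [← Real.cos_pi]; ring_nf
  have s2 : Real.sin (2 * (Real.pi / 2)) = 0 := by rw [← Real.sin_pi]; ring_nf
  have c3 : Real.cos (3 * (Real.pi / 2)) = 0 := by
    rw [show 3 * (Real.pi / 2) = Real.pi / 2 + Real.pi by ring, Real.cos_add_pi]; simp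
  have s3 : Real.sin (3 * (Real.pi / 2)) = -1 := by
    rw [show 3 * (Real.pi / 2) = Real.pi / 2 + Real.pi by ring, Real.sin_add_pi]; simp
  simp only [Fin.sum_univ_four, Fin.isValue, Fin.coe_ofNat_eq_mod, Nat.zero_mod, Nat.one_mod,
    Nat.reduceMod, Nat.cast_zero, Nat.cast_one, Nat.cast_ofNat, zero_mul, one_mul, Real.cos_zero,
    Real.sin_zero, Real.cos_pi_div_two, Real.sin_pi_div_two, c2, s2, c3, s3]
  ring

/-! ### The kernel as a finite average -/

namespace Network

variable {𝒳 : Type*} {n L m : ℕ} (W : Network 𝒳 n L m)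

theorem partialDeriv_eq (θ : Fin L → ℝ) (i : Fin L) (x : 𝒳) :
    W.partialDeriv θ i x = W.shiftDiff θ i x / 2 :=
  (W.isTrigPoly_model x).deriv_update θ i

/-- The contribution of one sample to the kernel estimate. -/
def gridNTK (s : Fin L → Fin 4) (x x' : 𝒳) : ℝ :=
  (∑ i, W.shiftDiff (angles s) i x * W.shiftDiff (angles s) i x') / 4

theorem ntkEstimate_eq {N : ℕ} (S : Samples N L) (x x' : 𝒳) :
    W.ntkEstimate S x x' = (∑ j, W.gridNTK (S j) x x') / N := by
  rw [ntkEstimate]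
  simp only [gridNTK, ← Finset.sum_div]
  rw [div_div, one_div, div_eq_inv_mul]

theorem abs_gridNTK_le (s : Fin L → Fin 4) (x x' : 𝒳) : |W.gridNTK s x x'| ≤ L * m ^ 2 := by
  have h : |∑ i, W.shiftDiff (angles s) i x * W.shiftDiff (angles s) i x'| ≤
      ∑ _i : Fin L, (2 * (m : ℝ)) * (2 * m) := by
    refine (Finset.abs_sum_le_sum_abs _ _).trans (Finset.sum_le_sum fun i _ => ?_)
    rw [abs_mul]
    exact mul_le_mul (W.abs_shiftDiff_le _ _ _) (W.abs_shiftDiff_le _ _ _) (abs_nonneg _)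
      (by positivity)
  rw [Finset.sum_const, Finset.card_univ, Fintype.card_fin, nsmul_eq_mul] at h
  rw [gridNTK, abs_div, abs_of_pos (by norm_num : (0 : ℝ) < 4), div_le_iff₀ (by norm_num)]
  linarith

/-- The average over the grid is exact: the estimate of the kernel is unbiased. -/
theorem ntk_eq_integral_gridNTK (x x' : 𝒳) :
    W.ntk x x' = ∫ s, W.gridNTK s x x' ∂(Measure.pi fun _ : Fin L => gridLaw) := by
  have hx := W.isTrigPoly_model x
  have hx' := W.isTrigPoly_model x'
  have key : ∀ {Ω : Type} [MeasurableSpace Ω] (μ : Measure Ω) [IsProbabilityMeasure μ] (e : Ω → ℝ),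
      HasUniformMoments μ e →
      ∫ ω : Fin L → Ω, (∑ i, W.shiftDiff (fun l => e (ω l)) i x *
          W.shiftDiff (fun l => e (ω l)) i x') / 4 ∂(Measure.pi fun _ => μ) =
        (∑ i, ∑ v : Bool, ∑ w : Bool, (if v = w then 1 else -1) *
          ∫ ω : Fin L → Ω, W.model ((fun l => e (ω l)) +
              (if v then Pi.single i (Real.pi / 2) else -Pi.single i (Real.pi / 2))) x *
            W.model ((fun l => e (ω l)) +
              (if w then Pi.single i (Real.pi / 2) else -Pi.single i (Real.pi / 2))) x'
            ∂(Measure.pi fun _ => μ)) / 4 := by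
    intro Ω _ μ _ e he
    have hint := fun v w => hx.integrable_mul (μ := μ) hx' he.measurable v w
    rw [integral_div]
    congr 1
    have e1 : ∀ (θ : Fin L → ℝ) (i : Fin L), W.shiftDiff θ i x * W.shiftDiff θ i x' =
        ∑ v : Bool, ∑ w : Bool, (if v = w then 1 else -1) *
          (W.model (θ + (if v then Pi.single i (Real.pi / 2) else -Pi.single i (Real.pi / 2))) x *
            W.model (θ + (if w then Pi.single i (Real.pi / 2) else
              -Pi.single i (Real.pi / 2))) x') := by
      intro θ i
      simp only [shiftDiff, Fintype.sum_bool, if_true, Bool.true_eq_false, Bool.false_eq_true,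
        if_false, sub_eq_add_neg θ]
      ring
    simp only [e1]
    rw [integral_finsetSum _ fun i _ => integrable_finsetSum _ fun v _ =>
      integrable_finsetSum _ fun w _ => (hint _ _).const_mul _]
    refine Finset.sum_congr rfl fun i _ => ?_
    rw [integral_finsetSum _ fun v _ => integrable_finsetSum _ fun w _ => (hint _ _).const_mul _]
    refine Finset.sum_congr rfl fun v _ => ?_
    rw [integral_finsetSum _ fun w _ => (hint _ _).const_mul _]
    refine Finset.sum_congr rfl fun w _ => ?_
    rw [integral_const_mul]
  have h1 : W.ntk x x' = ∫ θ : Fin L → ℝ, (∑ i, W.shiftDiff (fun l => θ l) i x *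
      W.shiftDiff (fun l => θ l) i x') / 4 ∂(Measure.pi fun _ => angleLaw) := by
    rw [ntk, initLaw]
    refine integral_congr_ae (Eventually.of_forall fun θ => ?_)
    simp only [empiricalNTK, partialDeriv_eq, Finset.sum_div]
    exact Finset.sum_congr rfl fun i _ => by ring
  have h2 := key angleLaw _ hasUniformMoments_angleLaw
  have h3 := key gridLaw _ hasUniformMoments_gridLaw
  rw [h1, h2]
  refine Eq.trans ?_ h3.symm
  congr 1
  refine Finset.sum_congr rfl fun i _ => Finset.sum_congr rfl fun v _ =>
    Finset.sum_congr rfl fun w _ => ?_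
  congr 1
  exact IsTrigPoly.integral_mul_eq hasUniformMoments_angleLaw hasUniformMoments_gridLaw hx hx' _ _

end Network

/-! ### Concentration of sample means -/

instance {L : ℕ} : IsProbabilityMeasure (Measure.pi fun _ : Fin L => gridLaw) := inferInstance

instance {N L : ℕ} : IsProbabilityMeasure (sampleLaw N L) :=
  inferInstanceAs (IsProbabilityMeasure (Measure.pi fun _ : Fin N =>
    (Measure.pi fun _ : Fin L => gridLaw)))

/-- Hoeffding's inequality for the mean of a bounded function of one sample. -/
theorem sampleLaw_abs_mean_sub_ge_le {N L : ℕ} (hN : 0 < N) (g : (Fin L → Fin 4) → ℝ) {B t : ℝ}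
    (hB : 0 < B) (ht : 0 ≤ t) (hg : ∀ s, |g s| ≤ B) :
    (sampleLaw N L).real {S | t ≤ |(∑ j, g (S j)) / N -
      ∫ s, g s ∂(Measure.pi fun _ : Fin L => gridLaw)|} ≤
      2 * Real.exp (-(N * t ^ 2 / (2 * B ^ 2))) := by
  have hN' : (0 : ℝ) < N := by exact_mod_cast hN
  have side : ∀ f : (Fin L → Fin 4) → ℝ, (∀ s, |f s| ≤ B) →
      (sampleLaw N L).real {S | N * t ≤ ∑ j, (f (S j) -
        ∫ s, f s ∂(Measure.pi fun _ : Fin L => gridLaw))} ≤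
        Real.exp (-(N * t ^ 2 / (2 * B ^ 2))) := by
    intro f hf
    set E := ∫ s, f s ∂(Measure.pi fun _ : Fin L => gridLaw) with hE
    have hsub : HasSubgaussianMGF (fun s => f s - E) ((‖B - -B‖₊ / 2) ^ 2)
        (Measure.pi fun _ : Fin L => gridLaw) :=
      hasSubgaussianMGF_of_mem_Icc (measurable_of_finite f).aemeasurable
        (Eventually.of_forall fun s => abs_le.1 (hf s))
    have hind : iIndepFun (fun (j : Fin N) (S : Samples N L) => f (S j) - E) (sampleLaw N L) :=
      iIndepFun_pi (X := fun _ s => f s - E) fun _ => (measurable_of_finite _).aemeasurable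
    have hj : ∀ j ∈ (Finset.univ : Finset (Fin N)), HasSubgaussianMGF
        (fun S : Samples N L => f (S j) - E) ((‖B - -B‖₊ / 2) ^ 2) (sampleLaw N L) := by
      intro j _
      have hmp : MeasurePreserving (fun S : Samples N L => S j) (sampleLaw N L)
          (Measure.pi fun _ : Fin L => gridLaw) := measurePreserving_eval _ j
      refine HasSubgaussianMGF.of_map (Y := fun S : Samples N L => S j) (X := fun s => f s - E)
        hmp.measurable.aemeasurable ?_
      rw [hmp.map_eq]
      exact hsub
    refine (HasSubgaussianMGF.measure_sum_ge_le_of_iIndepFun hind hj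
      (by positivity : (0 : ℝ) ≤ N * t)).trans (Real.exp_le_exp.2 (le_of_eq ?_))
    have hb : ‖B - -B‖ = 2 * B := by
      rw [sub_neg_eq_add, Real.norm_of_nonneg (by positivity)]; ring
    simp only [Finset.sum_const, Finset.card_univ, Fintype.card_fin, nsmul_eq_mul]
    push_cast
    rw [hb]
    field_simp
  have h1 := side g hg
  have h2 := side (fun s => -g s) (fun s => by rw [abs_neg]; exact hg s)
  rw [two_mul]
  refine le_trans (le_trans (measureReal_mono ?_) (measureReal_union_le _ _)) (add_le_add h1 h2)
  intro S hS
  simp only [Set.mem_ofPred_eq] at hS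
  simp only [Set.mem_union, Set.mem_ofPred_eq, Finset.sum_sub_distrib, Finset.sum_const,
    Finset.card_univ, Fintype.card_fin, nsmul_eq_mul, integral_neg, Finset.sum_neg_distrib]
  have hdiv : (∑ j, g (S j)) = N * ((∑ j, g (S j)) / N) := by field_simp
  rcases le_abs.1 hS with h | h
  · left
    rw [hdiv, ← mul_sub]
    exact mul_le_mul_of_nonneg_left h hN'.le
  · right
    rw [hdiv, show ∀ a b : ℝ, -(N * a) - N * -b = N * -(a - b) from fun _ _ => by ring]
    exact mul_le_mul_of_nonneg_left h hN'.le

/-! ### Perturbation of the trained mean -/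

section Norm

variable {d : ℕ}

theorem norm₂_nonneg (v : Fin d → ℝ) : 0 ≤ norm₂ v := norm_nonneg _

theorem norm₂_add_le (u v : Fin d → ℝ) : norm₂ (u + v) ≤ norm₂ u + norm₂ v := by
  rw [norm₂, WithLp.toLp_add]
  exact norm_add_le _ _

theorem norm₂_eq_zero {v : Fin d → ℝ} : norm₂ v = 0 ↔ v = 0 := by
  rw [norm₂, norm_eq_zero, WithLp.toLp_eq_zero]

theorem norm₂_eq_sqrt (v : Fin d → ℝ) : norm₂ v = √(∑ i, v i ^ 2) := by
  rw [norm₂, EuclideanSpace.norm_eq]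
  simp

theorem abs_dotProduct_le (u v : Fin d → ℝ) : |u ⬝ᵥ v| ≤ norm₂ u * norm₂ v := by
  have := abs_real_inner_le_norm (WithLp.toLp 2 v) (WithLp.toLp 2 u)
  rw [EuclideanSpace.inner_toLp_toLp, mul_comm] at this
  simpa [norm₂] using this

theorem norm₂_le {v : Fin d → ℝ} {B : ℝ} (hB : 0 ≤ B) (h : ∀ i, |v i| ≤ B) :
    norm₂ v ≤ √d * B := by
  rw [norm₂_eq_sqrt]
  calc √(∑ i, v i ^ 2) ≤ √(∑ _i : Fin d, B ^ 2) :=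
        Real.sqrt_le_sqrt (Finset.sum_le_sum fun i _ => sq_le_sq.2 (by rw [abs_of_nonneg hB]; exact h i))
    _ = √d * B := by
        rw [Finset.sum_const, Finset.card_univ, Fintype.card_fin, nsmul_eq_mul,
          Real.sqrt_mul (Nat.cast_nonneg d), Real.sqrt_sq hB]

theorem norm₂_mulVec_le_normOp (A : Matrix (Fin d) (Fin d) ℝ) (v : Fin d → ℝ) :
    norm₂ (A *ᵥ v) ≤ normOp A * norm₂ v := by
  have := (Matrix.toEuclideanCLM (𝕜 := ℝ) A).le_opNorm (WithLp.toLp 2 v)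
  rwa [Matrix.toEuclideanCLM_toLp] at this

theorem norm₂_mulVec_le {E : Matrix (Fin d) (Fin d) ℝ} {s : ℝ} (hs : 0 ≤ s)
    (h : ∀ i l, |E i l| ≤ s) (v : Fin d → ℝ) : norm₂ (E *ᵥ v) ≤ d * s * norm₂ v := by
  have h0 := norm₂_nonneg v
  have hd : √(d : ℝ) * √d = d := Real.mul_self_sqrt (Nat.cast_nonneg d)
  have h1 : ∀ i, |(E *ᵥ v) i| ≤ √d * s * norm₂ v := fun i =>
    (abs_dotProduct_le _ _).trans (mul_le_mul_of_nonneg_right (norm₂_le hs (h i)) h0)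
  refine (norm₂_le (by positivity) h1).trans (le_of_eq ?_)
  calc √(d : ℝ) * (√d * s * norm₂ v) = (√d * √d) * s * norm₂ v := by ring
    _ = _ := by rw [hd]

/-- First-order perturbation of `k ⬝ᵥ (K⁻¹ *ᵥ Y)`: the perturbation of the matrix enters only
through its action on `K⁻¹ *ᵥ Y`, once it is small enough to keep the matrix invertible. -/
theorem isUnit_and_abs_dotProduct_inv_sub_lt {K K' : Matrix (Fin d) (Fin d) ℝ} {k k' Y : Fin d → ℝ}
    {M ε : ℝ} (hd : 0 < d) (hM : 0 < M) (hK : IsUnit K) (hκ : 0 < normOp K⁻¹)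
    (h1 : |(k' - k) ⬝ᵥ (K⁻¹ *ᵥ Y)| < ε / 2)
    (h2 : ∀ i, |((K' - K) *ᵥ (K⁻¹ *ᵥ Y)) i| ≤ ε / (3 * d * M * normOp K⁻¹))
    (h3 : ∀ i l, |(K' - K) i l| ≤ 1 / (3 * d * normOp K⁻¹)) (h4 : ∀ i, |k' i| ≤ M) :
    IsUnit K' ∧ |k' ⬝ᵥ (K'⁻¹ *ᵥ Y) - k ⬝ᵥ (K⁻¹ *ᵥ Y)| < ε := by
  have hdet : IsUnit K.det := (Matrix.isUnit_iff_isUnit_det K).1 hK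
  have hε : 0 < ε := by linarith [abs_nonneg ((k' - k) ⬝ᵥ (K⁻¹ *ᵥ Y))]
  have hd' : (0 : ℝ) < d := by exact_mod_cast hd
  set κ := normOp K⁻¹ with hκdef
  set α := K⁻¹ *ᵥ Y with hα
  have hKα : K *ᵥ α = Y := by rw [hα, Matrix.mulVec_mulVec, Matrix.mul_nonsing_inv _ hdet,
    Matrix.one_mulVec]
  have low : ∀ v, norm₂ v ≤ 3 / 2 * κ * norm₂ (K' *ᵥ v) := by
    intro v
    have hv : v = K⁻¹ *ᵥ (K' *ᵥ v) + K⁻¹ *ᵥ ((-(K' - K)) *ᵥ v) := by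
      rw [← Matrix.mulVec_add, ← Matrix.add_mulVec, Matrix.mulVec_mulVec,
        show K' + -(K' - K) = K by abel, Matrix.nonsing_inv_mul _ hdet, Matrix.one_mulVec]
    have e1 := norm₂_mulVec_le_normOp K⁻¹ (K' *ᵥ v)
    have e2 := norm₂_mulVec_le_normOp K⁻¹ ((-(K' - K)) *ᵥ v)
    have e3 := norm₂_mulVec_le (E := -(K' - K)) (s := 1 / (3 * d * κ)) (by positivity)
      (fun i l => by rw [Matrix.neg_apply, abs_neg]; exact h3 i l) v
    have e4 := norm₂_add_le (K⁻¹ *ᵥ (K' *ᵥ v)) (K⁻¹ *ᵥ ((-(K' - K)) *ᵥ v))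
    rw [← hv] at e4
    have e5 : κ * norm₂ ((-(K' - K)) *ᵥ v) ≤ norm₂ v / 3 := by
      refine (mul_le_mul_of_nonneg_left e3 hκ.le).trans (le_of_eq ?_)
      field_simp
    linarith
  have hinj : Function.Injective K'.mulVec := by
    refine (injective_iff_map_eq_zero K'.mulVecLin).2 fun v hv => ?_
    have h0 := low v
    rw [show K' *ᵥ v = 0 from hv, norm₂_eq_zero.2 rfl, mul_zero] at h0
    exact norm₂_eq_zero.1 (le_antisymm h0 (norm₂_nonneg v))
  have hU : IsUnit K' := Matrix.mulVec_injective_iff_isUnit.1 hinj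
  refine ⟨hU, ?_⟩
  have hdet' : IsUnit K'.det := (Matrix.isUnit_iff_isUnit_det K').1 hU
  set v := K'⁻¹ *ᵥ ((K' - K) *ᵥ α) with hv
  have hKv : K' *ᵥ v = (K' - K) *ᵥ α := by
    rw [hv, Matrix.mulVec_mulVec, Matrix.mul_nonsing_inv _ hdet', Matrix.one_mulVec]
  have hsol : K'⁻¹ *ᵥ Y = α - v := by
    have : Y = K' *ᵥ (α - v) := by
      rw [Matrix.mulVec_sub, hKv, Matrix.sub_mulVec, hKα]; abel
    rw [this, Matrix.mulVec_mulVec, Matrix.nonsing_inv_mul _ hdet', Matrix.one_mulVec]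
  have e : k' ⬝ᵥ (K'⁻¹ *ᵥ Y) - k ⬝ᵥ α = (k' - k) ⬝ᵥ α - k' ⬝ᵥ v := by
    rw [hsol, dotProduct_sub, sub_dotProduct]; ring
  have b1 : |k' ⬝ᵥ v| ≤ ε / 2 := by
    have c1 := norm₂_le hM.le h4
    have c2 := norm₂_le (by positivity) h2
    have c3 := low v
    rw [hKv] at c3
    have hs : √(d : ℝ) * √d = d := Real.mul_self_sqrt hd'.le
    calc |k' ⬝ᵥ v| ≤ norm₂ k' * norm₂ v := abs_dotProduct_le _ _
      _ ≤ (√d * M) * (3 / 2 * κ * (√d * (ε / (3 * d * M * κ)))) := by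
          refine mul_le_mul c1 (c3.trans ?_) (norm₂_nonneg _) (by positivity)
          exact mul_le_mul_of_nonneg_left c2 (by positivity)
      _ = (√d * √d) * (M * (3 / 2 * κ * ((ε / (3 * d * M * κ))))) := by ring
      _ = ε / 2 := by rw [hs]; field_simp
  rw [e]
  exact (abs_sub _ _).trans_lt (by linarith)

end Norm

/-! ### Positivity of the kernels and the limit of training -/

section Gram

variable {𝒳 : Type*} {d : ℕ}

theorem posSemidef_trainMatrix {K : 𝒳 → 𝒳 → ℝ} (hs : ∀ x x', K x x' = K x' x) (X : Fin d → 𝒳)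
    (h : ∀ v : Fin d → ℝ, 0 ≤ ∑ p, ∑ q, v p * v q * K (X p) (X q)) :
    (trainMatrix K X).PosSemidef := by
  refine Matrix.PosSemidef.of_dotProduct_mulVec_nonneg ?_ fun v => ?_
  · ext i j
    simp [trainMatrix, hs (X j) (X i)]
  · refine (h v).trans (le_of_eq ?_)
    simp only [dotProduct, Matrix.mulVec, trainMatrix, Matrix.of_apply, Finset.mul_sum, star_trivial]
    exact Finset.sum_congr rfl fun p _ => Finset.sum_congr rfl fun q _ => by ring

/-- In an eigenbasis the exponential is diagonal with entries `exp (-t η λ)` for eigenvalues `λ > 0`. -/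
theorem tendsto_exp_neg_smul {A : Matrix (Fin d) (Fin d) ℝ} (hA : A.PosDef) {η : ℝ} (hη : 0 < η) :
    Tendsto (fun t : ℝ => NormedSpace.exp ((-(t * η)) • A)) atTop (𝓝 0) := by
  set U : Matrix (Fin d) (Fin d) ℝ := (hA.1.eigenvectorUnitary : Matrix (Fin d) (Fin d) ℝ) with hU
  have hUU : U * star U = 1 := Unitary.coe_mul_star_self hA.1.eigenvectorUnitary
  have hinv : U⁻¹ = star U := Matrix.inv_eq_right_inv hUU
  have hunit : IsUnit U := (Matrix.isUnit_iff_isUnit_det U).2 (Matrix.isUnit_det_of_right_inverse hUU)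
  have hspec : A = U * Matrix.diagonal hA.1.eigenvalues * U⁻¹ := by
    rw [hinv]
    exact hA.1.spectral_theorem
  have e : ∀ t : ℝ, NormedSpace.exp ((-(t * η)) • A) =
      U * Matrix.diagonal (fun i => Real.exp (-(t * η) * hA.1.eigenvalues i)) * U⁻¹ := by
    intro t
    have : (-(t * η)) • A = U * Matrix.diagonal ((-(t * η)) • hA.1.eigenvalues) * U⁻¹ := by
      rw [Matrix.diagonal_smul, Matrix.mul_smul, Matrix.smul_mul, ← hspec]
    have he : NormedSpace.exp ((-(t * η)) • hA.1.eigenvalues) =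
        fun i => Real.exp (-(t * η) * hA.1.eigenvalues i) := by
      funext i
      exact (Pi.coe_exp _ i).trans (by rw [Real.exp_eq_exp_ℝ]; rfl)
    rw [this, Matrix.exp_conj _ _ hunit, Matrix.exp_diagonal, he]
  simp only [e]
  have hd : Tendsto (fun t : ℝ => Matrix.diagonal fun i => Real.exp (-(t * η) * hA.1.eigenvalues i))
      atTop (𝓝 (0 : Matrix (Fin d) (Fin d) ℝ)) := by
    rw [← Matrix.diagonal_zero]
    refine ((Continuous.matrix_diagonal continuous_id).tendsto (0 : Fin d → ℝ)).comp ?_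
    refine tendsto_pi_nhds.2 fun i => ?_
    refine Real.tendsto_exp_atBot.comp ?_
    have : ∀ t : ℝ, -(t * η) * hA.1.eigenvalues i = -(t * (η * hA.1.eigenvalues i)) :=
      fun t => by ring
    simp only [this]
    exact tendsto_neg_atTop_atBot.comp
      (tendsto_id.atTop_mul_const (mul_pos hη (hA.eigenvalues_pos i)))
  have hc : Continuous fun D : Matrix (Fin d) (Fin d) ℝ => U * D * U⁻¹ := by fun_prop
  have := (hc.tendsto 0).comp hd
  rw [mul_zero, zero_mul] at this
  exact this

theorem tendsto_meanAtTime {K : 𝒳 → 𝒳 → ℝ} {X : Fin d → 𝒳} (hK : (trainMatrix K X).PosDef)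
    (Y : Fin d → ℝ) {η : ℝ} (hη : 0 < η) (x : 𝒳) :
    Tendsto (fun t => meanAtTime K X Y η t x) atTop (𝓝 (meanInfty K X Y x)) := by
  have h := tendsto_exp_neg_smul hK hη
  have hc : Continuous fun D : Matrix (Fin d) (Fin d) ℝ =>
      (fun i => K x (X i)) ⬝ᵥ (((trainMatrix K X)⁻¹ * (1 - D)) *ᵥ Y) := by fun_prop
  have := (hc.tendsto 0).comp h
  rw [sub_zero, mul_one] at this
  exact this

end Gram

namespace Network

variable {𝒳 : Type*} {n L m : ℕ} (W : Network 𝒳 n L m)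

theorem gridNTK_comm (s : Fin L → Fin 4) (x x' : 𝒳) : W.gridNTK s x x' = W.gridNTK s x' x := by
  simp only [gridNTK, mul_comm]

/-- The quadratic form of the kernel of one sample is a sum of squares of finite differences. -/
theorem gridNTK_form_nonneg {d : ℕ} (s : Fin L → Fin 4) (X : Fin d → 𝒳) (v : Fin d → ℝ) :
    0 ≤ ∑ p, ∑ q, v p * v q * W.gridNTK s (X p) (X q) := by
  have : ∑ p, ∑ q, v p * v q * W.gridNTK s (X p) (X q) =
      (∑ i, (∑ p, v p * W.shiftDiff (angles s) i (X p)) ^ 2) / 4 := by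
    have e : ∀ i, (∑ p, v p * W.shiftDiff (angles s) i (X p)) ^ 2 = ∑ p, ∑ q, v p * v q *
        (W.shiftDiff (angles s) i (X p) * W.shiftDiff (angles s) i (X q)) := by
      intro i
      rw [pow_two, Finset.sum_mul_sum]
      exact Finset.sum_congr rfl fun p _ => Finset.sum_congr rfl fun q _ => by ring
    simp only [e]
    conv_rhs => rw [Finset.sum_comm, Finset.sum_div]
    refine Finset.sum_congr rfl fun p _ => ?_
    conv_rhs => rw [Finset.sum_comm, Finset.sum_div]
    refine Finset.sum_congr rfl fun q _ => ?_
    rw [gridNTK, ← Finset.mul_sum, mul_div_assoc]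
  rw [this]
  positivity

theorem posSemidef_trainMatrix_ntk {d : ℕ} (X : Fin d → 𝒳) : (trainMatrix W.ntk X).PosSemidef := by
  refine posSemidef_trainMatrix (fun x x' => ?_) X fun v => ?_
  · simp only [ntk_eq_integral_gridNTK, W.gridNTK_comm _ x x']
  · have : ∑ p, ∑ q, v p * v q * W.ntk (X p) (X q) =
        ∫ s, ∑ p, ∑ q, v p * v q * W.gridNTK s (X p) (X q)
          ∂(Measure.pi fun _ : Fin L => gridLaw) := by
      rw [integral_finsetSum _ fun _ _ => Integrable.of_finite]
      refine Finset.sum_congr rfl fun p _ => ?_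
      rw [integral_finsetSum _ fun _ _ => Integrable.of_finite]
      refine Finset.sum_congr rfl fun q _ => ?_
      rw [integral_const_mul, ntk_eq_integral_gridNTK]
    rw [this]
    exact integral_nonneg fun s => W.gridNTK_form_nonneg s X v

theorem ntkEstimate_comm {N : ℕ} (S : Samples N L) (x x' : 𝒳) :
    W.ntkEstimate S x x' = W.ntkEstimate S x' x := by
  simp only [ntkEstimate_eq, W.gridNTK_comm _ x x']

theorem posSemidef_trainMatrix_ntkEstimate {N d : ℕ} (S : Samples N L) (X : Fin d → 𝒳) :
    (trainMatrix (W.ntkEstimate S) X).PosSemidef := by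
  refine posSemidef_trainMatrix (W.ntkEstimate_comm S) X fun v => ?_
  have : ∑ p, ∑ q, v p * v q * W.ntkEstimate S (X p) (X q) =
      (∑ j, ∑ p, ∑ q, v p * v q * W.gridNTK (S j) (X p) (X q)) / N := by
    simp only [ntkEstimate_eq, Finset.sum_div, Finset.mul_sum]
    conv_rhs => rw [Finset.sum_comm]
    refine Finset.sum_congr rfl fun p _ => ?_
    conv_rhs => rw [Finset.sum_comm]
    refine Finset.sum_congr rfl fun q _ => Finset.sum_congr rfl fun j _ => by ring
  rw [this]
  exact div_nonneg (Finset.sum_nonneg fun j _ => W.gridNTK_form_nonneg (S j) X v) (Nat.cast_nonneg N)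

theorem abs_ntkEstimate_le {N : ℕ} (hN : 0 < N) (S : Samples N L) (x x' : 𝒳) :
    |W.ntkEstimate S x x'| ≤ L * m ^ 2 := by
  have hN' : (0 : ℝ) < N := by exact_mod_cast hN
  rw [ntkEstimate_eq, abs_div, abs_of_pos hN', div_le_iff₀ hN']
  refine (Finset.abs_sum_le_sum_abs _ _).trans
    ((Finset.sum_le_sum fun j _ => W.abs_gridNTK_le (S j) x x').trans (le_of_eq ?_))
  rw [Finset.sum_const, Finset.card_univ, Fintype.card_fin, nsmul_eq_mul, mul_comm]

/-- Concentration of a linear combination of entries of a row of the estimated kernel. -/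
theorem sampleLaw_row_le {N d : ℕ} (hN : 0 < N) (x : 𝒳) (X : Fin d → 𝒳) (α : Fin d → ℝ) {B t : ℝ}
    (hB : 0 < B) (ht : 0 ≤ t) (hα : √d * (L * (m : ℝ) ^ 2) * norm₂ α ≤ B) :
    (sampleLaw N L).real {S | t ≤ |(fun i => W.ntkEstimate S x (X i) - W.ntk x (X i)) ⬝ᵥ α|} ≤
      2 * Real.exp (-(N * t ^ 2 / (2 * B ^ 2))) := by
  have h := sampleLaw_abs_mean_sub_ge_le hN (L := L)
    (fun s => (fun i => W.gridNTK s x (X i)) ⬝ᵥ α) hB ht (fun s => by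
      refine (abs_dotProduct_le _ _).trans (le_trans ?_ hα)
      exact mul_le_mul_of_nonneg_right (norm₂_le (by positivity) fun i => W.abs_gridNTK_le s x (X i))
        (norm₂_nonneg _))
  convert! h using 6 with S
  rw [show (fun i => W.ntkEstimate S x (X i) - W.ntk x (X i)) =
    (fun i => W.ntkEstimate S x (X i)) - (fun i => W.ntk x (X i)) from rfl, sub_dotProduct]
  congr 1
  · simp only [ntkEstimate_eq, dotProduct, Finset.sum_div, Finset.sum_mul]
    rw [Finset.sum_comm]
    refine Finset.sum_congr rfl fun j _ => Finset.sum_congr rfl fun i _ => by ring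
  · simp only [dotProduct]
    rw [integral_finsetSum _ fun _ _ => Integrable.of_finite]
    refine Finset.sum_congr rfl fun i _ => ?_
    rw [integral_mul_const, ntk_eq_integral_gridNTK]

theorem sampleLaw_entry_le {N : ℕ} (hN : 0 < N) (x x' : 𝒳) {t : ℝ} (ht : 0 ≤ t)
    (hB : 0 < (L : ℝ) * (m : ℝ) ^ 2) :
    (sampleLaw N L).real {S | t ≤ |W.ntkEstimate S x x' - W.ntk x x'|} ≤
      2 * Real.exp (-(N * t ^ 2 / (2 * (L * (m : ℝ) ^ 2) ^ 2))) := by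
  have h := sampleLaw_abs_mean_sub_ge_le hN (L := L) (fun s => W.gridNTK s x x') hB ht
    fun s => W.abs_gridNTK_le s x x'
  simpa only [ntkEstimate_eq, ntk_eq_integral_gridNTK] using h

set_option maxHeartbeats 1000000 in
/-- The failure probability of the estimate of the trained mean at one point. By
`isUnit_and_abs_dotProduct_inv_sub_lt` it suffices to control three families of sample means, which
fail with probability at most `δ / 128`, `δ / 2` and `δ / 128`. The first summand of the number of
samples pays for the query row, the second one for the training matrix. -/
theorem sampleLaw_failure_le {d : ℕ} (X : Fin d → 𝒳) (Y : Fin d → ℝ)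
    (hK : IsUnit (trainMatrix W.ntk X)) {ε δ : ℝ} (hε : 0 < ε)
    (hεt : ε < accuracyThreshold L m (trainMatrix W.ntk X) Y) (hδ : 0 < δ) (hδ1 : δ < 1)
    (x : 𝒳) {N : ℕ} (hN : sampleCount L m (trainMatrix W.ntk X) Y ε δ ≤ N) :
    (sampleLaw N L).real {S | ¬ (IsUnit (trainMatrix (W.ntkEstimate S) X) ∧
      |meanInfty (W.ntkEstimate S) X Y x - meanInfty W.ntk X Y x| < ε)} ≤ δ := by
  set K := trainMatrix W.ntk X with hKdef
  have hdet : IsUnit K.det := (Matrix.isUnit_iff_isUnit_det K).1 hK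
  -- nothing degenerates below the threshold
  have hthr := hε.trans hεt
  rw [accuracyThreshold] at hthr
  have hL : (0 : ℝ) < L := by
    rcases Nat.eq_zero_or_pos L with h | h
    · simp [h] at hthr
    · exact_mod_cast h
  have hd : 0 < d := by
    rcases Nat.eq_zero_or_pos d with h | h
    · subst h; simp at hthr
    · exact h
  have hd' : (1 : ℝ) ≤ d := by exact_mod_cast hd
  have hm : (0 : ℝ) < m := by
    rcases Nat.eq_zero_or_pos m with h | h
    · simp [h] at hthr
    · exact_mod_cast h
  have hy : 0 < norm₂ Y := by
    rcases (norm₂_nonneg Y).eq_or_lt with h | h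
    · simp [← h] at hthr
    · exact h
  have hκ : 0 < normOp K⁻¹ := by
    rcases (norm_nonneg (Matrix.toEuclideanCLM (𝕜 := ℝ) K⁻¹)).eq_or_lt with h | h
    · rw [show normOp K⁻¹ = 0 from h.symm] at hthr
      simp at hthr
    · exact h
  have hα : 0 < norm₂ (K⁻¹ *ᵥ Y) := by
    rcases (norm₂_nonneg (K⁻¹ *ᵥ Y)).eq_or_lt with h | h
    · have h0 := norm₂_eq_zero.1 h.symm
      have : Y = 0 := by
        have := congrArg (fun v => K *ᵥ v) h0
        simpa [Matrix.mulVec_mulVec, Matrix.mul_nonsing_inv _ hdet] using this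
      rw [this, norm₂_eq_zero.2 rfl] at hy
      exact absurd hy (lt_irrefl _)
    · exact h
  have hαy : norm₂ (K⁻¹ *ᵥ Y) ≤ normOp K⁻¹ * norm₂ Y := norm₂_mulVec_le_normOp _ _
  rw [sampleCount, radius] at hN
  rw [accuracyThreshold] at hεt
  set a := norm₂ (K⁻¹ *ᵥ Y) with ha
  set κ := normOp K⁻¹ with hκdef
  set y := norm₂ Y with hydef
  set M : ℝ := L * (m : ℝ) ^ 2 with hM
  have hMpos : 0 < M := by positivity
  set r : ℝ := √(d : ℝ) with hr
  have hr2 : r ^ 2 = d := Real.sq_sqrt (by positivity)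
  have hrpos : 0 < r := Real.sqrt_pos.2 (by linarith)
  have hl1 : 0 < Real.log (2 * (1 + (d : ℝ)) / δ) := Real.log_pos (by
    rw [lt_div_iff₀ hδ]; linarith)
  have hl2 : 0 < Real.log (4 * (d : ℝ) / δ) := Real.log_pos (by
    rw [lt_div_iff₀ hδ]; linarith)
  have he1 : Real.exp (-Real.log (2 * (1 + (d : ℝ)) / δ)) = δ / (2 * (1 + d)) := by
    rw [Real.exp_neg, Real.exp_log (by positivity), inv_div]
  have he2 : Real.exp (-Real.log (4 * (d : ℝ) / δ)) = δ / (4 * d) := by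
    rw [Real.exp_neg, Real.exp_log (by positivity), inv_div]
  set l1 := Real.log (2 * (1 + (d : ℝ)) / δ) with hl1def
  set l2 := Real.log (4 * (d : ℝ) / δ) with hl2def
  -- with this bound the prefactor `2 (1 + √2)^4 / 3` is at least `18`, as Hoeffding's inequality needs
  -- at the tolerance `ε / (3 d M κ)`
  have hsqrt : (27 : ℝ) ≤ (1 + √2) ^ 4 := by
    have h2 : (1.4 : ℝ) ≤ √2 := Real.le_sqrt_of_sq_le (by norm_num)
    calc (27 : ℝ) ≤ (1 + 1.4) ^ 4 := by norm_num
      _ ≤ _ := by gcongr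
  have hN1 : 8 * (2 * r * M * a) ^ 2 / ε ^ 2 * l1 ≤ N := by
    refine le_trans ?_ hN
    have e1 : 8 * (2 * r * M * a) ^ 2 / ε ^ 2 * l1 ≤ (24 * (2 * L * r * (m : ℝ) ^ 2 * a) ^ 2 +
        4 * (2 * L * r * (m : ℝ) ^ 2 * a) * ε) / (3 * ε ^ 2) * l1 := by
      refine mul_le_mul_of_nonneg_right ?_ hl1.le
      rw [hM, div_le_div_iff₀ (by positivity) (by positivity)]
      have : 0 ≤ 4 * (2 * L * r * (m : ℝ) ^ 2 * a) * ε * ε ^ 2 := by positivity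
      linarith [this]
    have e2 : 0 ≤ 2 * (1 + √2) ^ 4 * (L : ℝ) ^ 4 * (d : ℝ) ^ 3 * (m : ℝ) ^ 8 * κ ^ 4 *
        y ^ 2 / (3 * ε ^ 2) * l2 := by positivity
    linarith
  have hN2 : 18 * (d : ℝ) ^ 3 * M ^ 4 * κ ^ 4 * y ^ 2 / ε ^ 2 * l2 ≤ N := by
    refine le_trans ?_ hN
    have e1 : 18 * (d : ℝ) ^ 3 * M ^ 4 * κ ^ 4 * y ^ 2 / ε ^ 2 * l2 ≤
        2 * (1 + √2) ^ 4 * (L : ℝ) ^ 4 * (d : ℝ) ^ 3 * (m : ℝ) ^ 8 * κ ^ 4 *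
        y ^ 2 / (3 * ε ^ 2) * l2 := by
      have : 18 * (d : ℝ) ^ 3 * M ^ 4 * κ ^ 4 * y ^ 2 / ε ^ 2 * l2 =
          2 * 27 * (L : ℝ) ^ 4 * (d : ℝ) ^ 3 * (m : ℝ) ^ 8 * κ ^ 4 * y ^ 2 / (3 * ε ^ 2) * l2 := by
        rw [hM]; field_simp; ring
      rw [this]
      gcongr
    have e2 : 0 ≤ (24 * (2 * L * r * (m : ℝ) ^ 2 * a) ^ 2 +
        4 * (2 * L * r * (m : ℝ) ^ 2 * a) * ε) / (3 * ε ^ 2) * l1 := by positivity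
    linarith
  have hNpos : 0 < N := by
    have : (0 : ℝ) < N := lt_of_lt_of_le (by positivity) hN1
    exact_mod_cast this
  have hpi : ∀ i : Fin d, ∀ S : Samples N L,
      ((trainMatrix (W.ntkEstimate S) X - K) *ᵥ (K⁻¹ *ᵥ Y)) i =
        (fun l => W.ntkEstimate S (X i) (X l) - W.ntk (X i) (X l)) ⬝ᵥ (K⁻¹ *ᵥ Y) := fun i S => rfl
  -- the three families of bad events
  let bad1 : Set (Samples N L) :=
    {S | ε / 2 ≤ |(fun i => W.ntkEstimate S x (X i) - W.ntk x (X i)) ⬝ᵥ (K⁻¹ *ᵥ Y)|}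
  let bad2 : Fin d → Set (Samples N L) := fun i =>
    {S | ε / (3 * d * M * κ) ≤
      |(fun l => W.ntkEstimate S (X i) (X l) - W.ntk (X i) (X l)) ⬝ᵥ (K⁻¹ *ᵥ Y)|}
  let bad3 : Fin d × Fin d → Set (Samples N L) := fun q =>
    {S | 1 / (3 * d * κ) ≤ |W.ntkEstimate S (X q.1) (X q.2) - W.ntk (X q.1) (X q.2)|}
  have hsub : {S : Samples N L | ¬ (IsUnit (trainMatrix (W.ntkEstimate S) X) ∧
      |meanInfty (W.ntkEstimate S) X Y x - meanInfty W.ntk X Y x| < ε)} ⊆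
      bad1 ∪ ((⋃ i, bad2 i) ∪ ⋃ q, bad3 q) := by
    intro S hS
    by_contra hcon
    simp only [Set.mem_union, Set.mem_iUnion, not_or, not_exists] at hcon
    obtain ⟨c1, c2, c3⟩ := hcon
    refine hS (isUnit_and_abs_dotProduct_inv_sub_lt (K := K) (M := M) hd hMpos hK hκ ?_ ?_ ?_ ?_)
    · exact not_le.1 c1
    · exact fun i => (not_le.1 (c2 i)).le
    · exact fun i l => (not_le.1 (c3 (i, l))).le
    · exact fun i => W.abs_ntkEstimate_le hNpos S x (X i)
  have p1 : (sampleLaw N L).real bad1 ≤ δ / 128 := by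
    refine (W.sampleLaw_row_le hNpos x X (K⁻¹ *ᵥ Y) (B := r * M * a) (by positivity)
      (by positivity) le_rfl).trans ?_
    -- the exponent is four times the logarithm, so that the fourth power of its value appears
    have hx : 4 * l1 ≤ N * (ε / 2) ^ 2 / (2 * (r * M * a) ^ 2) := by
      rw [le_div_iff₀ (by positivity)]
      refine le_trans (le_of_eq ?_) (mul_le_mul_of_nonneg_right hN1 (by positivity))
      field_simp
      ring
    have hz : δ / (2 * (1 + d)) ≤ δ / 4 := by gcongr; linarith
    have hz0 : 0 ≤ δ / (2 * (1 + d)) := by positivity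
    calc 2 * Real.exp (-(N * (ε / 2) ^ 2 / (2 * (r * M * a) ^ 2)))
        ≤ 2 * Real.exp (-(4 * l1)) := by gcongr
      _ = 2 * (δ / (2 * (1 + d))) ^ 4 := by
          rw [← he1, ← Real.exp_nat_mul]; push_cast; ring_nf
      _ ≤ 2 * (δ / 4) ^ 4 := by gcongr
      _ = δ / 128 * δ ^ 3 := by ring
      _ ≤ δ / 128 := mul_le_of_le_one_right (by positivity) (pow_le_one₀ hδ.le hδ1.le)
  have p2 : ∀ i, (sampleLaw N L).real (bad2 i) ≤ 2 * (δ / (4 * d)) := by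
    intro i
    refine (W.sampleLaw_row_le hNpos (X i) X (K⁻¹ *ᵥ Y) (B := r * M * a) (by positivity)
      (by positivity) le_rfl).trans ?_
    rw [← he2]
    gcongr
    rw [le_div_iff₀ (by positivity)]
    refine le_trans ?_ (mul_le_mul_of_nonneg_right hN2 (by positivity))
    rw [mul_pow, mul_pow, hr2]
    have e : 18 * (d : ℝ) ^ 3 * M ^ 4 * κ ^ 4 * y ^ 2 / ε ^ 2 * l2 * (ε / (3 * d * M * κ)) ^ 2 =
        l2 * (2 * (d * M ^ 2 * (κ * y) ^ 2)) := by
      field_simp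
      ring
    rw [e]
    gcongr
  have p3 : ∀ q, (sampleLaw N L).real (bad3 q) ≤ 2 * (δ / (4 * d)) ^ 4 := by
    intro q
    refine (W.sampleLaw_entry_le hNpos (X q.1) (X q.2) (by positivity) hMpos).trans ?_
    rw [← he2, ← Real.exp_nat_mul]
    gcongr
    push_cast
    rw [mul_neg, neg_le_neg_iff, le_div_iff₀ (by positivity)]
    refine le_trans ?_ (mul_le_mul_of_nonneg_right hN2 (by positivity))
    -- below the threshold the exponent for a single entry is at least four times the logarithm
    have hε2 : 4 * ε ^ 2 ≤ d * M ^ 2 * y ^ 2 * κ ^ 2 := by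
      have h0 : ε ^ 2 ≤ ((L : ℝ) / 2 * r * (m : ℝ) ^ 2 * y * κ) ^ 2 := by gcongr
      have h1 : ((L : ℝ) / 2 * r * (m : ℝ) ^ 2 * y * κ) ^ 2 = r ^ 2 * M ^ 2 * y ^ 2 * κ ^ 2 / 4 := by
        rw [hM]; ring
      rw [h1, hr2] at h0
      linarith
    have e : 18 * (d : ℝ) ^ 3 * M ^ 4 * κ ^ 4 * y ^ 2 / ε ^ 2 * l2 * (1 / (3 * d * κ)) ^ 2 =
        l2 * (2 * M ^ 2) * ((d * M ^ 2 * y ^ 2 * κ ^ 2) / ε ^ 2) := by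
      field_simp
      ring
    rw [e]
    have : 4 ≤ (d * M ^ 2 * y ^ 2 * κ ^ 2) / ε ^ 2 := by
      rw [le_div_iff₀ (by positivity)]; exact hε2
    have h0 : 0 ≤ l2 * (2 * M ^ 2) := by positivity
    linarith [mul_le_mul_of_nonneg_left this h0]
  have s2 : ∑ i, (sampleLaw N L).real (bad2 i) ≤ δ / 2 := by
    refine (Finset.sum_le_sum fun i _ => p2 i).trans (le_of_eq ?_)
    rw [Finset.sum_const, Finset.card_univ, Fintype.card_fin, nsmul_eq_mul]
    field_simp
    norm_num
  have s3 : ∑ q, (sampleLaw N L).real (bad3 q) ≤ δ / 128 := by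
    refine (Finset.sum_le_sum fun q _ => p3 q).trans ?_
    rw [Finset.sum_const, Finset.card_univ, Fintype.card_prod, Fintype.card_fin, nsmul_eq_mul]
    push_cast
    have : (d : ℝ) * d * (2 * (δ / (4 * d)) ^ 4) = δ / 128 * (δ ^ 3 / d ^ 2) := by
      field_simp
      ring
    rw [this]
    refine mul_le_of_le_one_right (by positivity) ?_
    rw [div_le_one (by positivity)]
    exact (pow_le_one₀ hδ.le hδ1.le).trans (one_le_pow₀ hd')
  calc _ ≤ (sampleLaw N L).real (bad1 ∪ ((⋃ i, bad2 i) ∪ ⋃ q, bad3 q)) := measureReal_mono hsub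
    _ ≤ (sampleLaw N L).real bad1 + ((sampleLaw N L).real (⋃ i, bad2 i) +
        (sampleLaw N L).real (⋃ q, bad3 q)) :=
        (measureReal_union_le _ _).trans (by gcongr; exact measureReal_union_le _ _)
    _ ≤ δ / 128 + (δ / 2 + δ / 128) := by
        gcongr
        · exact (measureReal_iUnion_fintype_le _).trans s2
        · exact (measureReal_iUnion_fintype_le _).trans s3
    _ ≤ δ := by linarith

theorem sampleLaw_ge_of_failure_le {N : ℕ} {δ : ℝ} {s : Set (Samples N L)}
    (h : (sampleLaw N L).real sᶜ ≤ δ) : ENNReal.ofReal (1 - δ) ≤ sampleLaw N L s := by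
  have hs : MeasurableSet s := s.toFinite.measurableSet
  rw [← ofReal_measureReal (μ := sampleLaw N L)]
  refine ENNReal.ofReal_le_ofReal ?_
  rw [probReal_compl_eq_one_sub hs] at h
  linarith

end Network

/-! ### Reasoning about programs -/

namespace RealRAM

namespace Prog

/-- The index registers that a program may change. -/
def wIdx : Prog → List ℕ
  | seq p q => p.wIdx ++ q.wIdx
  | setIdx v _ | incIdx v | decIdx v => [v]
  | ifBit _ p q => p.wIdx ++ q.wIdx
  | ifIdx _ _ p q => p.wIdx ++ q.wIdx
  | loop v _ p => v :: p.wIdx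
  | _ => []

/-- The bit arrays that a program may change. -/
def wBit : Prog → List ℕ
  | seq p q => p.wBit ++ q.wBit
  | gate _ a _ _ => [a.arr]
  | less a _ _ => [a.arr]
  | draw a b => [a.arr, b.arr]
  | ifBit _ p q => p.wBit ++ q.wBit
  | ifIdx _ _ p q => p.wBit ++ q.wBit
  | loop _ _ p => p.wBit
  | _ => []

/-- The real arrays that a program may change. -/
def wReal : Prog → List ℕ
  | seq p q => p.wReal ++ q.wReal
  | const a _ => [a.arr]
  | arith _ a _ _ => [a.arr]
  | ifBit _ p q => p.wReal ++ q.wReal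
  | ifIdx _ _ p q => p.wReal ++ q.wReal
  | loop _ _ p => p.wReal
  | _ => []

/-- A program without random draws. -/
def NoDraw : Prog → Prop
  | seq p q => p.NoDraw ∧ q.NoDraw
  | draw _ _ => False
  | ifBit _ p q => p.NoDraw ∧ q.NoDraw
  | ifIdx _ _ p q => p.NoDraw ∧ q.NoDraw
  | loop _ _ p => p.NoDraw
  | _ => True

/-- All loop bounds are constants or registers in `R`. -/
def BoundsIn (R : List ℕ) : Prog → Prop
  | seq p q => p.BoundsIn R ∧ q.BoundsIn R
  | ifBit _ p q => p.BoundsIn R ∧ q.BoundsIn R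
  | ifIdx _ _ p q => p.BoundsIn R ∧ q.BoundsIn R
  | loop _ (.reg v) p => v ∈ R ∧ p.BoundsIn R
  | loop _ (.const _) p => p.BoundsIn R
  | _ => True

/-- An upper bound of the number of steps when the loop bound in register `v` is `f v`. -/
def cost (f : ℕ → ℕ) : Prog → ℕ
  | skip => 0
  | seq p q => p.cost f + q.cost f
  | ifBit _ p q => 1 + max (p.cost f) (q.cost f)
  | ifIdx _ _ p q => 1 + max (p.cost f) (q.cost f)
  | loop _ (.reg v) p => 1 + f v * (1 + p.cost f)
  | loop _ (.const k) p => 1 + k * (1 + p.cost f)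
  | _ => 1

end Prog

theorem foldl_range_induct {σ : Type*} (I : ℕ → σ → Prop) (f : σ → ℕ → σ) (b : ℕ) (s : σ)
    (h0 : I 0 s) (hs : ∀ k < b, ∀ s', I k s' → I (k + 1) (f s' k)) :
    I b ((List.range b).foldl f s) := by
  induction b with
  | zero => exact h0
  | succ b ih =>
    rw [List.range_succ, List.foldl_append]
    exact hs b (Nat.lt_succ_self b) _ (ih fun k hk => hs k (Nat.lt_succ_of_lt hk))

section StateLemmas

variable (s : State) (v k : ℕ) (c : Cell) (b : Bool) (r : ℝ)

@[simp] theorem tick_idx : s.tick.idx = s.idx := rfl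
@[simp] theorem tick_bit : s.tick.bit = s.bit := rfl
@[simp] theorem tick_real : s.tick.real = s.real := rfl
@[simp] theorem tick_draws : s.tick.draws = s.draws := rfl
@[simp] theorem setIdx_idx : (s.setIdx v k).idx = Function.update s.idx v k := rfl
@[simp] theorem setIdx_bit : (s.setIdx v k).bit = s.bit := rfl
@[simp] theorem setIdx_real : (s.setIdx v k).real = s.real := rfl
@[simp] theorem setIdx_draws : (s.setIdx v k).draws = s.draws := rfl
@[simp] theorem setBit_idx : (s.setBit c b).idx = s.idx := rfl
@[simp] theorem setBit_bit : (s.setBit c b).bit =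
    Function.update s.bit c.arr (Function.update (s.bit c.arr) (c.eval s) b) := rfl
@[simp] theorem setBit_real : (s.setBit c b).real = s.real := rfl
@[simp] theorem setReal_idx : (s.setReal c r).idx = s.idx := rfl
@[simp] theorem setReal_bit : (s.setReal c r).bit = s.bit := rfl
@[simp] theorem setReal_real : (s.setReal c r).real =
    Function.update s.real c.arr (Function.update (s.real c.arr) (c.eval s) r) := rfl

theorem Ix.eval_congr {s s' : State} (h : s'.idx = s.idx) : Ix.eval s' = Ix.eval s := by
  funext e
  cases e <;> simp [Ix.eval, h]

@[simp] theorem Ix.eval_tick : Ix.eval s.tick = Ix.eval s := Ix.eval_congr rfl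
@[simp] theorem Ix.eval_setBit : Ix.eval (s.setBit c b) = Ix.eval s := Ix.eval_congr rfl
@[simp] theorem Ix.eval_setReal : Ix.eval (s.setReal c r) = Ix.eval s := Ix.eval_congr rfl
@[simp] theorem Ix.eval_reg : Ix.eval s (.reg v) = s.idx v := rfl
@[simp] theorem Ix.eval_const : Ix.eval s (.const k) = k := rfl

theorem Ix.map_eval_congr {s s' : State} {l : List Ix}
    (h : ∀ v, Ix.reg v ∈ l → s'.idx v = s.idx v) : l.map (Ix.eval s') = l.map (Ix.eval s) := by
  refine List.map_congr_left fun e he => ?_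
  cases e with
  | const k => rfl
  | reg v => exact h v he

end StateLemmas

/-- The states `s` and `s'` agree outside the registers and arrays that `p` may change. -/
structure Frame (p : Prog) (s s' : State) : Prop where
  idx : ∀ v, v ∉ p.wIdx → s'.idx v = s.idx v
  bit : ∀ a, a ∉ p.wBit → s'.bit a = s.bit a
  real : ∀ a, a ∉ p.wReal → s'.real a = s.real a

theorem Frame.refl (p : Prog) (s : State) : Frame p s s := ⟨fun _ _ => rfl, fun _ _ => rfl, fun _ _ => rfl⟩

theorem Frame.trans {p : Prog} {s s' s'' : State} (h : Frame p s s') (h' : Frame p s' s'') :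
    Frame p s s'' :=
  ⟨fun v hv => (h'.idx v hv).trans (h.idx v hv), fun v hv => (h'.bit v hv).trans (h.bit v hv),
    fun v hv => (h'.real v hv).trans (h.real v hv)⟩

theorem Frame.mono {p q : Prog} {s s' : State} (h : Frame p s s')
    (h1 : ∀ v ∈ p.wIdx, v ∈ q.wIdx) (h2 : ∀ v ∈ p.wBit, v ∈ q.wBit)
    (h3 : ∀ v ∈ p.wReal, v ∈ q.wReal) : Frame q s s' :=
  ⟨fun v hv => h.idx v (mt (h1 v) hv), fun v hv => h.bit v (mt (h2 v) hv),
    fun v hv => h.real v (mt (h3 v) hv)⟩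

/-- A program changes only what it mentions as a target. -/
theorem frame_run (ω : ℕ → Fin 4) (p : Prog) (s : State) : Frame p s (run ω p s) := by
  induction p generalizing s with
  | skip => exact Frame.refl _ _
  | seq p q ihp ihq =>
    refine ((ihp s).mono ?_ ?_ ?_).trans ((ihq _).mono ?_ ?_ ?_) <;>
      simp +contextual [Prog.wIdx, Prog.wBit, Prog.wReal]
  | setIdx v e =>
    refine ⟨fun u hu => ?_, fun _ _ => rfl, fun _ _ => rfl⟩
    simp only [Prog.wIdx, List.mem_singleton] at hu
    simp [run, hu]
  | incIdx v =>
    refine ⟨fun u hu => ?_, fun _ _ => rfl, fun _ _ => rfl⟩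
    simp only [Prog.wIdx, List.mem_singleton] at hu
    simp [run, hu]
  | decIdx v =>
    refine ⟨fun u hu => ?_, fun _ _ => rfl, fun _ _ => rfl⟩
    simp only [Prog.wIdx, List.mem_singleton] at hu
    simp [run, hu]
  | gate g a b c =>
    refine ⟨fun _ _ => rfl, fun u hu => ?_, fun _ _ => rfl⟩
    simp only [Prog.wBit, List.mem_singleton] at hu
    simp [run, hu]
  | const a z =>
    refine ⟨fun _ _ => rfl, fun _ _ => rfl, fun u hu => ?_⟩
    simp only [Prog.wReal, List.mem_singleton] at hu
    simp [run, hu]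
  | arith o a b c =>
    refine ⟨fun _ _ => rfl, fun _ _ => rfl, fun u hu => ?_⟩
    simp only [Prog.wReal, List.mem_singleton] at hu
    simp [run, hu]
  | less a b c =>
    refine ⟨fun _ _ => rfl, fun u hu => ?_, fun _ _ => rfl⟩
    simp only [Prog.wBit, List.mem_singleton] at hu
    simp [run, hu]
  | draw a b =>
    refine ⟨fun _ _ => rfl, fun u hu => ?_, fun _ _ => rfl⟩
    simp only [Prog.wBit, List.mem_cons, List.not_mem_nil, or_false, not_or] at hu
    simp [run, hu.1, hu.2]
  | ifBit a p q ihp ihq =>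
    simp only [run]
    split_ifs
    · refine Frame.trans (s' := s.tick) ⟨fun _ _ => rfl, fun _ _ => rfl, fun _ _ => rfl⟩
        ((ihp _).mono ?_ ?_ ?_) <;> simp +contextual [Prog.wIdx, Prog.wBit, Prog.wReal]
    · refine Frame.trans (s' := s.tick) ⟨fun _ _ => rfl, fun _ _ => rfl, fun _ _ => rfl⟩
        ((ihq _).mono ?_ ?_ ?_) <;> simp +contextual [Prog.wIdx, Prog.wBit, Prog.wReal]
  | ifIdx e f p q ihp ihq =>
    simp only [run]
    split_ifs
    · refine Frame.trans (s' := s.tick) ⟨fun _ _ => rfl, fun _ _ => rfl, fun _ _ => rfl⟩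
        ((ihp _).mono ?_ ?_ ?_) <;> simp +contextual [Prog.wIdx, Prog.wBit, Prog.wReal]
    · refine Frame.trans (s' := s.tick) ⟨fun _ _ => rfl, fun _ _ => rfl, fun _ _ => rfl⟩
        ((ihq _).mono ?_ ?_ ?_) <;> simp +contextual [Prog.wIdx, Prog.wBit, Prog.wReal]
  | loop v e p ih =>
    refine foldl_range_induct (fun _ s' => Frame (.loop v e p) s s') _ _ _
      ⟨fun _ _ => rfl, fun _ _ => rfl, fun _ _ => rfl⟩ fun k _ s' hs' => ?_
    refine hs'.trans (Frame.trans (s' := (s'.setIdx v k).tick) ?_ ((ih _).mono ?_ ?_ ?_))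
    · refine ⟨fun u hu => ?_, fun _ _ => rfl, fun _ _ => rfl⟩
      simp only [Prog.wIdx, List.mem_cons, not_or] at hu
      simp [hu.1]
    all_goals simp +contextual [Prog.wIdx, Prog.wBit, Prog.wReal]

theorem run_draws (ω : ℕ → Fin 4) {p : Prog} (hp : p.NoDraw) (s : State) :
    (run ω p s).draws = s.draws := by
  induction p generalizing s with
  | seq p q ihp ihq => rw [run, ihq hp.2, ihp hp.1]
  | draw a b => exact hp.elim
  | ifBit a p q ihp ihq =>
    simp only [run]
    split_ifs
    · rw [ihp hp.1, tick_draws]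
    · rw [ihq hp.2, tick_draws]
  | ifIdx e f p q ihp ihq =>
    simp only [run]
    split_ifs
    · rw [ihp hp.1, tick_draws]
    · rw [ihq hp.2, tick_draws]
  | loop v e p ih =>
    refine foldl_range_induct (fun _ (s' : State) => s'.draws = s.draws) _ _ _ rfl fun k _ s' hs' => ?_
    rw [ih hp, tick_draws, setIdx_draws, hs']
  | _ => rfl

/-- If no loop bound is changed on the way, `cost` bounds the number of steps. -/
theorem run_steps_le (ω : ℕ → Fin 4) (f : ℕ → ℕ) (R : List ℕ) {p : Prog} (hp : p.BoundsIn R)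
    (hw : ∀ v ∈ R, v ∉ p.wIdx) (s : State) (hf : ∀ v ∈ R, s.idx v = f v) :
    (run ω p s).steps ≤ s.steps + p.cost f := by
  induction p generalizing s with
  | skip => exact le_rfl
  | seq p q ihp ihq =>
    simp only [Prog.wIdx, List.mem_append, not_or] at hw
    have h1 := ihp hp.1 (fun v hv => (hw v hv).1) s hf
    have h2 := ihq hp.2 (fun v hv => (hw v hv).2) (run ω p s) fun v hv => by
      rw [(frame_run ω p s).idx v (hw v hv).1, hf v hv]
    rw [run, Prog.cost]
    omega
  | ifBit a p q ihp ihq =>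
    simp only [Prog.wIdx, List.mem_append, not_or] at hw
    have h1 := ihp hp.1 (fun v hv => (hw v hv).1) s.tick hf
    have h2 := ihq hp.2 (fun v hv => (hw v hv).2) s.tick hf
    have h3 : s.tick.steps = s.steps + 1 := rfl
    have h4 := le_max_left (p.cost f) (q.cost f)
    have h5 := le_max_right (p.cost f) (q.cost f)
    simp only [run, Prog.cost]
    split_ifs <;> omega
  | ifIdx e g p q ihp ihq =>
    simp only [Prog.wIdx, List.mem_append, not_or] at hw
    have h1 := ihp hp.1 (fun v hv => (hw v hv).1) s.tick hf
    have h2 := ihq hp.2 (fun v hv => (hw v hv).2) s.tick hf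
    have h3 : s.tick.steps = s.steps + 1 := rfl
    have h4 := le_max_left (p.cost f) (q.cost f)
    have h5 := le_max_right (p.cost f) (q.cost f)
    simp only [run, Prog.cost]
    split_ifs <;> omega
  | loop v e p ih =>
    have key : ∀ b : ℕ, p.BoundsIn R →
        (∀ u ∈ R, ((List.range b).foldl (fun s' k => run ω p (s'.setIdx v k).tick) s.tick).idx u
          = s.idx u) ∧
        ((List.range b).foldl (fun s' k => run ω p (s'.setIdx v k).tick) s.tick).steps ≤
          s.steps + (1 + b * (1 + p.cost f)) := by
      intro b hpb
      refine foldl_range_induct (fun k (s' : State) => (∀ u ∈ R, s'.idx u = s.idx u) ∧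
        s'.steps ≤ s.steps + (1 + k * (1 + p.cost f))) _ _ _ ⟨fun _ _ => rfl, ?_⟩
        fun k _ s' hs' => ?_
      · exact Nat.add_le_add_left (by omega) _
      · have hw' : ∀ u ∈ R, u ≠ v ∧ u ∉ p.wIdx := by
          intro u hu
          have := hw u hu
          simpa [Prog.wIdx] using this
        have hidx : ∀ u ∈ R, (s'.setIdx v k).tick.idx u = s.idx u := by
          intro u hu
          rw [tick_idx, setIdx_idx, Function.update_of_ne (hw' u hu).1, hs'.1 u hu]
        constructor
        · intro u hu
          rw [(frame_run ω p _).idx u (hw' u hu).2, hidx u hu]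
        · have h1 := ih hpb (fun u hu => (hw' u hu).2) (s'.setIdx v k).tick
            fun u hu => (hidx u hu).trans (hf u hu)
          have h2 : (s'.setIdx v k).tick.steps = s'.steps + 1 := rfl
          have h3 := hs'.2
          rw [add_mul, one_mul]
          omega
    cases e with
    | const k => exact (key k hp).2
    | reg u =>
      have := (key (s.idx u) hp.2).2
      rw [hf u hp.1] at this
      simp only [run, Ix.eval_reg, Prog.cost, hf u hp.1]
      exact this
  | _ => exact le_rfl

/-- Loop invariants. The invariant may use that everything outside the targets of the loop is
unchanged and that the loop register holds the number of the round. -/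
theorem loop_induct (ω : ℕ → Fin 4) {v : ℕ} {e : Ix} {p : Prog} {s : State} (b : ℕ)
    (hb : e.eval s = b) (I : ℕ → State → Prop) (h0 : I 0 s.tick)
    (hI : ∀ k j s', I k s' → I k (s'.setIdx v j).tick)
    (hs : ∀ k < b, ∀ s', Frame (.loop v e p) s s' → s'.idx v = k → I k s' → I (k + 1) (run ω p s')) :
    I b (run ω (.loop v e p) s) := by
  rw [run, hb]
  refine (foldl_range_induct (fun k s' => Frame (.loop v e p) s s' ∧ I k s')
    (fun s' k => run ω p (s'.setIdx v k).tick) b s.tick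
    ⟨⟨fun _ _ => rfl, fun _ _ => rfl, fun _ _ => rfl⟩, h0⟩ fun k hk s' hs' => ?_).2
  have hF : Frame (.loop v e p) s (s'.setIdx v k).tick := by
    refine hs'.1.trans ⟨fun u hu => ?_, fun _ _ => rfl, fun _ _ => rfl⟩
    simp only [Prog.wIdx, List.mem_cons, not_or] at hu
    simp [hu.1]
  refine ⟨hF.trans ((frame_run ω p _).mono ?_ ?_ ?_), hs k hk _ hF (by simp) (hI k k s' hs'.2)⟩ <;>
    simp +contextual [Prog.wIdx, Prog.wBit, Prog.wReal]

/-! ### Pauli arithmetic on the machine -/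

/-- Sequential composition of a list of programs. -/
def block : List Prog → Prog
  | [] => .skip
  | p :: l => .seq p (block l)

theorem run_block_cons (ω : ℕ → Fin 4) (p : Prog) (l : List Prog) (s : State) :
    run ω (block (p :: l)) s = run ω (block l) (run ω p s) := rfl

theorem run_block_nil (ω : ℕ → Fin 4) (s : State) : run ω (block []) s = s := rfl

/-- The only cell with empty address of an array. -/
def cell (a : ℕ) : Cell := ⟨a, []⟩

/-- The body of the loop in `mulProg`. -/
def mulBody (A : ℕ) (pre : List Ix) : Prog := block [
  .gate and (cell 15) ⟨A, pre ++ [.const 1, .reg 12]⟩ ⟨A, pre ++ [.const 0, .reg 12]⟩,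
  .gate and (cell 16) (cell 8) (cell 15),
  .gate xor (cell 9) (cell 9) (cell 16),
  .gate xor (cell 8) (cell 8) (cell 15),
  .gate and (cell 15) ⟨11, [.reg 12]⟩ ⟨A, pre ++ [.const 1, .reg 12]⟩,
  .gate xor (cell 9) (cell 9) (cell 15),
  .gate xor ⟨10, [.reg 12]⟩ ⟨10, [.reg 12]⟩ ⟨A, pre ++ [.const 1, .reg 12]⟩,
  .gate xor ⟨11, [.reg 12]⟩ ⟨11, [.reg 12]⟩ ⟨A, pre ++ [.const 0, .reg 12]⟩]

/-- Multiplication of the Pauli register from the right by the self-adjoint Pauli operator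
with bits in array `A` and sign in array `A + 1` at the address `pre`. The Pauli register
`i^(u + 2 w) X^x Z^z` consists of the bit cells `8` and `9` (the phase bits `u`, `w`) and of the
bit arrays `10` and `11` (the bits `x`, `z`). -/
def mulProg (A : ℕ) (pre : List Ix) : Prog := block [
  .gate xor (cell 9) (cell 9) ⟨A + 1, pre⟩,
  .loop 12 (.reg 0) (mulBody A pre)]

/-- The phase of the Pauli register. -/
def regPhase (s : State) : ℂ := phase (s.bit 8 []) (s.bit 9 [])

/-- The operator in the Pauli register. -/
def regOp (n : ℕ) (s : State) : Op n :=
  regPhase s • xzOp (fun j => s.bit 10 [j]) (fun j => s.bit 11 [j])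

/-- The self-adjoint Pauli operator stored in the arrays `A` and `A + 1` at address `l`. -/
def storedOp (n : ℕ) (s : State) (A : ℕ) (l : List ℕ) : Op n :=
  signedPauli (s.bit (A + 1) l) (fun j => s.bit A (l ++ [0, (j : ℕ)]))
    (fun j => s.bit A (l ++ [1, (j : ℕ)]))

theorem mulBody_wIdx (A : ℕ) (pre : List Ix) : (mulBody A pre).wIdx = [] := rfl
theorem mulBody_wBit (A : ℕ) (pre : List Ix) :
    (mulBody A pre).wBit = [15, 16, 9, 8, 15, 9, 10, 11] := rfl
theorem mulProg_wIdx (A : ℕ) (pre : List Ix) : (mulProg A pre).wIdx = [12] := rfl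
theorem mulProg_wBit (A : ℕ) (pre : List Ix) :
    (mulProg A pre).wBit = [9, 15, 16, 9, 8, 15, 9, 10, 11] := rfl
theorem mulProg_wReal (A : ℕ) (pre : List Ix) : (mulProg A pre).wReal = [] := rfl

theorem run_mulBody (ω : ℕ → Fin 4) {A : ℕ} (hA : A < 8) (pre : List Ix) (s : State) :
    let x' := s.bit A (pre.map (Ix.eval s) ++ [1, s.idx 12])
    let z' := s.bit A (pre.map (Ix.eval s) ++ [0, s.idx 12])
    let k := s.idx 12
    regPhase (run ω (mulBody A pre) s) = regPhase s * (ipow (x' && z') * sg (s.bit 11 [k] && x')) ∧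
    (run ω (mulBody A pre) s).bit 10 = Function.update (s.bit 10) [k] (xor (s.bit 10 [k]) x') ∧
    (run ω (mulBody A pre) s).bit 11 = Function.update (s.bit 11) [k] (xor (s.bit 11 [k]) z') := by
  have h8 : A ≠ 8 := by omega
  have h9 : A ≠ 9 := by omega
  have h10 : A ≠ 10 := by omega
  have h15 : A ≠ 15 := by omega
  have h16 : A ≠ 16 := by omega
  refine ⟨?_, ?_, ?_⟩
  · rw [← mul_assoc]
    simp only [regPhase]
    rw [← phase_xor_i, ← phase_xor_sign]
    simp [mulBody, run, block, cell, State.getBit, Cell.eval, h8, h9, h10, h15, h16]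
  · simp [mulBody, run, block, cell, State.getBit, Cell.eval, h8, h9, h10, h15, h16]
  · simp [mulBody, run, block, cell, State.getBit, Cell.eval, h8, h9, h10, h15, h16]

theorem regOp_mulProg (ω : ℕ → Fin 4) {n A : ℕ} (hA : A < 7) {pre : List Ix}
    (hpre : Ix.reg 12 ∉ pre) {s : State} (hn : s.idx 0 = n) :
    regOp n (run ω (mulProg A pre) s) = regOp n s * storedOp n s A (pre.map (Ix.eval s)) := by
  rw [mulProg, run_block_cons, run_block_cons, run_block_nil]
  set l := pre.map (Ix.eval s) with hl
  set s1 := run ω (.gate xor (cell 9) (cell 9) ⟨A + 1, pre⟩) s with hs1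
  have hA9 : A + 1 ≠ 9 := by omega
  have e8 : s1.bit 8 = s.bit 8 := by simp [hs1, run, cell]
  have e9 : s1.bit 9 [] = xor (s.bit 9 []) (s.bit (A + 1) l) := by
    simp [hs1, run, cell, State.getBit, Cell.eval, hl]
  have eA : ∀ a, a ≠ 9 → s1.bit a = s.bit a := fun a ha => by simp [hs1, run, cell, ha]
  have hph1 : regPhase s1 = regPhase s * sg (s.bit (A + 1) l) := by
    rw [regPhase, e8, e9, phase_xor_sign, regPhase]
  let x' : ℕ → Bool := fun j => s.bit A (l ++ [1, j])
  let z' : ℕ → Bool := fun j => s.bit A (l ++ [0, j])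
  have key := loop_induct ω (v := 12) (e := .reg 0) (p := mulBody A pre) (s := s1) n hn
    (fun k s' => regPhase s' = regPhase s1 *
        ∏ j ∈ Finset.range k, (ipow (x' j && z' j) * sg (s.bit 11 [j] && x' j)) ∧
      (∀ j, s'.bit 10 [j] = if j < k then xor (s.bit 10 [j]) (x' j) else s.bit 10 [j]) ∧
      (∀ j, s'.bit 11 [j] = if j < k then xor (s.bit 11 [j]) (z' j) else s.bit 11 [j]))
    ⟨by simp [regPhase], fun j => by simp [eA], fun j => by simp [eA]⟩
    (fun _ _ _ h => h) (by
      rintro k - s' hF hk ⟨i1, i2, i3⟩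
      have hl' : pre.map (Ix.eval s') = l := by
        refine Ix.map_eval_congr fun v hv => ?_
        rw [hF.idx v (by
          simp only [Prog.wIdx, mulBody_wIdx, List.mem_singleton]
          rintro rfl; exact hpre hv)]
        rfl
      have hA' : s'.bit A = s.bit A := by
        rw [hF.bit A (by
          simp only [Prog.wBit, mulBody_wBit, List.mem_cons, List.not_mem_nil, or_false]; omega),
          eA A (by omega)]
      obtain ⟨b1, b2, b3⟩ := run_mulBody ω (by omega : A < 8) pre s'
      rw [hl', hA', hk] at b1 b2 b3
      refine ⟨?_, fun j => ?_, fun j => ?_⟩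
      · rw [b1, i1, Finset.prod_range_succ, mul_assoc, i3 k, if_neg (lt_irrefl k)]
      · rw [b2]
        by_cases hj : j = k
        · subst hj; simp [i2, x']
        · have : j < k + 1 ↔ j < k := by omega
          simp [hj, i2, this]
      · rw [b3]
        by_cases hj : j = k
        · subst hj; simp [i3, z']
        · have : j < k + 1 ↔ j < k := by omega
          simp [hj, i3, this])
  obtain ⟨k1, k2, k3⟩ := key
  rw [regOp, k1, hph1, regOp, storedOp, Matrix.smul_mul, xzOp_mul_signedPauli, smul_smul,
    ← Fin.prod_univ_eq_prod_range]
  simp only [k2, k3, Fin.is_lt, if_true, ← mul_assoc, x', z']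

/-- The body of the loop in `commProg`. -/
def commBody (A : ℕ) (pre : List Ix) : Prog := block [
  .gate and (cell 15) ⟨10, [.reg 12]⟩ ⟨A, pre ++ [.const 0, .reg 12]⟩,
  .gate xor (cell 14) (cell 14) (cell 15),
  .gate and (cell 15) ⟨11, [.reg 12]⟩ ⟨A, pre ++ [.const 1, .reg 12]⟩,
  .gate xor (cell 14) (cell 14) (cell 15)]

/-- Sets the flag in the bit cell `14` if the Pauli register anticommutes with a stored Pauli
operator, and clears it otherwise. -/
def commProg (A : ℕ) (pre : List Ix) : Prog := block [
  .gate (fun _ _ => false) (cell 14) (cell 14) (cell 14),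
  .loop 12 (.reg 0) (commBody A pre)]

theorem commBody_wIdx (A : ℕ) (pre : List Ix) : (commBody A pre).wIdx = [] := rfl
theorem commBody_wBit (A : ℕ) (pre : List Ix) : (commBody A pre).wBit = [15, 14, 15, 14] := rfl
theorem commProg_wIdx (A : ℕ) (pre : List Ix) : (commProg A pre).wIdx = [12] := rfl
theorem commProg_wBit (A : ℕ) (pre : List Ix) : (commProg A pre).wBit = [14, 15, 14, 15, 14] := rfl

theorem sg_xor (a b : Bool) : sg (xor a b) = sg a * sg b := by
  cases a <;> cases b <;> simp [sg]

theorem regOp_congr {n : ℕ} {s s' : State} (h8 : s'.bit 8 = s.bit 8) (h9 : s'.bit 9 = s.bit 9)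
    (h10 : s'.bit 10 = s.bit 10) (h11 : s'.bit 11 = s.bit 11) : regOp n s' = regOp n s := by
  simp only [regOp, regPhase, h8, h9, h10, h11]

theorem regOp_commProg (ω : ℕ → Fin 4) {n A : ℕ} {pre : List Ix} {s : State} :
    regOp n (run ω (commProg A pre) s) = regOp n s := by
  have hF := frame_run ω (commProg A pre) s
  have h := fun a (ha : a ∉ (commProg A pre).wBit) => hF.bit a ha
  simp only [commProg_wBit] at h
  exact regOp_congr (h _ (by simp)) (h _ (by simp)) (h _ (by simp)) (h _ (by simp))

theorem regOp_mul_storedOp_comm (ω : ℕ → Fin 4) {n A : ℕ} (hA : A < 7) {pre : List Ix}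
    (hpre : Ix.reg 12 ∉ pre) {s : State} (hn : s.idx 0 = n) :
    regOp n s * storedOp n s A (pre.map (Ix.eval s)) =
      sg ((run ω (commProg A pre) s).bit 14 []) •
        (storedOp n s A (pre.map (Ix.eval s)) * regOp n s) := by
  set l := pre.map (Ix.eval s) with hl
  have key : sg ((run ω (commProg A pre) s).bit 14 []) = ∏ j ∈ Finset.range n,
      sg (xor (s.bit 10 [j] && s.bit A (l ++ [0, j])) (s.bit 11 [j] && s.bit A (l ++ [1, j]))) := by
    rw [commProg, run_block_cons, run_block_cons, run_block_nil]
    set s1 := run ω (.gate (fun _ _ => false) (cell 14) (cell 14) (cell 14)) s with hs1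
    have e14 : s1.bit 14 [] = false := by simp [hs1, run, cell, Cell.eval]
    have eA : ∀ a, a ≠ 14 → s1.bit a = s.bit a := fun a ha => by simp [hs1, run, cell, ha]
    refine loop_induct ω (v := 12) (e := .reg 0) (p := commBody A pre) (s := s1) n hn
      (fun k s' => sg (s'.bit 14 []) = ∏ j ∈ Finset.range k,
        sg (xor (s.bit 10 [j] && s.bit A (l ++ [0, j])) (s.bit 11 [j] && s.bit A (l ++ [1, j]))))
      (by simp [e14, sg]) (fun _ _ _ h => h) ?_
    rintro k - s' hF hk i1
    have hl' : pre.map (Ix.eval s') = l := by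
      refine Ix.map_eval_congr fun v hv => ?_
      rw [hF.idx v (by
        simp only [Prog.wIdx, commBody_wIdx, List.mem_singleton]
        rintro rfl; exact hpre hv)]
      rfl
    have hb : ∀ a, a ≠ 14 → a ≠ 15 → s'.bit a = s.bit a := by
      intro a h1 h2
      rw [hF.bit a (by
        simp only [Prog.wBit, commBody_wBit, List.mem_cons, List.not_mem_nil, or_false]; omega), eA a h1]
    rw [Finset.prod_range_succ, ← i1, ← sg_xor]
    have h14 : A ≠ 14 := by omega
    have h15 : A ≠ 15 := by omega
    simp [commBody, run, block, cell, State.getBit, Cell.eval, h14, h15, hl', hk, hb]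
  rw [key, ← Fin.prod_univ_eq_prod_range (fun j => sg (xor (s.bit 10 [j] && s.bit A (l ++ [0, j]))
    (s.bit 11 [j] && s.bit A (l ++ [1, j])))), regOp, Matrix.smul_mul, storedOp,
    xzOp_mul_signedPauli_comm, Matrix.mul_smul, smul_comm]

end RealRAM

/-! ### Inverse Clifford conjugation -/

theorem generator_mul_self {n : ℕ} (g : Fin 2) (k : Fin n) : generator g k * generator g k = 1 :=
  pauliString_mul_self _

theorem generator_commute {n : ℕ} {k k' : Fin n} (h : k ≠ k') (g g' : Fin 2) :
    Commute (generator g k) (generator g' k') := by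
  rw [commute_iff_eq, generator, generator, pauliString_eq_tens, pauliString_eq_tens, tens_mul,
    tens_mul]
  congr 1
  funext j
  have h0 : pauli 0 = 1 := by simp [pauli, Matrix.one_fin_two]
  by_cases hj : j = k
  · have hj' : j ≠ k' := fun e => h (hj.symm.trans e)
    simp [hj', h0]
  · simp [hj, h0]

theorem generator_anticommute {n : ℕ} (k : Fin n) :
    generator 0 k * generator 1 k = -(generator 1 k * generator 0 k) := by
  rw [generator_zero, generator_one, xzOp_mul, xzOp_mul]
  have h1 : ∏ j : Fin n, sg (Function.update (fun _ => false) k true j &&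
      Function.update (fun _ => false) k true j) = -1 := by
    rw [Finset.prod_eq_single k (fun j _ hj => by simp [hj, sg]) (by simp)]
    simp [sg]
  have h2 : ∏ j : Fin n, sg (false && false) = 1 := by simp [sg]
  rw [h1, h2, one_smul, neg_one_smul]
  simp

/-- A generator conjugated by `V`, i.e. a row of the tableau of `V`. -/
def row {n : ℕ} (V : Op n) (g : Fin 2) (k : Fin n) : Op n := V * generator g k * Vᴴ

section Conj

variable {n : ℕ} {V : Op n}

theorem conj_mul_conj (hV : V ∈ Matrix.unitaryGroup (Fin n → Fin 2) ℂ)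
    (A B : Op n) : (V * A * Vᴴ) * (V * B * Vᴴ) = V * (A * B) * Vᴴ := by
  have h1 : Vᴴ * V = 1 := (Matrix.mem_unitaryGroup_iff').1 hV
  calc (V * A * Vᴴ) * (V * B * Vᴴ) = V * A * (Vᴴ * V) * B * Vᴴ := by simp only [mul_assoc]
    _ = _ := by rw [h1, mul_one]; simp only [mul_assoc]

theorem row_commute (hV : V ∈ Matrix.unitaryGroup (Fin n → Fin 2) ℂ)
    {k k' : Fin n} (h : k ≠ k') (g g' : Fin 2) :
    Commute (row V g k) (row V g' k') := by
  rw [commute_iff_eq, row, row, conj_mul_conj hV, conj_mul_conj hV, (generator_commute h g g').eq]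

theorem row_anticommute (hV : V ∈ Matrix.unitaryGroup (Fin n → Fin 2) ℂ)
    (k : Fin n) : row V 0 k * row V 1 k = -(row V 1 k * row V 0 k) := by
  rw [row, row, conj_mul_conj hV, conj_mul_conj hV, generator_anticommute, mul_neg, neg_mul]

theorem bpow_row (hV : V ∈ Matrix.unitaryGroup (Fin n → Fin 2) ℂ)
    (b : Bool) (g : Fin 2) (k : Fin n) :
    bpow b (row V g k) = V * bpow b (generator g k) * Vᴴ := by
  have h2 : V * Vᴴ = 1 := (Matrix.mem_unitaryGroup_iff).1 hV
  cases b
  · simp [bpow, h2]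
  · simp [bpow, row]

/-- One round of the reduction: after multiplication by the rows of qubit `k` that are selected by
the commutation flags, the operator commutes with these rows as well. -/
theorem reduction_commute (hV : V ∈ Matrix.unitaryGroup (Fin n → Fin 2) ℂ)
    {T : Op n} {k : Fin n} {a b : Bool}
    (ha : T * row V 1 k = sg a • (row V 1 k * T))
    (hb : T * bpow a (row V 0 k) * row V 0 k = sg b • (row V 0 k * (T * bpow a (row V 0 k))))
    (hold : ∀ g, ∀ k' < k, Commute T (row V g k')) :
    ∀ g, ∀ k' ≤ k, Commute (T * bpow a (row V 0 k) * bpow b (row V 1 k)) (row V g k') := by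
  have hbp : ∀ (c : Bool) (A B : Op n), Commute A B → Commute (bpow c A) B := by
    intro c A B h
    cases c
    · simp [bpow]
    · simpa [bpow] using h
  intro g k' hk'
  rcases hk'.lt_or_eq with h | rfl
  · exact ((hold g k' h).mul_left (hbp _ _ _ (row_commute hV h.ne' _ _))).mul_left
      (hbp _ _ _ (row_commute hV h.ne' _ _))
  · have hanti := row_anticommute hV k'
    have hanti' : row V 1 k' * row V 0 k' = -(row V 0 k' * row V 1 k') := by rw [hanti, neg_neg]
    have h1 : Commute (T * bpow a (row V 0 k')) (row V 1 k') := by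
      rw [commute_iff_eq]
      cases a
      · simpa [bpow, sg] using ha
      · simp only [bpow, if_true, sg, neg_smul, one_smul] at ha ⊢
        rw [mul_assoc, hanti, mul_neg, ← mul_assoc, ha, neg_mul, neg_neg, mul_assoc]
    generalize T * bpow a (row V 0 k') = T1 at hb h1 ⊢
    have h0 : Commute (T1 * bpow b (row V 1 k')) (row V 0 k') := by
      rw [commute_iff_eq]
      cases b
      · simpa [bpow, sg] using hb
      · simp only [bpow, if_true, sg, neg_smul, one_smul] at hb ⊢
        rw [mul_assoc, hanti', mul_neg, ← mul_assoc, hb, neg_mul, neg_neg, mul_assoc]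
    have h1' : Commute (T1 * bpow b (row V 1 k')) (row V 1 k') :=
      h1.mul_left (hbp _ _ _ (Commute.refl _))
    fin_cases g
    · exact h0
    · exact h1'

/-- Each round moves a factor from the register into the bits of the preimage: the rows are
involutions, so multiplying by them and recording them cancels. -/
theorem reduction_invariant (hV : V ∈ Matrix.unitaryGroup (Fin n → Fin 2) ℂ)
    (T : Op n) {k : Fin n} (a b : Bool) {x z : Fin n → Bool}
    (hx : x k = false) (hz : z k = false) :
    T * bpow a (row V 0 k) * bpow b (row V 1 k) *
        (V * xzOp (Function.update x k b) (Function.update z k a) * Vᴴ) =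
      T * (V * xzOp x z * Vᴴ) := by
  have hsq : ∀ (c : Bool) (g : Fin 2), bpow c (generator g k) * bpow c (generator g k) = 1 := by
    intro c g
    cases c
    · simp [bpow]
    · simpa [bpow] using generator_mul_self g k
  rw [← bpow_mul_bpow_mul_xzOp x z k hx hz a b, bpow_row hV, bpow_row hV, mul_assoc T,
    conj_mul_conj hV, mul_assoc T, conj_mul_conj hV]
  congr 3
  calc bpow a (generator 0 k) * bpow b (generator 1 k) *
        (bpow b (generator 1 k) * bpow a (generator 0 k) * xzOp x z)
      = bpow a (generator 0 k) * (bpow b (generator 1 k) * bpow b (generator 1 k)) *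
          bpow a (generator 0 k) * xzOp x z := by simp only [mul_assoc]
    _ = _ := by rw [hsq, mul_one, hsq, one_mul]

end Conj

namespace RealRAM

/-- The body of the reduction loop in `cliffProg`. -/
def cliffBody : Prog := block [
  commProg 0 [.reg 8, .reg 11, .const 1, .reg 13],
  .gate and ⟨12, [.reg 13]⟩ (cell 14) (cell 14),
  .ifBit (cell 14) (mulProg 0 [.reg 8, .reg 11, .const 0, .reg 13]) .skip,
  commProg 0 [.reg 8, .reg 11, .const 0, .reg 13],
  .gate and ⟨13, [.reg 13]⟩ (cell 14) (cell 14),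
  .ifBit (cell 14) (mulProg 0 [.reg 8, .reg 11, .const 1, .reg 13]) .skip]

/-- The body of the copying loop in `cliffProg`. -/
def copyBody : Prog := block [
  .gate and ⟨10, [.reg 12]⟩ ⟨13, [.reg 12]⟩ ⟨13, [.reg 12]⟩,
  .gate and ⟨11, [.reg 12]⟩ ⟨12, [.reg 12]⟩ ⟨12, [.reg 12]⟩]

/-- Replaces the operator `Q` in the Pauli register by `V† Q V`, where `V` is the gate in layer
`l` (register `11`) for the input number `p` (register `8`). The operator `Q` is reduced to a
phase by rows of the tableau; the rows used (bit arrays `12` and `13`) are the bits of `V† Q V`. -/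
def cliffProg : Prog := block [
  .loop 13 (.reg 0) cliffBody,
  .loop 12 (.reg 0) copyBody]

theorem cliffBody_wIdx : cliffBody.wIdx = [12, 12, 12, 12] := rfl
theorem cliffBody_wBit : cliffBody.wBit = [14, 15, 14, 15, 14, 12, 9, 15, 16, 9, 8, 15, 9, 10, 11,
  14, 15, 14, 15, 14, 13, 9, 15, 16, 9, 8, 15, 9, 10, 11] := rfl
theorem cliffProg_wIdx : cliffProg.wIdx = [13, 12, 12, 12, 12, 12] := rfl
theorem cliffProg_wBit : cliffProg.wBit = [14, 15, 14, 15, 14, 12, 9, 15, 16, 9, 8, 15, 9, 10, 11,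
  14, 15, 14, 15, 14, 13, 9, 15, 16, 9, 8, 15, 9, 10, 11, 10, 11] := rfl
theorem cliffProg_wReal : cliffProg.wReal = [] := rfl

/-- One half of a reduction round: the flag is the commutation sign with the first row, and the
register is multiplied by the second row if the flag is set. -/
theorem run_reduce (ω : ℕ → Fin 4) {n : ℕ} (t : ℕ) (ht : t = 12 ∨ t = 13) (pre pre' : List Ix)
    (hpre : Ix.reg 12 ∉ pre) (hpre' : Ix.reg 12 ∉ pre') {s : State} (hn : s.idx 0 = n) :
    let s' := run ω (block [commProg 0 pre, .gate and ⟨t, [.reg 13]⟩ (cell 14) (cell 14),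
      .ifBit (cell 14) (mulProg 0 pre') .skip]) s
    ∃ a : Bool, s'.bit t = Function.update (s.bit t) [s.idx 13] a ∧
      regOp n s * storedOp n s 0 (pre.map (Ix.eval s)) =
        sg a • (storedOp n s 0 (pre.map (Ix.eval s)) * regOp n s) ∧
      regOp n s' = regOp n s * bpow a (storedOp n s 0 (pre'.map (Ix.eval s))) := by
  intro s'
  have hF := frame_run ω (commProg 0 pre) s
  have h0 := regOp_mul_storedOp_comm ω (A := 0) (by norm_num) hpre hn
  have h1 : regOp n (run ω (commProg 0 pre) s) = regOp n s := regOp_commProg ω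
  set s1 := run ω (commProg 0 pre) s with hs1
  set a := s1.bit 14 [] with ha
  refine ⟨a, ?_, h0, ?_⟩
  all_goals
    have hbit : ∀ c, c ∉ [14, 15, 14, 15, 14] → s1.bit c = s.bit c := fun c hc => hF.bit c hc
    have hidx : ∀ v, v ≠ 12 → s1.idx v = s.idx v := fun v hv => hF.idx v (by
      simpa [commProg_wIdx] using hv)
    set s2 := run ω (.gate and ⟨t, [.reg 13]⟩ (cell 14) (cell 14)) s1 with hs2
    have e2 : s2.bit = Function.update s1.bit t (Function.update (s1.bit t) [s.idx 13] a) := by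
      simp [hs2, run, State.getBit, cell, Cell.eval, hidx, ha]
    have i2 : s2.idx = s1.idx := rfl
    have g2 : s2.getBit (cell 14) = a := by
      have : s2.bit 14 [] = a := by
        rw [e2, Function.update_of_ne (by omega)]
      simpa [State.getBit, cell, Cell.eval] using this
    have hs' : s' = if a = true then run ω (mulProg 0 pre') s2.tick else s2.tick := by
      change (if s2.getBit (cell 14) = true then _ else _) = _
      rw [g2]
      rfl
    clear_value a
  · have h3 : s'.bit t = s2.bit t := by
      rw [hs']
      split_ifs
      · rw [(frame_run ω (mulProg 0 pre') s2.tick).bit t (by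
          rcases ht with rfl | rfl <;> simp [mulProg_wBit])]
        rfl
      · rfl
    rw [h3, e2, Function.update_self, hbit t (by rcases ht with rfl | rfl <;> simp)]
  · have h2 : regOp n s2 = regOp n s := by
      rw [← h1]
      refine regOp_congr ?_ ?_ ?_ ?_ <;> rw [e2, Function.update_of_ne (by omega)]
    rw [hs']
    cases a
    · simp only [Bool.false_eq_true, if_false, bpow, mul_one]
      exact h2
    · simp only [if_true, bpow]
      have hn2 : s2.tick.idx 0 = n := by
        rw [tick_idx, i2, hidx 0 (by norm_num), hn]
      rw [regOp_mulProg ω (by norm_num) hpre' hn2]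
      have hm : pre'.map (Ix.eval s2.tick) = pre'.map (Ix.eval s) := by
        refine Ix.map_eval_congr fun v hv => ?_
        rw [tick_idx, i2, hidx v (by rintro rfl; exact hpre' hv)]
      have hb : ∀ c, c < 2 → s2.tick.bit c = s.bit c := by
        intro c hc
        rw [tick_bit, e2, Function.update_of_ne (by omega), hbit c (by simp; omega)]
      rw [show regOp n s2.tick = regOp n s from h2, hm, storedOp, hb 0 (by norm_num),
        hb (0 + 1) (by norm_num), storedOp]

/-- The bits at the positions below `k`. -/
def bitsBelow (n : ℕ) (f : List ℕ → Bool) (k : ℕ) (j : Fin n) : Bool :=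
  if (j : ℕ) < k then f [j] else false

theorem bitsBelow_update {n : ℕ} (f : List ℕ → Bool) (k : Fin n) (a : Bool) :
    bitsBelow n (Function.update f [(k : ℕ)] a) (k + 1) = Function.update (bitsBelow n f k) k a := by
  funext j
  by_cases hj : j = k
  · subst hj; simp [bitsBelow]
  · have h1 : (j : ℕ) ≠ k := fun e => hj (Fin.ext e)
    have h2 : (j : ℕ) < k + 1 ↔ (j : ℕ) < k := by omega
    simp [bitsBelow, hj, h1, h2]

/-- After all rounds the register commutes with the whole tableau, hence is a phase, while the product
of the register and of `V X^x Z^z V†` for the recorded bits is still `Q`. -/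
theorem regOp_cliffProg (ω : ℕ → Fin 4) {n : ℕ} {s : State} (hn : s.idx 0 = n) {V : Op n}
    (hV : V ∈ Matrix.unitaryGroup (Fin n → Fin 2) ℂ)
    (htab : ∀ (g : Fin 2) (k : Fin n), row V g k = storedOp n s 0 [s.idx 8, s.idx 11, g, k]) :
    regOp n (run ω cliffProg s) = Vᴴ * regOp n s * V := by
  have h1 : Vᴴ * V = 1 := (Matrix.mem_unitaryGroup_iff').1 hV
  have h2 : V * Vᴴ = 1 := (Matrix.mem_unitaryGroup_iff).1 hV
  rw [cliffProg, run_block_cons, run_block_cons, run_block_nil]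
  set Q := regOp n s with hQ
  have key := loop_induct ω (v := 13) (e := .reg 0) (p := cliffBody) (s := s) n hn
    (fun k s' => regOp n s' * (V * xzOp (bitsBelow n (s'.bit 13) k) (bitsBelow n (s'.bit 12) k) * Vᴴ)
        = Q ∧ ∀ g, ∀ k' : Fin n, (k' : ℕ) < k → Commute (regOp n s') (row V g k'))
    ⟨by
      have e : ∀ f, bitsBelow n f 0 = fun _ => false := fun f => by funext j; simp [bitsBelow]
      rw [e, e, xzOp_false, mul_one, h2, mul_one]
      rfl, fun g k' hk' => absurd hk' (by omega)⟩
    (fun _ _ _ h => h) (by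
      rintro k hk s' hF hk' ⟨i1, i2⟩
      have hidx : ∀ v, v ≠ 12 → v ≠ 13 → s'.idx v = s.idx v := fun v hv hv' => hF.idx v (by
        simp [Prog.wIdx, cliffBody_wIdx, hv, hv'])
      have hrow : ∀ (u : State), u.bit 0 = s.bit 0 → u.bit 1 = s.bit 1 →
          (∀ v, v ≠ 12 → v ≠ 13 → u.idx v = s.idx v) → u.idx 13 = k → ∀ g : Fin 2,
          storedOp n u 0 (List.map (Ix.eval u) [.reg 8, .reg 11, .const g, .reg 13]) =
            row V g ⟨k, hk⟩ := by
        intro u b0 b1 hu hu13 g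
        rw [htab]
        simp [storedOp, b0, b1, hu, hu13]
      have hstr : run ω cliffBody s' =
          run ω (block [commProg 0 [.reg 8, .reg 11, .const 0, .reg 13],
            .gate and ⟨13, [.reg 13]⟩ (cell 14) (cell 14),
            .ifBit (cell 14) (mulProg 0 [.reg 8, .reg 11, .const 1, .reg 13]) .skip])
          (run ω (block [commProg 0 [.reg 8, .reg 11, .const 1, .reg 13],
            .gate and ⟨12, [.reg 13]⟩ (cell 14) (cell 14),
            .ifBit (cell 14) (mulProg 0 [.reg 8, .reg 11, .const 0, .reg 13]) .skip]) s') := rfl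
      have hn' : s'.idx 0 = n := by rw [hidx 0 (by norm_num) (by norm_num), hn]
      obtain ⟨a, a1, a2, a3⟩ := run_reduce ω 12 (Or.inl rfl)
        [.reg 8, .reg 11, .const 1, .reg 13] [.reg 8, .reg 11, .const 0, .reg 13]
        (by simp) (by simp) hn'
      have hF1 := frame_run ω (block [commProg 0 [.reg 8, .reg 11, .const 1, .reg 13],
            .gate and ⟨12, [.reg 13]⟩ (cell 14) (cell 14),
            .ifBit (cell 14) (mulProg 0 [.reg 8, .reg 11, .const 0, .reg 13]) .skip]) s'
      rw [hstr]
      set s1 := run ω (block [commProg 0 [.reg 8, .reg 11, .const 1, .reg 13],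
            .gate and ⟨12, [.reg 13]⟩ (cell 14) (cell 14),
            .ifBit (cell 14) (mulProg 0 [.reg 8, .reg 11, .const 0, .reg 13]) .skip]) s' with hs1
      have hw1 : ∀ c, c ∉ [14, 15, 14, 15, 14, 12, 9, 15, 16, 9, 8, 15, 9, 10, 11] →
        s1.bit c = s'.bit c := fun c hc => hF1.bit c hc
      have hi1 : ∀ v, v ∉ [12, 12] → s1.idx v = s'.idx v := fun v hv => hF1.idx v hv
      have hn1 : s1.idx 0 = n := by rw [hi1 0 (by simp), hn']
      obtain ⟨b, b1, b2, b3⟩ := run_reduce ω 13 (Or.inr rfl)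
        [.reg 8, .reg 11, .const 0, .reg 13] [.reg 8, .reg 11, .const 1, .reg 13]
        (by simp) (by simp) hn1
      have hF2 := frame_run ω (block [commProg 0 [.reg 8, .reg 11, .const 0, .reg 13],
            .gate and ⟨13, [.reg 13]⟩ (cell 14) (cell 14),
            .ifBit (cell 14) (mulProg 0 [.reg 8, .reg 11, .const 1, .reg 13]) .skip]) s1
      set s2 := run ω (block [commProg 0 [.reg 8, .reg 11, .const 0, .reg 13],
            .gate and ⟨13, [.reg 13]⟩ (cell 14) (cell 14),
            .ifBit (cell 14) (mulProg 0 [.reg 8, .reg 11, .const 1, .reg 13]) .skip]) s1 with hs2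
      have hw2 : ∀ c, c ∉ [14, 15, 14, 15, 14, 13, 9, 15, 16, 9, 8, 15, 9, 10, 11] →
        s2.bit c = s1.bit c := fun c hc => hF2.bit c hc
      have hb' : ∀ c, c < 2 → s'.bit c = s.bit c := fun c hc => hF.bit c (by
        simp only [Prog.wBit, cliffBody_wBit, List.mem_cons, List.not_mem_nil, or_false]; omega)
      have r' := hrow s' (hb' 0 (by norm_num)) (hb' 1 (by norm_num)) hidx hk'
      have r1 := hrow s1 ((hw1 0 (by simp)).trans (hb' 0 (by norm_num)))
        ((hw1 1 (by simp)).trans (hb' 1 (by norm_num)))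
        (fun v hv hv' => (hi1 v (by simp [hv])).trans (hidx v hv hv'))
        ((hi1 13 (by simp)).trans hk')
      have q0 : storedOp n s' 0 (List.map (Ix.eval s') [.reg 8, .reg 11, .const 0, .reg 13]) =
        row V 0 ⟨k, hk⟩ := r' 0
      have q1 : storedOp n s' 0 (List.map (Ix.eval s') [.reg 8, .reg 11, .const 1, .reg 13]) =
        row V 1 ⟨k, hk⟩ := r' 1
      have p0 : storedOp n s1 0 (List.map (Ix.eval s1) [.reg 8, .reg 11, .const 0, .reg 13]) =
        row V 0 ⟨k, hk⟩ := r1 0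
      have p1 : storedOp n s1 0 (List.map (Ix.eval s1) [.reg 8, .reg 11, .const 1, .reg 13]) =
        row V 1 ⟨k, hk⟩ := r1 1
      rw [q1] at a2
      rw [q0] at a3
      rw [p0, a3] at b2
      rw [p1, a3] at b3
      rw [b3]
      constructor
      · have e13 : s2.bit 13 = Function.update (s'.bit 13) [((⟨k, hk⟩ : Fin n) : ℕ)] b := by
          rw [b1, hw1 13 (by simp), hi1 13 (by simp), hk']
        have e12 : s2.bit 12 = Function.update (s'.bit 12) [((⟨k, hk⟩ : Fin n) : ℕ)] a := by
          rw [hw2 12 (by simp), a1, hk']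
        rw [e13, e12]
        have u13 := bitsBelow_update (s'.bit 13) ⟨k, hk⟩ b
        have u12 := bitsBelow_update (s'.bit 12) ⟨k, hk⟩ a
        simp only at u13 u12
        rw [u13, u12, reduction_invariant hV _ a b (by simp [bitsBelow]) (by simp [bitsBelow]), i1]
      · intro g k'' hk''
        exact reduction_commute hV a2 b2 (fun g k₁ h₁ => i2 g k₁ h₁) g k'' (by
          rw [Fin.le_def]; simp only; omega))
  obtain ⟨k1, k2⟩ := key
  set s1 := run ω (.loop 13 (.reg 0) cliffBody) s with hs1
  have hn1 : s1.idx 0 = n := by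
    rw [(frame_run ω (.loop 13 (.reg 0) cliffBody) s).idx 0 (by simp [Prog.wIdx, cliffBody_wIdx]), hn]
  have key2 := loop_induct ω (v := 12) (e := .reg 0) (p := copyBody) (s := s1) n hn1
    (fun k s' => ∀ j < k, s'.bit 10 [j] = s1.bit 13 [j] ∧ s'.bit 11 [j] = s1.bit 12 [j])
    (fun j hj => absurd hj (by omega)) (fun _ _ _ h => h) (by
      intro k hk s' hF hk' i1 j hj
      have e12 : s'.bit 12 = s1.bit 12 := hF.bit 12 (by simp [Prog.wBit, copyBody, block])
      have e13 : s'.bit 13 = s1.bit 13 := hF.bit 13 (by simp [Prog.wBit, copyBody, block])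
      by_cases hjk : j = k
      · subst hjk
        simp [copyBody, run, block, State.getBit, Cell.eval, hk', e12, e13]
      · have := i1 j (by omega)
        simp [copyBody, run, block, State.getBit, Cell.eval, hk', hjk, this])
  have hF2 := frame_run ω (.loop 12 (.reg 0) copyBody) s1
  set s2 := run ω (.loop 12 (.reg 0) copyBody) s1 with hs2
  have e8 : s2.bit 8 = s1.bit 8 := hF2.bit 8 (by simp [Prog.wBit, copyBody, block])
  have e9 : s2.bit 9 = s1.bit 9 := hF2.bit 9 (by simp [Prog.wBit, copyBody, block])
  have hfin : regOp n s2 = regPhase s1 • xzOp (fun j : Fin n => s1.bit 13 [j]) (fun j => s1.bit 12 [j]) := by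
    rw [regOp, regPhase, e8, e9, regPhase]
    congr 2 <;> funext j
    · exact (key2 j j.2).1
    · exact (key2 j j.2).2
  have hb : ∀ f, bitsBelow n f n = fun j : Fin n => f [(j : ℕ)] := fun f => by
    funext j; simp [bitsBelow]
  rw [hb, hb] at k1
  have hph : regOp n s1 = regPhase s1 • (1 : Op n) := by
    refine smul_xzOp_eq_of_commute V hV _ _ _ fun g k => ?_
    have := (k2 g k k.2).eq
    rw [regOp, Matrix.smul_mul, Matrix.mul_smul] at this
    exact smul_right_injective _ (phase_ne_zero _ _) this
  rw [hfin, ← k1, hph, Matrix.smul_mul, one_mul, Matrix.mul_smul, Matrix.smul_mul]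
  congr 1
  calc xzOp (fun j : Fin n => s1.bit 13 [j]) (fun j => s1.bit 12 [j])
      = (Vᴴ * V) * xzOp (fun j : Fin n => s1.bit 13 [j]) (fun j => s1.bit 12 [j]) * (Vᴴ * V) := by
        rw [h1, one_mul, mul_one]
    _ = _ := by simp only [mul_assoc]

/-! ### Evaluation of the model function at grid points -/

/-- The bit of the grid angle of parameter `l` (register `11`) in sample `j` (register `6`) that
stands for a quarter turn. -/
def unitCell : Cell := ⟨6, [.reg 6, .reg 11]⟩

/-- The bit of the current grid angle that stands for a half turn. -/
def twoCell : Cell := ⟨7, [.reg 6, .reg 11]⟩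

/-- Multiplication of the Pauli register by the generator of parameter `l` and by `-i` or `i`. -/
def quarterTurn : Prog := block [
  mulProg 2 [.reg 11],
  .gate xor (cell 9) (cell 9) (cell 8),
  .gate (fun a _ => !a) (cell 8) (cell 8) (cell 8),
  .gate (fun a b => xor a (!b)) (cell 9) (cell 9) twoCell]

/-- Replaces the operator `Q` in the Pauli register by `R† Q R` for the rotation `R` in layer `l`
at the current grid angle. -/
def rotProg : Prog := block [
  commProg 2 [.reg 11],
  .ifBit (cell 14) (.ifBit unitCell quarterTurn (.gate xor (cell 9) (cell 9) twoCell)) .skip]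

theorem rotProg_wIdx : rotProg.wIdx = [12, 12] := rfl
theorem rotProg_wBit : rotProg.wBit =
  [14, 15, 14, 15, 14, 9, 15, 16, 9, 8, 15, 9, 10, 11, 9, 8, 9, 9] := rfl

/-- The pair of bits `b 6`, `b 7` at the address `l` represents the grid angle `κ`. -/
def IsAngle (s : State) (l : List ℕ) (κ : Fin 4) : Prop :=
  s.bit 6 l = Nat.testBit κ 0 ∧ s.bit 7 l = Nat.testBit κ 1

theorem regOp_of_phase {n : ℕ} {s s' : State} (c : ℂ) (h10 : s'.bit 10 = s.bit 10)
    (h11 : s'.bit 11 = s.bit 11) (h : regPhase s' = c * regPhase s) :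
    regOp n s' = c • regOp n s := by
  rw [regOp, h, h10, h11, regOp, smul_smul]

theorem cos_sin_grid (κ : Fin 4) :
    (Real.cos ((κ : ℕ) * (Real.pi / 2)), Real.sin ((κ : ℕ) * (Real.pi / 2))) =
      ((![1, 0, -1, 0] : Fin 4 → ℝ) κ, (![0, 1, 0, -1] : Fin 4 → ℝ) κ) := by
  have c2 : Real.cos (2 * (Real.pi / 2)) = -1 := by rw [← Real.cos_pi]; ring_nf
  have s2 : Real.sin (2 * (Real.pi / 2)) = 0 := by rw [← Real.sin_pi]; ring_nf
  have c3 : Real.cos (3 * (Real.pi / 2)) = 0 := by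
    rw [show 3 * (Real.pi / 2) = Real.pi / 2 + Real.pi by ring, Real.cos_add_pi]; simp
  have s3 : Real.sin (3 * (Real.pi / 2)) = -1 := by
    rw [show 3 * (Real.pi / 2) = Real.pi / 2 + Real.pi by ring, Real.sin_add_pi]; simp
  fin_cases κ <;> simp [c2, s2, c3, s3]

/-- At a grid angle an anticommuting operator is multiplied by `1`, `-i P`, `-1` or `i P`. -/
theorem regOp_rotProg (ω : ℕ → Fin 4) {n : ℕ} {s : State} (hn : s.idx 0 = n) {P : Op n}
    (hP : P = storedOp n s 2 [s.idx 11]) (hH : P.IsHermitian) {κ : Fin 4}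
    (hκ : IsAngle s [s.idx 6, s.idx 11] κ) :
    regOp n (run ω rotProg s) =
      (rotation P ((κ : ℕ) * (Real.pi / 2)))ᴴ * regOp n s * rotation P ((κ : ℕ) * (Real.pi / 2)) := by
  have hPP : P * P = 1 := by rw [hP, storedOp, signedPauli_mul_self]
  have h0 := regOp_mul_storedOp_comm ω (A := 2) (pre := [.reg 11]) (by norm_num) (by simp) hn
  simp only [List.map_cons, List.map_nil, Ix.eval_reg] at h0
  rw [← hP] at h0
  have h1 : regOp n (run ω (commProg 2 [.reg 11]) s) = regOp n s := regOp_commProg ω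
  have hF := frame_run ω (commProg 2 [.reg 11]) s
  rw [rotProg, run_block_cons, run_block_cons, run_block_nil]
  set s1 := run ω (commProg 2 [.reg 11]) s with hs1
  have hbit : ∀ c, c ∉ [14, 15, 14, 15, 14] → s1.bit c = s.bit c := fun c hc => hF.bit c hc
  have hidx : ∀ v, v ≠ 12 → s1.idx v = s.idx v := fun v hv => hF.idx v (by
    simpa [commProg_wIdx] using hv)
  have g14 : s1.getBit (cell 14) = s1.bit 14 [] := rfl
  rw [run, g14]
  generalize s1.bit 14 [] = a at h0 ⊢
  cases a
  · simp only [sg, Bool.false_eq_true, if_false, one_smul] at h0 ⊢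
    rw [rotation_conj_of_commute hPP hH h0]
    exact h1
  · simp only [sg, if_true, neg_smul, one_smul] at h0 ⊢
    rw [rotation_conj_of_anticommute hPP hH h0]
    have hcs := cos_sin_grid κ
    rw [Prod.mk.injEq] at hcs
    rw [hcs.1, hcs.2]
    have hn1 : s1.tick.tick.idx 0 = n := (hidx 0 (by norm_num)).trans hn
    have h6 : s1.tick.getBit unitCell = Nat.testBit κ 0 := by
      simp only [State.getBit, unitCell, Cell.eval, tick_bit, List.map_cons, List.map_nil,
        Ix.eval_reg, tick_idx, hidx 6 (by norm_num), hidx 11 (by norm_num), hbit 6 (by simp)]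
      exact hκ.1
    have h7 : s1.bit 7 [s1.idx 6, s1.idx 11] = Nat.testBit κ 1 := by
      rw [hidx 6 (by norm_num), hidx 11 (by norm_num), hbit 7 (by simp)]
      exact hκ.2
    have hmul := regOp_mulProg ω (A := 2) (pre := [.reg 11]) (by norm_num) (by simp) hn1
    have hst : storedOp n s1.tick.tick 2 [s1.tick.tick.idx 11] = P := by
      rw [hP]
      simp only [storedOp, tick_bit, tick_idx, hidx 11 (by norm_num), hbit 2 (by simp),
        hbit (2 + 1) (by simp)]
    simp only [List.map_cons, List.map_nil, Ix.eval_reg] at hmul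
    rw [hst, show regOp n s1.tick.tick = regOp n s from h1] at hmul
    have hF2 := frame_run ω (mulProg 2 [.reg 11]) s1.tick.tick
    have hq : ∀ b : Bool, Nat.testBit κ 1 = b →
        regOp n (run ω quarterTurn s1.tick.tick) = (Complex.I * sg (!b)) • (regOp n s * P) := by
      intro b hb
      rw [← hmul, quarterTurn, run_block_cons]
      set s2 := run ω (mulProg 2 [.reg 11]) s1.tick.tick with hs2
      have b7 : s2.bit 7 [s2.idx 6, s2.idx 11] = b := by
        rw [hF2.bit 7 (by simp [mulProg_wBit]), hF2.idx 6 (by simp [mulProg_wIdx]),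
          hF2.idx 11 (by simp [mulProg_wIdx])]
        exact h7.trans hb
      refine regOp_of_phase _ ?_ ?_ ?_
      · simp [run, block, cell, State.getBit, Cell.eval]
      · simp [run, block, cell, State.getBit, Cell.eval]
      · simp only [regPhase]
        have e := phase_xor_i (s2.bit 8 []) (s2.bit 9 []) true
        rw [show Complex.I * sg (!b) * phase (s2.bit 8 []) (s2.bit 9 []) =
          phase (s2.bit 8 []) (s2.bit 9 []) * ipow true * sg (!b) by simp [ipow]; ring, ← e,
          ← phase_xor_sign]
        simp [run, block, cell, State.getBit, Cell.eval, twoCell, b7]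
    have hh : ∀ b : Bool, Nat.testBit κ 1 = b →
        regOp n (run ω (.gate xor (cell 9) (cell 9) twoCell) s1.tick.tick) = sg b • regOp n s := by
      intro b hb
      rw [← h1]
      refine regOp_of_phase _ ?_ ?_ ?_
      · simp [run, cell]
      · simp [run, cell]
      · rw [mul_comm]
        simp only [regPhase]
        rw [← phase_xor_sign]
        simp [run, cell, State.getBit, Cell.eval, twoCell, h7, hb]
    rw [run, h6]
    fin_cases κ
    · have := hh false rfl
      simpa [sg] using this
    · have := hq false rfl
      simpa [sg] using this
    · have := hh true rfl
      simpa [sg] using this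
    · have := hq true rfl
      simpa [sg] using this

/-- Adds to the real cell `3` the coefficient `c k` (with `k` in register `9`) times the real part
of the matrix element `⟨0ⁿ| Q |0ⁿ⟩` of the operator in the Pauli register. -/
def expProg : Prog := block [
  .gate (fun _ _ => false) (cell 14) (cell 14) (cell 14),
  .loop 12 (.reg 0) (.gate or (cell 14) (cell 14) ⟨10, [.reg 12]⟩),
  .ifBit (cell 14) .skip (.ifBit (cell 8) .skip (.ifBit (cell 9)
    (.arith .sub (cell 3) (cell 3) ⟨0, [.reg 9]⟩) (.arith .add (cell 3) (cell 3) ⟨0, [.reg 9]⟩)))]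

/-- The matrix element vanishes unless all bits `x` do; then it is the phase, whose real part is `±1`
or `0`. -/
theorem real_expProg (ω : ℕ → Fin 4) {n : ℕ} {s : State} (hn : s.idx 0 = n) :
    (run ω expProg s).real 3 [] = s.real 3 [] + s.real 0 [s.idx 9] * (regOp n s 0 0).re := by
  rw [expProg, run_block_cons, run_block_cons, run_block_cons, run_block_nil]
  set s1 := run ω (.gate (fun _ _ => false) (cell 14) (cell 14) (cell 14)) s with hs1
  have e14 : s1.bit 14 [] = false := by simp [hs1, run, cell, Cell.eval]
  have eA : ∀ a, a ≠ 14 → s1.bit a = s.bit a := fun a ha => by simp [hs1, run, cell, ha]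
  have key := loop_induct ω (v := 12) (e := .reg 0)
    (p := .gate or (cell 14) (cell 14) ⟨10, [.reg 12]⟩) (s := s1) n hn
    (fun k s' => s'.bit 14 [] = true ↔ ∃ j < k, s.bit 10 [j] = true)
    (by simp [e14]) (fun _ _ _ h => h) (by
      intro k hk s' hF hk' i1
      have e10 : s'.bit 10 = s.bit 10 := by
        rw [hF.bit 10 (by simp [Prog.wBit, cell]), eA 10 (by norm_num)]
      have : (run ω (.gate or (cell 14) (cell 14) ⟨10, [.reg 12]⟩) s').bit 14 [] =
          (s'.bit 14 [] || s.bit 10 [k]) := by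
        simp [run, cell, State.getBit, Cell.eval, hk', e10]
      rw [this, Bool.or_eq_true, i1]
      constructor
      · rintro (⟨j, hj, h⟩ | h)
        · exact ⟨j, by omega, h⟩
        · exact ⟨k, by omega, h⟩
      · rintro ⟨j, hj, h⟩
        by_cases hjk : j = k
        · subst hjk; exact Or.inr h
        · exact Or.inl ⟨j, by omega, h⟩)
  have hF := frame_run ω (.loop 12 (.reg 0) (.gate or (cell 14) (cell 14) ⟨10, [.reg 12]⟩)) s1
  set s2 := run ω (.loop 12 (.reg 0) (.gate or (cell 14) (cell 14) ⟨10, [.reg 12]⟩)) s1 with hs2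
  have e8 : s2.bit 8 [] = s.bit 8 [] := by
    rw [hF.bit 8 (by simp [Prog.wBit, cell]), eA 8 (by norm_num)]
  have e9 : s2.bit 9 [] = s.bit 9 [] := by
    rw [hF.bit 9 (by simp [Prog.wBit, cell]), eA 9 (by norm_num)]
  have er : s2.real = s.real := by
    funext a; rw [hF.real a (by simp [Prog.wReal])]; rfl
  have ei : s2.idx 9 = s.idx 9 := by rw [hF.idx 9 (by simp [Prog.wIdx])]; rfl
  have h00 : regOp n s 0 0 = if s2.bit 14 [] = true then 0 else phase (s.bit 8 []) (s.bit 9 []) := by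
    rw [regOp, Matrix.smul_apply, xzOp_zero_zero, regPhase]
    have : (∀ j : Fin n, s.bit 10 [(j : ℕ)] = false) ↔ ¬ s2.bit 14 [] = true := by
      rw [key]
      constructor
      · rintro h ⟨j, hj, h'⟩
        have := h ⟨j, hj⟩
        simp [h'] at this
      · intro h j
        by_contra hc
        exact h ⟨j, j.2, by simpa using hc⟩
    by_cases hc : s2.bit 14 [] = true
    · rw [if_neg (by rw [this]; exact fun h => h hc), if_pos hc, smul_zero]
    · rw [if_pos (this.2 hc), if_neg hc, smul_eq_mul, mul_one]
  have g14 : s2.getBit (cell 14) = s2.bit 14 [] := rfl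
  have g8 : s2.tick.getBit (cell 8) = s2.bit 8 [] := rfl
  have g9 : s2.tick.tick.getBit (cell 9) = s2.bit 9 [] := rfl
  rw [h00, run, g14]
  by_cases hc : s2.bit 14 [] = true
  · rw [if_pos hc, if_pos hc]
    simp [run, er]
  · rw [if_neg hc, if_neg hc]
    simp only [run, g8, e8, g9, e9]
    rcases s.bit 8 [] <;> rcases s.bit 9 [] <;>
      simp [phase, ipow, sg, er, ei, cell, State.getReal, Cell.eval, Arith.eval, sub_eq_add_neg]

/-- Loads the identity into the Pauli register. -/
def initProg : Prog := block [
  .gate (fun _ _ => false) (cell 8) (cell 8) (cell 8),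
  .gate (fun _ _ => false) (cell 9) (cell 9) (cell 9),
  .loop 12 (.reg 0) (block [
    .gate (fun _ _ => false) ⟨10, [.reg 12]⟩ (cell 14) (cell 14),
    .gate (fun _ _ => false) ⟨11, [.reg 12]⟩ (cell 14) (cell 14)])]

theorem initProg_wIdx : initProg.wIdx = [12] := rfl
theorem initProg_wBit : initProg.wBit = [8, 9, 10, 11] := rfl
theorem initProg_wReal : initProg.wReal = [] := rfl

theorem regOp_initProg (ω : ℕ → Fin 4) {n : ℕ} {s : State} (hn : s.idx 0 = n) :
    regOp n (run ω initProg s) = 1 := by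
  rw [initProg, run_block_cons, run_block_cons, run_block_cons, run_block_nil]
  set s1 := run ω (.gate (fun _ _ => false) (cell 9) (cell 9) (cell 9))
    (run ω (.gate (fun _ _ => false) (cell 8) (cell 8) (cell 8)) s) with hs1
  have e8 : s1.bit 8 [] = false := by simp [hs1, run, cell, Cell.eval]
  have e9 : s1.bit 9 [] = false := by simp [hs1, run, cell, Cell.eval]
  set p : Prog := block [
    .gate (fun _ _ => false) ⟨10, [.reg 12]⟩ (cell 14) (cell 14),
    .gate (fun _ _ => false) ⟨11, [.reg 12]⟩ (cell 14) (cell 14)] with hp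
  have key := loop_induct ω (v := 12) (e := .reg 0) (p := p) (s := s1) n hn
    (fun k s' => ∀ j < k, s'.bit 10 [j] = false ∧ s'.bit 11 [j] = false)
    (fun j hj => absurd hj (by omega)) (fun _ _ _ h => h) (by
      intro k hk s' hF hk' i1 j hj
      by_cases hjk : j = k
      · subst hjk
        simp [hp, run, block, Cell.eval, hk']
      · have := i1 j (by omega)
        simp [hp, run, block, Cell.eval, hk', hjk, this])
  have hF := frame_run ω (.loop 12 (.reg 0) p) s1
  rw [regOp, regPhase, hF.bit 8 (by simp [Prog.wBit, hp, block]),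
    hF.bit 9 (by simp [Prog.wBit, hp, block]), e8, e9]
  have h10 : (fun j : Fin n => (run ω (.loop 12 (.reg 0) p) s1).bit 10 [(j : ℕ)]) = fun _ => false :=
    funext fun j => (key j j.2).1
  have h11 : (fun j : Fin n => (run ω (.loop 12 (.reg 0) p) s1).bit 11 [(j : ℕ)]) = fun _ => false :=
    funext fun j => (key j j.2).2
  rw [h10, h11, xzOp_false]
  simp [phase, ipow, sg]

/-- Conjugates the operator in the Pauli register by one Clifford gate and by the rotation that
precedes it in the circuit. -/
def layerBody : Prog := block [cliffProg, .decIdx 11, rotProg]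

/-- Adds the contribution of one term of the observable to the real cell `3`: starting from `Q k`,
the Pauli register is conjugated by the gates of the circuit, from the last one to the first one. -/
def termProg : Prog := block [
  initProg,
  mulProg 4 [.reg 9],
  .setIdx 11 (.reg 1),
  .loop 10 (.reg 1) layerBody,
  cliffProg,
  expProg]

/-- Writes the value of the model function at the grid angles of sample `j` (register `6`) and at
input number `p` (register `8`) into the real cell `3`. -/
def evalProg : Prog := block [
  .const (cell 3) 0,
  .loop 9 (.reg 2) termProg]

theorem layerBody_wIdx : layerBody.wIdx = [13, 12, 12, 12, 12, 12, 11, 12, 12] := rfl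
theorem layerBody_wBit : layerBody.wBit = cliffProg.wBit ++ rotProg.wBit := rfl
theorem layerBody_wReal : layerBody.wReal = [] := rfl
theorem termProg_wIdx : termProg.wIdx = [12, 12, 11, 10, 13, 12, 12, 12, 12, 12, 11, 12, 12,
  13, 12, 12, 12, 12, 12, 12] := rfl
theorem termProg_wBit : termProg.wBit = [8, 9, 10, 11] ++ ([9, 15, 16, 9, 8, 15, 9, 10, 11] ++
  (cliffProg.wBit ++ rotProg.wBit ++ (cliffProg.wBit ++ [14, 14]))) := rfl
theorem termProg_wReal : termProg.wReal = [3, 3] := rfl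
theorem evalProg_wIdx : evalProg.wIdx = 9 :: termProg.wIdx := rfl
theorem evalProg_wBit : evalProg.wBit = termProg.wBit := rfl
theorem evalProg_wReal : evalProg.wReal = [3, 3, 3] := rfl

/-- The state contains the network and the training data, as in `IsInput`, and the number `d + 1`
of input points. -/
structure Loaded {𝒳 : Type*} {n L m d : ℕ} (W : Network 𝒳 n L m) (X : Fin d → 𝒳)
    (Y : Fin d → ℝ) (N : ℕ) (x : 𝒳) (s : State) : Prop where
  size_n : s.idx 0 = n
  size_L : s.idx 1 = L
  size_m : s.idx 2 = m
  size_d : s.idx 3 = d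
  size_N : s.idx 4 = N
  size_D : s.idx 5 = d + 1
  tableau : ∀ (p : Fin (d + 1)) (l : Fin (L + 1)) (g : Fin 2) (k : Fin n),
    row (W.U (inputPoint X x p) l) g k = storedOp n s 0 [p, l, g, k]
  gen : ∀ l : Fin L, W.P l = storedOp n s 2 [l]
  obs : ∀ k : Fin m, W.Q k = storedOp n s 4 [k]
  coeff : ∀ k : Fin m, s.real 0 [k] = W.c k
  label : ∀ i : Fin d, s.real 1 [i] = Y i

section

variable {𝒳 : Type*} {n L m d N : ℕ} {W : Network 𝒳 n L m} {X : Fin d → 𝒳} {Y : Fin d → ℝ} {x : 𝒳}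

theorem storedOp_congr {s s' : State} {A : ℕ} (h : s'.bit A = s.bit A)
    (h' : s'.bit (A + 1) = s.bit (A + 1)) (l : List ℕ) : storedOp n s' A l = storedOp n s A l := by
  simp only [storedOp, h, h']

theorem Loaded.congr {s s' : State} (h : Loaded W X Y N x s)
    (hi : ∀ v, v < 6 → s'.idx v = s.idx v) (hb : ∀ a, a < 6 → s'.bit a = s.bit a)
    (hr : ∀ a, a < 2 → s'.real a = s.real a) : Loaded W X Y N x s' := by
  refine ⟨?_, ?_, ?_, ?_, ?_, ?_, fun p l g k => ?_, fun l => ?_, fun k => ?_, fun k => ?_,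
    fun i => ?_⟩
  · rw [hi 0 (by norm_num), h.size_n]
  · rw [hi 1 (by norm_num), h.size_L]
  · rw [hi 2 (by norm_num), h.size_m]
  · rw [hi 3 (by norm_num), h.size_d]
  · rw [hi 4 (by norm_num), h.size_N]
  · rw [hi 5 (by norm_num), h.size_D]
  · rw [h.tableau, storedOp_congr (hb 0 (by norm_num)) (hb 1 (by norm_num))]
  · rw [h.gen, storedOp_congr (hb 2 (by norm_num)) (hb 3 (by norm_num))]
  · rw [h.obs, storedOp_congr (hb 4 (by norm_num)) (hb 5 (by norm_num))]
  · rw [hr 0 (by norm_num), h.coeff]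
  · rw [hr 1 (by norm_num), h.label]

/-- The product of the layers of a circuit from layer number `j` on. -/
def tailProd {R : Type*} [Monoid R] {L : ℕ} (F : Fin L → R) (j : ℕ) : R :=
  ((List.ofFn F).drop j).reverse.prod

theorem tailProd_self {R : Type*} [Monoid R] {L : ℕ} (F : Fin L → R) : tailProd F L = 1 := by
  rw [tailProd, List.drop_of_length_le (by simp)]
  rfl

theorem tailProd_eq {R : Type*} [Monoid R] {L : ℕ} (F : Fin L → R) (j : Fin L) :
    tailProd F j = tailProd F (j + 1) * F j := by
  rw [tailProd, List.drop_eq_getElem_cons (by simp), List.reverse_cons, List.prod_append,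
    List.prod_singleton, List.getElem_ofFn]
  rfl

/-- The factor of layer `l` in the circuit. -/
def layer (W : Network 𝒳 n L m) (y : 𝒳) (κ : Fin L → Fin 4) (l : Fin L) : Op n :=
  W.U y l.succ * rotation (W.P l) (angles κ l)

/-- The Heisenberg picture: the operator in the register is conjugated by the circuit, layer by layer. -/
theorem regOp_layers (ω : ℕ → Fin 4) {s : State} (h : Loaded W X Y N x s) {p : Fin (d + 1)}
    (hp : s.idx 8 = p) {κ : Fin L → Fin 4}
    (hκ : ∀ l : Fin L, IsAngle s [s.idx 6, (l : ℕ)] (κ l)) (h11 : s.idx 11 = L) :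
    let s' := run ω (block [.loop 10 (.reg 1) layerBody, cliffProg]) s
    regOp n s' = (W.circuit (inputPoint X x p) (angles κ))ᴴ * regOp n s *
      W.circuit (inputPoint X x p) (angles κ) := by
  intro s'
  set y := inputPoint X x p with hy
  set F := layer W y κ with hF
  set Q := regOp n s with hQ
  have hcliff : ∀ (u : State) (l : Fin (L + 1)), Loaded W X Y N x u → u.idx 8 = p → u.idx 11 = l →
      regOp n (run ω cliffProg u) = (W.U y l)ᴴ * regOp n u * W.U y l := by
    intro u l hu h8 h11
    refine regOp_cliffProg ω hu.size_n (W.U_mem y l).1 fun g k => ?_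
    rw [hy, hu.tableau p l g k, h8, h11]
  have key := loop_induct ω (v := 10) (e := .reg 1) (p := layerBody) (s := s) L h.size_L
    (fun t s' => s'.idx 11 = L - t ∧
      regOp n s' = (tailProd F (L - t))ᴴ * Q * tailProd F (L - t))
    ⟨h11, by rw [Nat.sub_zero, tailProd_self, Matrix.conjTranspose_one, one_mul, mul_one]; rfl⟩
    (fun _ _ _ h => h) (by
      rintro t ht u hFr hk ⟨i1, i2⟩
      have hui : ∀ v, v < 10 → u.idx v = s.idx v := fun v hv => hFr.idx v (by
        simp only [Prog.wIdx, layerBody_wIdx, List.mem_cons, List.not_mem_nil, or_false]; omega)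
      have hub : ∀ a, a < 8 → u.bit a = s.bit a := fun a ha => hFr.bit a (by
        simp only [Prog.wBit, layerBody_wBit, cliffProg_wBit, rotProg_wBit, List.mem_append,
          List.mem_cons, List.not_mem_nil, or_false]; omega)
      have hur : ∀ a, u.real a = s.real a := fun a => hFr.real a (by
        simp [Prog.wReal, layerBody_wReal])
      have hu : Loaded W X Y N x u := h.congr (fun v hv => hui v (by omega))
        (fun a ha => hub a (by omega)) (fun a _ => hur a)
      rw [layerBody, run_block_cons, run_block_cons, run_block_cons, run_block_nil]
      have hl : L - t - 1 < L := by omega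
      set l : Fin L := ⟨L - t - 1, hl⟩ with hldef
      have hc := hcliff u l.succ hu (by rw [hui 8 (by norm_num), hp])
        (by rw [i1, hldef, Fin.val_succ]; simp only; omega)
      have hF1 := frame_run ω cliffProg u
      set u1 := run ω cliffProg u with hu1
      have hi1 : ∀ v, v < 12 → u1.idx v = u.idx v := fun v hv => hF1.idx v (by
        simp only [cliffProg_wIdx, List.mem_cons, List.not_mem_nil, or_false]; omega)
      have hb1 : ∀ a, a < 8 → u1.bit a = u.bit a := fun a ha => hF1.bit a (by
        simp only [cliffProg_wBit, List.mem_cons, List.not_mem_nil, or_false]; omega)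
      set u2 := run ω (.decIdx 11) u1 with hu2
      have hb2 : u2.bit = u1.bit := rfl
      have hi2 : ∀ v, v ≠ 11 → u2.idx v = u1.idx v := fun v hv => by simp [hu2, run, hv]
      have h2 : u2.idx 11 = l := by
        simp only [hu2, run, tick_idx, setIdx_idx, Function.update_self]
        rw [hi1 11 (by norm_num), i1]
      have hn2 : u2.idx 0 = n := by rw [hi2 0 (by norm_num), hi1 0 (by norm_num), hu.size_n]
      have hr := regOp_rotProg ω hn2 (P := W.P l) (κ := κ l) (by
        rw [hu.gen l, h2]
        refine (storedOp_congr ?_ ?_ _).symm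
        · rw [hb2, hb1 _ (by norm_num)]
        · rw [hb2, hb1 _ (by norm_num)]) (W.P_herm l) (by
        rw [h2, hi2 6 (by norm_num), hi1 6 (by norm_num), hui 6 (by norm_num)]
        have := hκ l
        rw [IsAngle] at this ⊢
        rw [hb2, hb1 6 (by norm_num), hb1 7 (by norm_num), hub 6 (by norm_num),
          hub 7 (by norm_num)]
        exact this)
      constructor
      · rw [(frame_run ω rotProg u2).idx 11 (by simp [rotProg_wIdx]), h2, hldef]
        simp only; omega
      · have hreg : regOp n u2 = regOp n u1 := rfl
        have ht1 : tailProd F (L - (t + 1)) = tailProd F (L - t) * F l := by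
          have := tailProd_eq F l
          rw [hldef] at this ⊢
          simp only at this
          rw [show L - (t + 1) = L - t - 1 by omega, this, show L - t - 1 + 1 = L - t by omega]
        rw [hr, hreg, hc, i2, ht1, hF, layer, ← hF, angles]
        simp only [Matrix.conjTranspose_mul, mul_assoc])
  obtain ⟨k1, k2⟩ := key
  have hF3 := frame_run ω (.loop 10 (.reg 1) layerBody) s
  have hs' : s' = run ω cliffProg (run ω (.loop 10 (.reg 1) layerBody) s) := rfl
  rw [hs']
  set s1 := run ω (.loop 10 (.reg 1) layerBody) s with hs1
  have hi : ∀ v, v < 10 → s1.idx v = s.idx v := fun v hv => hF3.idx v (by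
    simp only [Prog.wIdx, layerBody_wIdx, List.mem_cons, List.not_mem_nil, or_false]; omega)
  have hl : Loaded W X Y N x s1 := h.congr (fun v hv => hi v (by omega))
    (fun a ha => hF3.bit a (by
      simp only [Prog.wBit, layerBody_wBit, cliffProg_wBit, rotProg_wBit, List.mem_append,
        List.mem_cons, List.not_mem_nil, or_false]; omega))
    (fun a _ => hF3.real a (by simp [Prog.wReal, layerBody_wReal]))
  rw [hcliff s1 0 hl (by rw [hi 8 (by norm_num), hp]) (by rw [k1]; simp), k2]
  have hcirc : W.circuit y (angles κ) = tailProd F (L - L) * W.U y 0 := by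
    rw [Nat.sub_self, tailProd, List.drop_zero]
    rfl
  rw [hcirc]
  simp only [Matrix.conjTranspose_mul, mul_assoc]

theorem real_termProg (ω : ℕ → Fin 4) {s : State} (h : Loaded W X Y N x s) {p : Fin (d + 1)}
    (hp : s.idx 8 = p) {κ : Fin L → Fin 4}
    (hκ : ∀ l : Fin L, IsAngle s [s.idx 6, (l : ℕ)] (κ l)) {k : Fin m} (hk : s.idx 9 = k) :
    (run ω termProg s).real 3 [] = s.real 3 [] + W.c k *
      (((W.circuit (inputPoint X x p) (angles κ))ᴴ * W.Q k *
        W.circuit (inputPoint X x p) (angles κ)) 0 0).re := by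
  have hstr : run ω termProg s = run ω expProg (run ω (block [.loop 10 (.reg 1) layerBody, cliffProg])
    (run ω (.setIdx 11 (.reg 1)) (run ω (mulProg 4 [.reg 9]) (run ω initProg s)))) := rfl
  rw [hstr]
  have o1 := regOp_initProg ω h.size_n
  have F1 := frame_run ω initProg s
  set s1 := run ω initProg s with hs1
  have hi1 : ∀ v, v < 12 → s1.idx v = s.idx v := fun v hv => F1.idx v (by
    simp only [initProg_wIdx, List.mem_cons, List.not_mem_nil, or_false]; omega)
  have hb1 : ∀ a, a < 8 → s1.bit a = s.bit a := fun a ha => F1.bit a (by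
    simp only [initProg_wBit, List.mem_cons, List.not_mem_nil, or_false]; omega)
  have hr1 : ∀ a, s1.real a = s.real a := fun a => F1.real a (by simp [initProg_wReal])
  have o2 := regOp_mulProg ω (A := 4) (pre := [.reg 9]) (by norm_num) (by simp)
    ((hi1 0 (by norm_num)).trans h.size_n)
  have F2 := frame_run ω (mulProg 4 [.reg 9]) s1
  set s2 := run ω (mulProg 4 [.reg 9]) s1 with hs2
  have hi2 : ∀ v, v < 12 → s2.idx v = s.idx v := fun v hv => (F2.idx v (by
    simp only [mulProg_wIdx, List.mem_cons, List.not_mem_nil, or_false]; omega)).trans (hi1 v hv)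
  have hb2 : ∀ a, a < 8 → s2.bit a = s.bit a := fun a ha => (F2.bit a (by
    simp only [mulProg_wBit, List.mem_cons, List.not_mem_nil, or_false]; omega)).trans (hb1 a ha)
  have hr2 : ∀ a, s2.real a = s.real a := fun a =>
    (F2.real a (by simp [mulProg_wReal])).trans (hr1 a)
  have e2 : regOp n s2 = W.Q k := by
    rw [o2, o1, one_mul, List.map_cons, List.map_nil, Ix.eval_reg, hi1 9 (by norm_num), hk,
      storedOp_congr (hb1 4 (by norm_num)) (hb1 (4 + 1) (by norm_num)), ← h.obs k]
  set s3 := run ω (.setIdx 11 (.reg 1)) s2 with hs3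
  have hi3 : ∀ v, v < 11 → s3.idx v = s.idx v := fun v hv => by
    rw [← hi2 v (by omega)]
    have : v ≠ 11 := by omega
    simp [hs3, run, this]
  have h311 : s3.idx 11 = L := by
    simp only [hs3, run, tick_idx, setIdx_idx, Function.update_self, Ix.eval_reg]
    rw [hi2 1 (by norm_num), h.size_L]
  have hl3 : Loaded W X Y N x s3 := h.congr (fun v hv => hi3 v (by omega))
    (fun a ha => hb2 a (by omega)) (fun a _ => hr2 a)
  have o3 := regOp_layers ω hl3 ((hi3 8 (by norm_num)).trans hp) (κ := κ) (fun l => by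
    rw [hi3 6 (by norm_num)]
    have := hκ l
    rw [IsAngle] at this ⊢
    rw [show s3.bit = s2.bit from rfl, hb2 6 (by norm_num), hb2 7 (by norm_num)]
    exact this) h311
  simp only at o3
  have F4 := frame_run ω (block [.loop 10 (.reg 1) layerBody, cliffProg]) s3
  set s4 := run ω (block [.loop 10 (.reg 1) layerBody, cliffProg]) s3 with hs4
  have hi4 : ∀ v, v < 10 → s4.idx v = s.idx v := fun v hv => (F4.idx v (by
    simp only [block, Prog.wIdx, layerBody_wIdx, cliffProg_wIdx, List.mem_append, List.mem_cons,
      List.not_mem_nil, or_false]; omega)).trans (hi3 v (by omega))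
  have hr4 : ∀ a, s4.real a = s.real a := fun a =>
    (F4.real a (by simp [block, Prog.wReal, layerBody_wReal, cliffProg_wReal])).trans (hr2 a)
  rw [real_expProg ω ((hi4 0 (by norm_num)).trans h.size_n), o3,
    show regOp n s3 = regOp n s2 from rfl, e2, hr4, hr4, hi4 9 (by norm_num), hk, h.coeff]

theorem real_evalProg (ω : ℕ → Fin 4) {s : State} (h : Loaded W X Y N x s) {p : Fin (d + 1)}
    (hp : s.idx 8 = p) {κ : Fin L → Fin 4}
    (hκ : ∀ l : Fin L, IsAngle s [s.idx 6, (l : ℕ)] (κ l)) :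
    (run ω evalProg s).real 3 [] = W.model (angles κ) (inputPoint X x p) := by
  rw [evalProg, run_block_cons, run_block_cons, run_block_nil, W.model_eq_sum]
  set s1 := run ω (.const (cell 3) 0) s with hs1
  have e3 : s1.real 3 [] = 0 := by simp [hs1, run, cell, Cell.eval]
  have hl1 : Loaded W X Y N x s1 := h.congr (fun _ _ => rfl) (fun _ _ => rfl) (fun a ha => by
    have : a ≠ 3 := by omega
    simp [hs1, run, cell, this])
  set y := inputPoint X x p with hy
  set g : ℕ → ℝ := fun k => if hk : k < m then W.c ⟨k, hk⟩ *
    (((W.circuit y (angles κ))ᴴ * W.Q ⟨k, hk⟩ * W.circuit y (angles κ)) 0 0).re else 0 with hg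
  have key := loop_induct ω (v := 9) (e := .reg 2) (p := termProg) (s := s1) m hl1.size_m
    (fun k s' => s'.real 3 [] = ∑ j ∈ Finset.range k, g j) (by simp [e3]) (fun _ _ _ h => h) (by
      intro k hk u hF hk' i1
      have hi : ∀ v, v < 9 → u.idx v = s1.idx v := fun v hv => hF.idx v (by
        simp only [Prog.wIdx, termProg_wIdx, List.mem_cons, List.not_mem_nil, or_false]; omega)
      have hb : ∀ a, a < 8 → u.bit a = s1.bit a := fun a ha => hF.bit a (by
        simp only [Prog.wBit, termProg_wBit, cliffProg_wBit, rotProg_wBit, List.mem_append,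
          List.mem_cons, List.not_mem_nil, or_false]; omega)
      have hr : ∀ a, a < 2 → u.real a = s1.real a := fun a ha => hF.real a (by
        simp only [Prog.wReal, termProg_wReal, List.mem_cons, List.not_mem_nil, or_false]; omega)
      have hu : Loaded W X Y N x u := hl1.congr (fun v hv => hi v (by omega))
        (fun a ha => hb a (by omega)) hr
      rw [real_termProg ω hu (p := p) ((hi 8 (by norm_num)).trans hp) (κ := κ) (fun l => by
        rw [hi 6 (by norm_num)]
        have := hκ l
        rw [IsAngle] at this ⊢
        rw [hb 6 (by norm_num), hb 7 (by norm_num)]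
        exact this) (k := ⟨k, hk⟩) hk', i1, Finset.sum_range_succ, hg]
      simp only [hk, dif_pos]
      rfl)
  rw [key, ← Fin.sum_univ_eq_sum_range]
  exact Finset.sum_congr rfl fun k _ => by simp [hg]

end

end RealRAM

/-! ### Parameter shifts on the grid -/

theorem exists_succ_quarter_turn (k : Fin 4) : ∃ z : ℤ,
    ((k : ℕ) : ℝ) * (Real.pi / 2) + Real.pi / 2 =
      (((k + 1 : Fin 4) : ℕ) : ℝ) * (Real.pi / 2) + z * (2 * Real.pi) := by
  have h : ∀ k : Fin 4, ∃ z : ℤ, ((k : ℕ) : ℤ) + 1 = ((k + 1 : Fin 4) : ℕ) + 4 * z := by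
    intro k
    refine ⟨if k = 3 then 1 else 0, ?_⟩
    revert k
    decide
  obtain ⟨z, hz⟩ := h k
  refine ⟨z, ?_⟩
  generalize (k + 1 : Fin 4) = l at hz ⊢
  have hz' : ((k : ℕ) : ℝ) + 1 = (l : ℕ) + 4 * z := by exact_mod_cast hz
  rw [← add_one_mul, hz']
  ring

theorem exists_pred_quarter_turn (k : Fin 4) : ∃ z : ℤ,
    ((k : ℕ) : ℝ) * (Real.pi / 2) - Real.pi / 2 =
      (((k + 1 + 2 : Fin 4) : ℕ) : ℝ) * (Real.pi / 2) + z * (2 * Real.pi) := by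
  have h : ∀ k : Fin 4, ∃ z : ℤ, ((k : ℕ) : ℤ) - 1 = ((k + 1 + 2 : Fin 4) : ℕ) + 4 * z := by
    intro k
    refine ⟨if k = 0 then -1 else 0, ?_⟩
    revert k
    decide
  obtain ⟨z, hz⟩ := h k
  refine ⟨z, ?_⟩
  generalize (k + 1 + 2 : Fin 4) = l at hz ⊢
  have hz' : ((k : ℕ) : ℝ) - 1 = (l : ℕ) + 4 * z := by exact_mod_cast hz
  rw [← sub_one_mul, hz']
  ring

/-- On the grid, the shifts by `±π/2` stay on the grid, up to multiples of `2π`. -/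
theorem Network.shiftDiff_angles {𝒳 : Type*} {n L m : ℕ} (W : Network 𝒳 n L m) (κ : Fin L → Fin 4)
    (i : Fin L) (y : 𝒳) :
    W.shiftDiff (angles κ) i y = W.model (angles (Function.update κ i (κ i + 1))) y -
      W.model (angles (Function.update (Function.update κ i (κ i + 1)) i (κ i + 1 + 2))) y := by
  have hx := W.isTrigPoly_model y
  rw [Network.shiftDiff, Function.update_idem]
  refine congrArg₂ _ ?_ ?_
  · refine hx.eq_of_int_shift (θ := angles (Function.update κ i (κ i + 1))) fun l => ?_
    by_cases hl : l = i
    · subst hl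
      obtain ⟨z, hz⟩ := exists_succ_quarter_turn (κ l)
      refine ⟨z, ?_⟩
      simp only [angles, Pi.add_apply, Pi.single_eq_same, Function.update_self]
      exact hz
    · refine ⟨0, ?_⟩
      simp only [angles, Pi.add_apply, Pi.single_eq_of_ne hl, Function.update_of_ne hl]
      simp
  · refine hx.eq_of_int_shift (θ := angles (Function.update κ i (κ i + 1 + 2))) fun l => ?_
    by_cases hl : l = i
    · subst hl
      obtain ⟨z, hz⟩ := exists_pred_quarter_turn (κ l)
      refine ⟨z, ?_⟩
      simp only [angles, Pi.sub_apply, Pi.single_eq_same, Function.update_self]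
      exact hz
    · refine ⟨0, ?_⟩
      simp only [angles, Pi.sub_apply, Pi.single_eq_of_ne hl, Function.update_of_ne hl]
      simp

namespace RealRAM

/-! ### Accumulation of the kernel -/

/-- Adds a quarter turn to the angle of parameter `i` (register `7`) of sample `j`
(register `6`). -/
def bumpProg : Prog := block [
  .gate xor ⟨7, [.reg 6, .reg 7]⟩ ⟨7, [.reg 6, .reg 7]⟩ ⟨6, [.reg 6, .reg 7]⟩,
  .gate (fun a _ => !a) ⟨6, [.reg 6, .reg 7]⟩ ⟨6, [.reg 6, .reg 7]⟩ ⟨6, [.reg 6, .reg 7]⟩]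

/-- Adds a half turn to the angle of parameter `i` (register `7`) of sample `j`
(register `6`). -/
def flipProg : Prog :=
  .gate (fun a _ => !a) ⟨7, [.reg 6, .reg 7]⟩ ⟨7, [.reg 6, .reg 7]⟩ ⟨7, [.reg 6, .reg 7]⟩

/-- Stores the value of the model function at input `p` (register `8`) in the real array `4`. -/
def fillBody : Prog := block [
  evalProg, .const ⟨4, [.reg 8]⟩ 0, .arith .add ⟨4, [.reg 8]⟩ ⟨4, [.reg 8]⟩ (cell 3)]

/-- Subtracts the value of the model function at input `p` (register `8`) in the real array
`4`. -/
def subBody : Prog := block [evalProg, .arith .sub ⟨4, [.reg 8]⟩ ⟨4, [.reg 8]⟩ (cell 3)]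

/-- Writes the finite differences with respect to parameter `i` of sample `j` into the real array
`4`, for all inputs. The angle is shifted by a quarter turn, a half turn and a quarter turn, which
restores it. -/
def gradProg : Prog := block [
  bumpProg, .loop 8 (.reg 5) fillBody, flipProg, .loop 8 (.reg 5) subBody, bumpProg]

/-- Adds the product of two finite differences to an entry of the real array `6`. -/
def accBody : Prog := block [
  .arith .mul (cell 5) ⟨4, [.reg 14]⟩ ⟨4, [.reg 15]⟩,
  .arith .add ⟨6, [.reg 14, .reg 15]⟩ ⟨6, [.reg 14, .reg 15]⟩ (cell 5)]

/-- Adds the outer product of the vector of finite differences to the real array `6`. -/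
def accProg : Prog := .loop 14 (.reg 5) (.loop 15 (.reg 5) accBody)

/-- Accumulates, in the real array `6`, the estimate of the kernel times `4 N`. -/
def kernelProg : Prog := block [
  .loop 14 (.reg 5) (.loop 15 (.reg 5) (.const ⟨6, [.reg 14, .reg 15]⟩ 0)),
  .loop 6 (.reg 4) (.loop 7 (.reg 1) (block [gradProg, accProg]))]

/-- Draws all samples and stores their bits in the bit arrays `6` and `7`. -/
def drawProg : Prog :=
  .loop 6 (.reg 4) (.loop 7 (.reg 1) (.draw ⟨6, [.reg 6, .reg 7]⟩ ⟨7, [.reg 6, .reg 7]⟩))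

theorem fillBody_wIdx : fillBody.wIdx = evalProg.wIdx ++ [] := rfl
theorem fillBody_wBit : fillBody.wBit = evalProg.wBit ++ [] := rfl
theorem fillBody_wReal : fillBody.wReal = evalProg.wReal ++ [4, 4] := rfl
theorem subBody_wIdx : subBody.wIdx = evalProg.wIdx ++ [] := rfl
theorem subBody_wBit : subBody.wBit = evalProg.wBit ++ [] := rfl
theorem subBody_wReal : subBody.wReal = evalProg.wReal ++ [4] := rfl

theorem isAngle_congr {s s' : State} (h6 : s'.bit 6 = s.bit 6) (h7 : s'.bit 7 = s.bit 7)
    {l : List ℕ} {κ : Fin 4} (h : IsAngle s l κ) : IsAngle s' l κ := by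
  rw [IsAngle] at h ⊢
  rw [h6, h7]
  exact h

theorem run_bumpProg (ω : ℕ → Fin 4) (s : State) :
    (run ω bumpProg s).bit 6 = Function.update (s.bit 6) [s.idx 6, s.idx 7]
      (!s.bit 6 [s.idx 6, s.idx 7]) ∧
    (run ω bumpProg s).bit 7 = Function.update (s.bit 7) [s.idx 6, s.idx 7]
      (xor (s.bit 7 [s.idx 6, s.idx 7]) (s.bit 6 [s.idx 6, s.idx 7])) := by
  constructor <;> simp [bumpProg, run, block, State.getBit, Cell.eval]

theorem run_flipProg (ω : ℕ → Fin 4) (s : State) :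
    (run ω flipProg s).bit 6 = s.bit 6 ∧
    (run ω flipProg s).bit 7 = Function.update (s.bit 7) [s.idx 6, s.idx 7]
      (!s.bit 7 [s.idx 6, s.idx 7]) := by
  constructor <;> simp [flipProg, run, State.getBit, Cell.eval]

section

variable {𝒳 : Type*} {n L m d N : ℕ} {W : Network 𝒳 n L m} {X : Fin d → 𝒳} {Y : Fin d → ℝ} {x : 𝒳}

theorem isAngle_update {s s' : State} {j : ℕ} {i : Fin L} {κ : Fin L → Fin 4} {k : Fin 4} {u w : Bool}
    (h : ∀ l : Fin L, IsAngle s [j, (l : ℕ)] (κ l))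
    (h6 : s'.bit 6 = Function.update (s.bit 6) [j, (i : ℕ)] u)
    (h7 : s'.bit 7 = Function.update (s.bit 7) [j, (i : ℕ)] w)
    (hu : u = Nat.testBit k 0) (hw : w = Nat.testBit k 1) (l : Fin L) :
    IsAngle s' [j, (l : ℕ)] (Function.update κ i k l) := by
  rw [IsAngle, h6, h7]
  by_cases hl : l = i
  · subst hl
    simp [hu, hw]
  · have hl' : (l : ℕ) ≠ i := fun e => hl (Fin.ext e)
    have := h l
    rw [IsAngle] at this
    simpa [hl, hl'] using this

theorem loop_fill (ω : ℕ → Fin 4) {s : State} (h : Loaded W X Y N x s) {κ : Fin L → Fin 4}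
    (hκ : ∀ l : Fin L, IsAngle s [s.idx 6, (l : ℕ)] (κ l)) (p : Fin (d + 1)) :
    (run ω (.loop 8 (.reg 5) fillBody) s).real 4 [(p : ℕ)] =
      W.model (angles κ) (inputPoint X x p) := by
  refine loop_induct ω (v := 8) (e := .reg 5) (p := fillBody) (s := s) (d + 1) h.size_D
    (fun k s' => ∀ p : Fin (d + 1), (p : ℕ) < k →
      s'.real 4 [(p : ℕ)] = W.model (angles κ) (inputPoint X x p))
    (fun p hp => absurd hp (by omega)) (fun _ _ _ h => h) ?_ p p.2
  intro k hk u hF hk' i1 p hp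
  have hi : ∀ v, v < 8 → u.idx v = s.idx v := fun v hv => hF.idx v (by
    simp only [Prog.wIdx, fillBody_wIdx, evalProg_wIdx, termProg_wIdx, List.mem_append,
      List.mem_cons, List.not_mem_nil, or_false]; omega)
  have hb : ∀ a, a < 8 → u.bit a = s.bit a := fun a ha => hF.bit a (by
    simp only [Prog.wBit, fillBody_wBit, evalProg_wBit, termProg_wBit, cliffProg_wBit,
      rotProg_wBit, List.mem_append, List.mem_cons, List.not_mem_nil, or_false]; omega)
  have hr : ∀ a, a < 2 → u.real a = s.real a := fun a ha => hF.real a (by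
    simp only [Prog.wReal, fillBody_wReal, evalProg_wReal, List.mem_append, List.mem_cons,
      List.not_mem_nil, or_false]; omega)
  have hu : Loaded W X Y N x u := h.congr (fun v hv => hi v (by omega))
    (fun a ha => hb a (by omega)) hr
  have he := real_evalProg ω hu (p := ⟨k, hk⟩) hk' (κ := κ) (fun l => by
    rw [hi 6 (by norm_num)]
    exact isAngle_congr (hb 6 (by norm_num)) (hb 7 (by norm_num)) (hκ l))
  have hF1 := frame_run ω evalProg u
  rw [fillBody, run_block_cons]
  set u1 := run ω evalProg u with hu1
  have h8 : u1.idx 8 = k := by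
    rw [hF1.idx 8 (by simp [evalProg_wIdx, termProg_wIdx]), hk']
  have h4 : u1.real 4 = u.real 4 := hF1.real 4 (by simp [evalProg_wReal])
  by_cases hpk : (p : ℕ) = k
  · have : p = ⟨k, hk⟩ := Fin.ext hpk
    subst this
    simp [run, block, cell, State.getReal, Cell.eval, Arith.eval, h8, he]
  · have := i1 p (by omega)
    simp [run, block, cell, Cell.eval, h8, hpk, h4, this]

theorem loop_sub (ω : ℕ → Fin 4) {s : State} (h : Loaded W X Y N x s) {κ : Fin L → Fin 4}
    (hκ : ∀ l : Fin L, IsAngle s [s.idx 6, (l : ℕ)] (κ l)) (p : Fin (d + 1)) :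
    (run ω (.loop 8 (.reg 5) subBody) s).real 4 [(p : ℕ)] =
      s.real 4 [(p : ℕ)] - W.model (angles κ) (inputPoint X x p) := by
  have key := loop_induct ω (v := 8) (e := .reg 5) (p := subBody) (s := s) (d + 1) h.size_D
    (fun k s' => ∀ p : Fin (d + 1), s'.real 4 [(p : ℕ)] = if (p : ℕ) < k then
      s.real 4 [(p : ℕ)] - W.model (angles κ) (inputPoint X x p) else s.real 4 [(p : ℕ)])
    (fun p => by simp) (fun _ _ _ h => h) (by
      intro k hk u hF hk' i1 p
      have hi : ∀ v, v < 8 → u.idx v = s.idx v := fun v hv => hF.idx v (by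
        simp only [Prog.wIdx, subBody_wIdx, evalProg_wIdx, termProg_wIdx, List.mem_append,
          List.mem_cons, List.not_mem_nil, or_false]; omega)
      have hb : ∀ a, a < 8 → u.bit a = s.bit a := fun a ha => hF.bit a (by
        simp only [Prog.wBit, subBody_wBit, evalProg_wBit, termProg_wBit, cliffProg_wBit,
          rotProg_wBit, List.mem_append, List.mem_cons, List.not_mem_nil, or_false]; omega)
      have hr : ∀ a, a < 2 → u.real a = s.real a := fun a ha => hF.real a (by
        simp only [Prog.wReal, subBody_wReal, evalProg_wReal, List.mem_append, List.mem_cons,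
          List.not_mem_nil, or_false]; omega)
      have hu : Loaded W X Y N x u := h.congr (fun v hv => hi v (by omega))
        (fun a ha => hb a (by omega)) hr
      have he := real_evalProg ω hu (p := ⟨k, hk⟩) hk' (κ := κ) (fun l => by
        rw [hi 6 (by norm_num)]
        exact isAngle_congr (hb 6 (by norm_num)) (hb 7 (by norm_num)) (hκ l))
      have hF1 := frame_run ω evalProg u
      rw [subBody, run_block_cons]
      set u1 := run ω evalProg u with hu1
      have h8 : u1.idx 8 = k := by
        rw [hF1.idx 8 (by simp [evalProg_wIdx, termProg_wIdx]), hk']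
      have h4 : u1.real 4 = u.real 4 := hF1.real 4 (by simp [evalProg_wReal])
      have h3 := i1 p
      by_cases hpk : (p : ℕ) = k
      · have : p = ⟨k, hk⟩ := Fin.ext hpk
        subst this
        simp only [lt_irrefl, if_false] at h3
        simp [run, block, cell, State.getReal, Cell.eval, Arith.eval, h8, he, h4, h3]
      · have : (p : ℕ) < k + 1 ↔ (p : ℕ) < k := by omega
        simp [run, block, cell, Cell.eval, h8, hpk, h4, this, h3])
  rw [key p, if_pos p.2]

theorem Loaded.of_frame {s s' : State} {q : Prog} (h : Loaded W X Y N x s) (hF : Frame q s s')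
    (hi : ∀ v ∈ q.wIdx, 6 ≤ v) (hb : ∀ v ∈ q.wBit, 6 ≤ v) (hr : ∀ v ∈ q.wReal, 2 ≤ v) :
    Loaded W X Y N x s' :=
  h.congr (fun v hv => hF.idx v fun hm => by have := hi v hm; omega)
    (fun v hv => hF.bit v fun hm => by have := hb v hm; omega)
    (fun v hv => hF.real v fun hm => by have := hr v hm; omega)

/-- The array `4` receives the finite differences, and the stored angles are restored. -/
theorem run_gradProg (ω : ℕ → Fin 4) {s : State} (h : Loaded W X Y N x s) {i : Fin L}
    (hi : s.idx 7 = i) {κ : Fin L → Fin 4} (hκ : ∀ l : Fin L, IsAngle s [s.idx 6, (l : ℕ)] (κ l)) :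
    (∀ p : Fin (d + 1), (run ω gradProg s).real 4 [(p : ℕ)] =
      W.shiftDiff (angles κ) i (inputPoint X x p)) ∧
    (run ω gradProg s).bit 6 = s.bit 6 ∧ (run ω gradProg s).bit 7 = s.bit 7 := by
  set j := s.idx 6 with hj
  rw [gradProg, run_block_cons, run_block_cons, run_block_cons, run_block_cons, run_block_cons,
    run_block_nil]
  obtain ⟨b6, b7⟩ := run_bumpProg ω s
  rw [hi, ← hj] at b6 b7
  have F1 := frame_run ω bumpProg s
  set s1 := run ω bumpProg s with hs1
  have L1 : Loaded W X Y N x s1 := h.of_frame F1 (by decide) (by decide) (by decide)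
  have j1 : s1.idx 6 = j := rfl
  have i1 : s1.idx 7 = i := hi
  have a1 : ∀ l : Fin L, IsAngle s1 [s1.idx 6, (l : ℕ)] (Function.update κ i (κ i + 1) l) := by
    intro l
    have := hκ i
    rw [IsAngle] at this
    refine isAngle_update hκ b6 b7 ?_ ?_ l <;> rw [this.1]
    · generalize κ i = k; fin_cases k <;> rfl
    · rw [this.2]; generalize κ i = k; fin_cases k <;> rfl
  have e1 := fun p => loop_fill ω L1 a1 p
  have F2 := frame_run ω (.loop 8 (.reg 5) fillBody) s1
  set s2 := run ω (.loop 8 (.reg 5) fillBody) s1 with hs2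
  have hI : ∀ v, v < 8 → v ∉ (Prog.loop 8 (.reg 5) fillBody).wIdx := fun v hv => by
    simp only [Prog.wIdx, fillBody_wIdx, evalProg_wIdx, termProg_wIdx, List.mem_append,
      List.mem_cons, List.not_mem_nil, or_false]; omega
  have hB : ∀ v, v < 8 → v ∉ (Prog.loop 8 (.reg 5) fillBody).wBit := fun v hv => by
    simp only [Prog.wBit, fillBody_wBit, evalProg_wBit, termProg_wBit, cliffProg_wBit,
      rotProg_wBit, List.mem_append, List.mem_cons, List.not_mem_nil, or_false]; omega
  have L2 : Loaded W X Y N x s2 := L1.of_frame F2 (by decide) (by decide) (by decide)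
  have j2 : s2.idx 6 = j := F2.idx 6 (hI 6 (by norm_num))
  have i2 : s2.idx 7 = i := (F2.idx 7 (hI 7 (by norm_num))).trans i1
  obtain ⟨c6, c7⟩ := run_flipProg ω s2
  have F3 := frame_run ω flipProg s2
  set s3 := run ω flipProg s2 with hs3
  have L3 : Loaded W X Y N x s3 := L2.of_frame F3 (by decide) (by decide) (by decide)
  have j3 : s3.idx 6 = j := j2
  have i3 : s3.idx 7 = i := i2
  rw [i2, j2] at c7
  rw [F2.bit 7 (hB 7 (by norm_num))] at c7
  rw [F2.bit 6 (hB 6 (by norm_num))] at c6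
  have a3 : ∀ l : Fin L, IsAngle s3 [s3.idx 6, (l : ℕ)]
      (Function.update (Function.update κ i (κ i + 1)) i (κ i + 1 + 2) l) := by
    intro l
    have := a1 i
    rw [IsAngle, Function.update_self, j1] at this
    rw [j3]
    rw [j1] at a1
    refine isAngle_update a1 (u := s1.bit 6 [j, (i : ℕ)]) (by rw [c6, Function.update_eq_self]) c7
      ?_ ?_ l
    · rw [this.1]; generalize κ i = k; fin_cases k <;> rfl
    · rw [this.2]; generalize κ i = k; fin_cases k <;> rfl
  have e3 := fun p => loop_sub ω L3 a3 p
  have F4 := frame_run ω (.loop 8 (.reg 5) subBody) s3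
  set s4 := run ω (.loop 8 (.reg 5) subBody) s3 with hs4
  obtain ⟨d6, d7⟩ := run_bumpProg ω s4
  have j4 : s4.idx 6 = j := (F4.idx 6 (hI 6 (by norm_num))).trans j3
  have i4 : s4.idx 7 = i := (F4.idx 7 (hI 7 (by norm_num))).trans i3
  have F5 := frame_run ω bumpProg s4
  set s5 := run ω bumpProg s4 with hs5
  rw [j4, i4, F4.bit 6 (hB 6 (by norm_num))] at d6
  rw [j4, i4, F4.bit 6 (hB 6 (by norm_num)), F4.bit 7 (hB 7 (by norm_num))] at d7
  refine ⟨fun p => ?_, ?_, ?_⟩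
  · rw [F5.real 4 (by decide), e3, F3.real 4 (by decide), e1, W.shiftDiff_angles]
  · rw [d6, c6, b6]
    simp
  · rw [d7, c7, c6, b6, b7]
    simp only [Function.update_self, Function.update_idem]
    cases s.bit 6 [j, (i : ℕ)] <;> cases h7 : s.bit 7 [j, (i : ℕ)] <;>
      simp only [Bool.xor_false, Bool.xor_true, Bool.not_true, Bool.not_false] <;>
      rw [← h7, Function.update_eq_self]

theorem run_accProg (ω : ℕ → Fin 4) {s : State} {D : ℕ} (hD : s.idx 5 = D) (p q : ℕ) (hp : p < D)
    (hq : q < D) : (run ω accProg s).real 6 [p, q] =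
      s.real 6 [p, q] + s.real 4 [p] * s.real 4 [q] := by
  have key := loop_induct ω (v := 14) (e := .reg 5) (p := .loop 15 (.reg 5) accBody) (s := s) D hD
    (fun k s' => ∀ p q, q < D → s'.real 6 [p, q] =
      if p < k then s.real 6 [p, q] + s.real 4 [p] * s.real 4 [q] else s.real 6 [p, q])
    (fun p q _ => by simp) (fun _ _ _ h => h) (by
      intro k hk u hF hk' i1
      have h5 : u.idx 5 = D := (hF.idx 5 (by decide)).trans hD
      have h4 : u.real 4 = s.real 4 := hF.real 4 (by decide)
      have key2 := loop_induct ω (v := 15) (e := .reg 5) (p := accBody) (s := u) D h5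
        (fun t s' => ∀ p q, s'.real 6 [p, q] =
          if p = k ∧ q < t then u.real 6 [p, q] + s.real 4 [p] * s.real 4 [q] else u.real 6 [p, q])
        (fun p q => by simp) (fun _ _ _ h => h) (by
          intro t ht z hG ht' i2 p q
          have g14 : z.idx 14 = k := (hG.idx 14 (by decide)).trans hk'
          have g4 : z.real 4 = s.real 4 := (hG.real 4 (by decide)).trans h4
          have hz := i2 p q
          by_cases hpq : p = k ∧ q = t
          · obtain ⟨rfl, rfl⟩ := hpq
            simp only [lt_irrefl, and_false, if_false] at hz
            simp [accBody, run, block, cell, State.getReal, Cell.eval, Arith.eval, g14, ht', g4, hz]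
          · have : (p = k ∧ q ≤ t) ↔ (p = k ∧ q < t) := by omega
            simp [accBody, run, block, cell, Cell.eval, g14, ht', hpq, this, hz])
      intro p q hq
      rw [key2 p q]
      have := i1 p q hq
      by_cases hpk : p = k
      · subst hpk
        simp only [lt_irrefl, if_false] at this
        simp [hq, this]
      · have h' : p < k + 1 ↔ p < k := by omega
        simp [hpk, h', this])
  rw [accProg, key p q hq, if_pos hp]

/-- The matrix accumulated by `kernelProg`. -/
def gramSum (W : Network 𝒳 n L m) (S : Samples N L) (y y' : 𝒳) : ℝ :=
  ∑ j, ∑ i, W.shiftDiff (angles (S j)) i y * W.shiftDiff (angles (S j)) i y'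

set_option maxRecDepth 20000 in
theorem run_kernelProg (ω : ℕ → Fin 4) {s : State} (h : Loaded W X Y N x s) {S : Samples N L}
    (hS : ∀ (j : Fin N) (i : Fin L), IsAngle s [(j : ℕ), (i : ℕ)] (S j i)) (p q : Fin (d + 1)) :
    (run ω kernelProg s).real 6 [(p : ℕ), (q : ℕ)] =
      gramSum W S (inputPoint X x p) (inputPoint X x q) := by
  rw [kernelProg, run_block_cons, run_block_cons, run_block_nil]
  set zp : Prog := .loop 14 (.reg 5) (.loop 15 (.reg 5) (.const ⟨6, [.reg 14, .reg 15]⟩ 0)) with hzp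
  have hzero := loop_induct ω (v := 14) (e := .reg 5)
    (p := .loop 15 (.reg 5) (.const ⟨6, [.reg 14, .reg 15]⟩ 0)) (s := s) (d + 1) h.size_D
    (fun k s' => ∀ p q, p < k → q < d + 1 → s'.real 6 [p, q] = 0)
    (fun p q hp => absurd hp (by omega)) (fun _ _ _ h => h) (by
      intro k hk u hF hk' i1
      have h5 : u.idx 5 = d + 1 := (hF.idx 5 (by decide)).trans h.size_D
      have key2 := loop_induct ω (v := 15) (e := .reg 5) (p := .const ⟨6, [.reg 14, .reg 15]⟩ 0)
        (s := u) (d + 1) h5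
        (fun t s' => ∀ p q, (p < k ∧ q < d + 1 ∨ p = k ∧ q < t) → s'.real 6 [p, q] = 0)
        (fun p q hpq => i1 p q (by omega) (by omega)) (fun _ _ _ h => h) (by
          intro t ht z hG ht' i2 p q hpq
          have g14 : z.idx 14 = k := (hG.idx 14 (by decide)).trans hk'
          by_cases hpq' : p = k ∧ q = t
          · obtain ⟨rfl, rfl⟩ := hpq'
            simp [run, Cell.eval, g14, ht']
          · have := i2 p q (by omega)
            simp [run, Cell.eval, g14, ht', hpq', this])
      intro p q hp hq
      exact key2 p q (by omega))
  have F1 := frame_run ω zp s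
  set s1 := run ω zp s with hs1
  have L1 : Loaded W X Y N x s1 := h.of_frame F1 (by decide) (by decide) (by decide)
  have A1 : ∀ (j : Fin N) (i : Fin L), IsAngle s1 [(j : ℕ), (i : ℕ)] (S j i) := fun j i =>
    isAngle_congr (F1.bit 6 (by decide)) (F1.bit 7 (by decide)) (hS j i)
  -- one sample
  let T : Fin N → Fin (d + 1) → Fin (d + 1) → ℕ → ℝ := fun j p q i => if hi : i < L then
    W.shiftDiff (angles (S j)) ⟨i, hi⟩ (inputPoint X x p) *
      W.shiftDiff (angles (S j)) ⟨i, hi⟩ (inputPoint X x q) else 0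
  have inner : ∀ (j : Fin N) (u : State), Loaded W X Y N x u → u.idx 6 = j →
      (∀ (j : Fin N) (i : Fin L), IsAngle u [(j : ℕ), (i : ℕ)] (S j i)) →
      (∀ (j : Fin N) (i : Fin L), IsAngle (run ω (.loop 7 (.reg 1) (block [gradProg, accProg])) u)
        [(j : ℕ), (i : ℕ)] (S j i)) ∧
      ∀ p q : Fin (d + 1), (run ω (.loop 7 (.reg 1) (block [gradProg, accProg])) u).real 6
        [(p : ℕ), (q : ℕ)] = u.real 6 [(p : ℕ), (q : ℕ)] + ∑ i ∈ Finset.range L, T j p q i := by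
    intro j u hu hj hA
    refine loop_induct ω (v := 7) (e := .reg 1) (p := block [gradProg, accProg]) (s := u) L hu.size_L
      (fun k s' => (∀ (j : Fin N) (i : Fin L), IsAngle s' [(j : ℕ), (i : ℕ)] (S j i)) ∧
        ∀ p q : Fin (d + 1), s'.real 6 [(p : ℕ), (q : ℕ)] =
          u.real 6 [(p : ℕ), (q : ℕ)] + ∑ i ∈ Finset.range k, T j p q i)
      ⟨hA, fun p q => by simp⟩ (fun _ _ _ h => h) ?_
    rintro k hk z hF hk' ⟨i1, i2⟩
    have hz : Loaded W X Y N x z := hu.of_frame hF (by decide) (by decide) (by decide)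
    have z6 : z.idx 6 = j := (hF.idx 6 (by decide)).trans hj
    rw [run_block_cons, run_block_cons, run_block_nil]
    obtain ⟨g4, g6, g7⟩ := run_gradProg ω hz (i := ⟨k, hk⟩) hk' (κ := S j) (by
      rw [z6]; exact i1 j)
    have G := frame_run ω gradProg z
    set z1 := run ω gradProg z with hz1
    have r6 : z1.real 6 = z.real 6 := G.real 6 (by decide)
    have z5 : z1.idx 5 = d + 1 := (G.idx 5 (by decide)).trans hz.size_D
    have G2 := frame_run ω accProg z1
    refine ⟨fun j' i' => isAngle_congr ?_ ?_ (i1 j' i'), fun p q => ?_⟩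
    · rw [G2.bit 6 (by decide), g6]
    · rw [G2.bit 7 (by decide), g7]
    · rw [run_accProg ω z5 p q p.2 q.2, r6, i2, g4, g4, Finset.sum_range_succ, add_assoc]
      simp only [T, hk, dif_pos]
  let T' : Fin (d + 1) → Fin (d + 1) → ℕ → ℝ := fun p q j => if hj : j < N then
    ∑ i ∈ Finset.range L, T ⟨j, hj⟩ p q i else 0
  have key := loop_induct ω (v := 6) (e := .reg 4)
    (p := .loop 7 (.reg 1) (block [gradProg, accProg])) (s := s1) N L1.size_N
    (fun k s' => (∀ (j : Fin N) (i : Fin L), IsAngle s' [(j : ℕ), (i : ℕ)] (S j i)) ∧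
      ∀ p q : Fin (d + 1), s'.real 6 [(p : ℕ), (q : ℕ)] = ∑ j ∈ Finset.range k, T' p q j)
    ⟨A1, fun p q => by
      rw [Finset.range_zero, Finset.sum_empty]
      exact hzero p q p.2 q.2⟩ (fun _ _ _ h => h) (by
      rintro k hk u hF hk' ⟨i1, i2⟩
      have hu : Loaded W X Y N x u := L1.of_frame hF (by decide) (by decide) (by decide)
      obtain ⟨c1, c2⟩ := inner ⟨k, hk⟩ u hu hk' i1
      refine ⟨c1, fun p q => ?_⟩
      rw [c2, i2, Finset.sum_range_succ]
      simp only [T', hk, dif_pos])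
  rw [key.2 p q, gramSum, ← Fin.sum_univ_eq_sum_range]
  refine Finset.sum_congr rfl fun j _ => ?_
  simp only [T', Fin.is_lt, dif_pos, Fin.eta]
  rw [← Fin.sum_univ_eq_sum_range]
  exact Finset.sum_congr rfl fun i _ => by simp [T]

end

/-! ### Drawing the samples -/

theorem run_drawProg (ω : ℕ → Fin 4) {s : State} {N L : ℕ} (hN : s.idx 4 = N) (hL : s.idx 1 = L)
    (h0 : s.draws = 0) : (run ω drawProg s).draws = N * L ∧
      ∀ (j : Fin N) (i : Fin L), IsAngle (run ω drawProg s) [(j : ℕ), (i : ℕ)]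
        (drawnSamples N L ω j i) := by
  set dp : Prog := .draw ⟨6, [.reg 6, .reg 7]⟩ ⟨7, [.reg 6, .reg 7]⟩ with hdp
  have key := loop_induct ω (v := 6) (e := .reg 4) (p := .loop 7 (.reg 1) dp) (s := s) N hN
    (fun k s' => s'.draws = k * L ∧ ∀ j < k, ∀ i < L, IsAngle s' [j, i] (ω (j * L + i)))
    ⟨by simp [h0], fun j hj => absurd hj (by omega)⟩ (fun _ _ _ h => h) (by
      rintro k hk u hF hk' ⟨i1, i2⟩
      have h1 : u.idx 1 = L := (hF.idx 1 (by decide)).trans hL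
      have key2 := loop_induct ω (v := 7) (e := .reg 1) (p := dp) (s := u) L h1
        (fun t s' => s'.draws = k * L + t ∧ ∀ j i, (j < k ∧ i < L ∨ j = k ∧ i < t) →
          IsAngle s' [j, i] (ω (j * L + i)))
        ⟨i1, fun j i hji => i2 j (by omega) i (by omega)⟩ (fun _ _ _ h => h) (by
          rintro t ht z hG ht' ⟨c1, c2⟩
          have g6 : z.idx 6 = k := (hG.idx 6 (by decide)).trans hk'
          constructor
          · simp only [hdp, run]
            change z.draws + 1 = _
            omega
          · intro j i hji
            by_cases hji' : j = k ∧ i = t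
            · obtain ⟨rfl, rfl⟩ := hji'
              rw [IsAngle]
              simp [hdp, run, Cell.eval, g6, ht', c1]
            · have := c2 j i (by omega)
              rw [IsAngle] at this ⊢
              simp [hdp, run, Cell.eval, g6, ht', hji', this])
      refine ⟨by rw [key2.1]; ring, fun j hj i hi => key2.2 j i (by omega)⟩)
  exact ⟨key.1, fun j i => key.2 j j.2 i i.2⟩

end RealRAM

/-! ### Orthogonalisation -/

/-- The state of the elimination for a `d × (d + 1)` matrix `G` after `i` rounds: the rows of `w`
from number `i` on are orthogonal to the first `i` rows of `G`, and each of them is a unit vector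
up to its first `i` entries. -/
structure Eliminated (G w : ℕ → ℕ → ℝ) (d i : ℕ) : Prop where
  orth : ∀ r, i ≤ r → r ≤ d → ∀ j < i, ∑ c ∈ Finset.range (d + 1), G j c * w r c = 0
  diag : ∀ r, i ≤ r → r ≤ d → w r r = 1
  off : ∀ r, i ≤ r → r ≤ d → ∀ c, i ≤ c → c ≤ d → c ≠ r → w r c = 0

/-- For a positive definite left block no pivot vanishes: the pivot is the value of the quadratic
form at a row of `w`. -/
theorem Eliminated.pivot_ne_zero {G w : ℕ → ℕ → ℝ} {d i : ℕ} (h : Eliminated G w d i) (hi : i < d)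
    (hG : (Matrix.of fun a b : Fin d => G a b).PosDef) :
    ∑ c ∈ Finset.range (d + 1), G i c * w i c ≠ 0 := by
  set v : Fin d → ℝ := fun c => w i c with hv
  have hrow : ∀ j : Fin d, ((Matrix.of fun a b : Fin d => G a b) *ᵥ v) j =
      ∑ c ∈ Finset.range (d + 1), G j c * w i c := by
    intro j
    rw [Finset.sum_range_succ, h.off i le_rfl hi.le d hi.le le_rfl hi.ne', mul_zero, add_zero,
      Matrix.mulVec, dotProduct, ← Fin.sum_univ_eq_sum_range (fun c => G j c * w i c)]
    rfl
  have hquad : v ⬝ᵥ ((Matrix.of fun a b : Fin d => G a b) *ᵥ v) =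
      ∑ c ∈ Finset.range (d + 1), G i c * w i c := by
    rw [dotProduct, Finset.sum_eq_single (⟨i, hi⟩ : Fin d)]
    · rw [hrow, hv]
      simp only [h.diag i le_rfl hi.le, one_mul]
    · intro j _ hj
      rcases lt_trichotomy (j : ℕ) i with hlt | heq | hgt
      · rw [hrow, h.orth i le_rfl hi.le j hlt, mul_zero]
      · exact absurd (Fin.ext heq) hj
      · rw [hv]
        simp only [h.off i le_rfl hi.le j hgt.le j.2.le hgt.ne', zero_mul]
    · exact fun hn => absurd (Finset.mem_univ _) hn
  have hv0 : v ≠ 0 := by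
    intro h0
    have := congrFun h0 ⟨i, hi⟩
    rw [hv] at this
    simp [h.diag i le_rfl hi.le] at this
  have hpos := hG.dotProduct_mulVec_pos hv0
  rw [star_trivial, hquad] at hpos
  exact hpos.ne'

theorem Eliminated.succ {G w w' : ℕ → ℕ → ℝ} {d i : ℕ} (h : Eliminated G w d i) (hi : i < d)
    (hp : ∑ c ∈ Finset.range (d + 1), G i c * w i c ≠ 0)
    (hw : ∀ r c, i < r → r ≤ d → c ≤ d → w' r c = w r c -
      ((∑ c ∈ Finset.range (d + 1), G i c * w r c) /
        ∑ c ∈ Finset.range (d + 1), G i c * w i c) * w i c) : Eliminated G w' d (i + 1) := by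
  refine ⟨fun r hr hrd j hj => ?_, fun r hr hrd => ?_, fun r hr hrd c hc hcd hcr => ?_⟩
  · set e := (∑ c ∈ Finset.range (d + 1), G i c * w r c) /
        ∑ c ∈ Finset.range (d + 1), G i c * w i c with he
    have : ∑ c ∈ Finset.range (d + 1), G j c * w' r c =
        (∑ c ∈ Finset.range (d + 1), G j c * w r c) -
          e * ∑ c ∈ Finset.range (d + 1), G j c * w i c := by
      rw [Finset.mul_sum, ← Finset.sum_sub_distrib]
      refine Finset.sum_congr rfl fun c hc => ?_
      rw [hw r c (by omega) hrd (by have := Finset.mem_range.1 hc; omega)]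
      ring
    rw [this]
    rcases Nat.lt_succ_iff_lt_or_eq.1 hj with hj | rfl
    · rw [h.orth r (by omega) hrd j hj, h.orth i le_rfl hi.le j hj, mul_zero, sub_zero]
    · rw [he, div_mul_cancel₀ _ hp, sub_self]
  · rw [hw r r (by omega) hrd hrd, h.diag r (by omega) hrd,
      h.off i le_rfl hi.le r (by omega) hrd (by omega), mul_zero, sub_zero]
  · rw [hw r c (by omega) hrd hcd, h.off r (by omega) hrd c (by omega) hcd hcr,
      h.off i le_rfl hi.le c (by omega) hcd (by omega), mul_zero, sub_zero]

/-- At the end the last row of `w` solves the linear system with right hand side minus the last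
column of `G`. -/
theorem Eliminated.mulVec_eq {G w : ℕ → ℕ → ℝ} {d : ℕ} (h : Eliminated G w d d) (j : Fin d) :
    ((Matrix.of fun a b : Fin d => G a b) *ᵥ fun c : Fin d => w d c) j = -G j d := by
  have := h.orth d le_rfl le_rfl j j.2
  rw [Finset.sum_range_succ, h.diag d le_rfl le_rfl, mul_one,
    ← Fin.sum_univ_eq_sum_range (fun c => G j c * w d c)] at this
  exact eq_neg_of_add_eq_zero_left this

namespace RealRAM

/-! ### The linear solver on the machine -/

/-- Writes the inner product of row `a` of the real array `6` and row `b` of the real array `7`,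
over the columns below register `e`, into the real cell `t`. -/
def dotProg (t a b e : ℕ) : Prog := block [
  .const (cell t) 0,
  .loop 16 (.reg e) (block [
    .arith .mul (cell 5) ⟨6, [.reg a, .reg 16]⟩ ⟨7, [.reg b, .reg 16]⟩,
    .arith .add (cell t) (cell t) (cell 5)])]

/-- Makes row `15` of the real array `7` orthogonal to row `14` of the real array `6`, by means of
row `14` of the real array `7`. -/
def elimBody : Prog := block [
  dotProg 9 14 15 5,
  .arith .div (cell 9) (cell 9) (cell 8),
  .loop 16 (.reg 5) (block [
    .arith .mul (cell 5) (cell 9) ⟨7, [.reg 14, .reg 16]⟩,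
    .arith .sub ⟨7, [.reg 15, .reg 16]⟩ ⟨7, [.reg 15, .reg 16]⟩ (cell 5)])]

/-- One round of the elimination. -/
def elimRound : Prog := block [
  dotProg 8 14 14 5,
  .loop 15 (.reg 5) (.ifIdx (.reg 14) (.reg 15) elimBody .skip)]

/-- Writes minus the labels into column `d` of the real array `6`. -/
def labelProg : Prog := .loop 14 (.reg 3) (block [
  .const (cell 5) 0,
  .arith .sub ⟨6, [.reg 14, .reg 3]⟩ (cell 5) ⟨1, [.reg 14]⟩])

/-- Writes the identity matrix into the real array `7`. -/
def eyeProg : Prog := .loop 14 (.reg 5) (block [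
  .loop 15 (.reg 5) (.const ⟨7, [.reg 14, .reg 15]⟩ 0),
  .const ⟨7, [.reg 14, .reg 14]⟩ 1])

/-- Solves the linear system and writes the inner product of the solution and of row `d` of the
real array `6` into the output cell. -/
def solveProg : Prog := block [
  labelProg,
  eyeProg,
  .loop 14 (.reg 3) elimRound,
  dotProg 2 3 3 3]

theorem run_dotProg (ω : ℕ → Fin 4) {s : State} {t a b e D : ℕ} (ht5 : t ≠ 5) (ht6 : t ≠ 6)
    (ht7 : t ≠ 7) (ha : a ≠ 16) (hb : b ≠ 16) (he : s.idx e = D) :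
    (run ω (dotProg t a b e) s).real t [] =
      ∑ c ∈ Finset.range D, s.real 6 [s.idx a, c] * s.real 7 [s.idx b, c] := by
  rw [dotProg, run_block_cons, run_block_cons, run_block_nil]
  set s1 := run ω (.const (cell t) 0) s with hs1
  have r6 : s1.real 6 = s.real 6 := by simp [hs1, run, cell, ht6.symm]
  have r7 : s1.real 7 = s.real 7 := by simp [hs1, run, cell, ht7.symm]
  have rt : s1.real t [] = 0 := by simp [hs1, run, cell, Cell.eval]
  refine loop_induct ω (v := 16) (e := .reg e) (s := s1) D he
    (fun k s' => s'.real t [] =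
      ∑ c ∈ Finset.range k, s.real 6 [s.idx a, c] * s.real 7 [s.idx b, c])
    (by simpa using rt) (fun _ _ _ h => h) ?_
  intro k hk u hF hk' i1
  have ua : u.idx a = s.idx a := hF.idx a (by simp [Prog.wIdx, block, ha])
  have ub : u.idx b = s.idx b := hF.idx b (by simp [Prog.wIdx, block, hb])
  have u6 : u.real 6 = s.real 6 :=
    (hF.real 6 (by simp [Prog.wReal, block, cell, ht6.symm])).trans r6
  have u7 : u.real 7 = s.real 7 :=
    (hF.real 7 (by simp [Prog.wReal, block, cell, ht7.symm])).trans r7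
  simp [run, block, cell, State.getReal, Cell.eval, Arith.eval, ht5, ua, ub, u6, u7, hk', i1,
    Finset.sum_range_succ]

theorem run_elimBody (ω : ℕ → Fin 4) {s : State} {i r D : ℕ} (h14 : s.idx 14 = i)
    (h15 : s.idx 15 = r) (h5 : s.idx 5 = D) (hir : i ≠ r) (a c : ℕ) :
    (run ω elimBody s).real 7 [a, c] = if a = r ∧ c < D then s.real 7 [r, c] -
      ((∑ c ∈ Finset.range D, s.real 6 [i, c] * s.real 7 [r, c]) / s.real 8 []) * s.real 7 [i, c]
      else s.real 7 [a, c] := by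
  rw [elimBody, run_block_cons, run_block_cons, run_block_cons, run_block_nil]
  have hd := run_dotProg ω (s := s) (t := 9) (a := 14) (b := 15) (e := 5) (by norm_num)
    (by norm_num) (by norm_num) (by norm_num) (by norm_num) h5
  rw [h14, h15] at hd
  have F1 := frame_run ω (dotProg 9 14 15 5) s
  set s1 := run ω (dotProg 9 14 15 5) s with hs1
  have d8 : s1.real 8 = s.real 8 := F1.real 8 (by decide)
  set s2 := run ω (.arith .div (cell 9) (cell 9) (cell 8)) s1 with hs2
  have e9 : s2.real 9 [] =
      (∑ c ∈ Finset.range D, s.real 6 [i, c] * s.real 7 [r, c]) / s.real 8 [] := by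
    simp [hs2, run, cell, State.getReal, Cell.eval, Arith.eval, hd, d8]
  have F2 := frame_run ω (.arith .div (cell 9) (cell 9) (cell 8)) s1
  rw [← hs2] at F2
  have r7 : s2.real 7 = s.real 7 := (F2.real 7 (by decide)).trans (F1.real 7 (by decide))
  have j14 : s2.idx 14 = i := (F1.idx 14 (by decide)).trans h14
  have j15 : s2.idx 15 = r := (F1.idx 15 (by decide)).trans h15
  have j5 : s2.idx 5 = D := (F1.idx 5 (by decide)).trans h5
  rw [← e9]
  refine loop_induct ω (v := 16) (e := .reg 5) (s := s2) D j5
    (fun k s' => ∀ a c, s'.real 7 [a, c] = if a = r ∧ c < k then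
      s.real 7 [r, c] - s2.real 9 [] * s.real 7 [i, c] else s.real 7 [a, c])
    (fun a c => by simp [r7]) (fun _ _ _ h => h) ?_ a c
  intro k hk u hF hk' i1 a c
  have u14 : u.idx 14 = i := (hF.idx 14 (by decide)).trans j14
  have u15 : u.idx 15 = r := (hF.idx 15 (by decide)).trans j15
  have u9 : u.real 9 = s2.real 9 := hF.real 9 (by decide)
  have hi := i1 i k
  rw [if_neg (by omega)] at hi
  by_cases hac : a = r ∧ c = k
  · obtain ⟨rfl, rfl⟩ := hac
    have hz := i1 a c
    simp only [lt_irrefl, and_false, if_false] at hz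
    simp [run, block, cell, State.getReal, Cell.eval, Arith.eval, u14, u15, u9, hk', hz, hi]
  · have hz := i1 a c
    have : (a = r ∧ c ≤ k) ↔ (a = r ∧ c < k) := by omega
    simp [run, block, cell, Cell.eval, u15, hk', hac, this, hz]

theorem run_elimRound (ω : ℕ → Fin 4) {s : State} {i D : ℕ} (h14 : s.idx 14 = i)
    (h5 : s.idx 5 = D) (r c : ℕ) (hr : i < r) (hrD : r < D) (hc : c < D) :
    (run ω elimRound s).real 7 [r, c] = s.real 7 [r, c] -
      ((∑ c ∈ Finset.range D, s.real 6 [i, c] * s.real 7 [r, c]) /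
        ∑ c ∈ Finset.range D, s.real 6 [i, c] * s.real 7 [i, c]) * s.real 7 [i, c] := by
  rw [elimRound, run_block_cons, run_block_cons, run_block_nil]
  have hd := run_dotProg ω (s := s) (t := 8) (a := 14) (b := 14) (e := 5) (by norm_num)
    (by norm_num) (by norm_num) (by norm_num) (by norm_num) h5
  rw [h14] at hd
  have F1 := frame_run ω (dotProg 8 14 14 5) s
  set s1 := run ω (dotProg 8 14 14 5) s with hs1
  have r6 : s1.real 6 = s.real 6 := F1.real 6 (by decide)
  have r7 : s1.real 7 = s.real 7 := F1.real 7 (by decide)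
  have j14 : s1.idx 14 = i := (F1.idx 14 (by decide)).trans h14
  have j5 : s1.idx 5 = D := (F1.idx 5 (by decide)).trans h5
  have key := loop_induct ω (v := 15) (e := .reg 5)
    (p := .ifIdx (.reg 14) (.reg 15) elimBody .skip) (s := s1) D j5
    (fun t s' => ∀ r c, s'.real 7 [r, c] = if i < r ∧ r < t ∧ c < D then s.real 7 [r, c] -
      ((∑ c ∈ Finset.range D, s.real 6 [i, c] * s.real 7 [r, c]) / s1.real 8 []) *
        s.real 7 [i, c] else s.real 7 [r, c])
    (fun r c => by simp [r7]) (fun _ _ _ h => h) (by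
      intro k hk u hF hk' i1 r c
      have u14 : u.idx 14 = i := (hF.idx 14 (by decide)).trans j14
      have u5 : u.idx 5 = D := (hF.idx 5 (by decide)).trans j5
      have u6 : u.real 6 = s.real 6 := (hF.real 6 (by decide)).trans r6
      have u8 : u.real 8 = s1.real 8 := hF.real 8 (by decide)
      simp only [run, Ix.eval_reg, u14, hk']
      by_cases hik : i < k
      · rw [if_pos hik]
        have hz := i1 r c
        rw [run_elimBody ω (s := u.tick) (i := i) (r := k) (D := D) u14 hk' u5 hik.ne r c]
        simp only [tick_real, u6, u8]
        by_cases hrk : r = k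
        · subst hrk
          have hrow : ∀ c, u.real 7 [r, c] = s.real 7 [r, c] := fun c => by
            rw [i1, if_neg (by omega)]
          have hrow' : ∀ c, u.real 7 [i, c] = s.real 7 [i, c] := fun c => by
            rw [i1, if_neg (by omega)]
          simp only [hrow, hrow']
          by_cases hcD : c < D
          · rw [if_pos ⟨trivial, hcD⟩, if_pos ⟨hik, by omega, hcD⟩]
          · rw [if_neg (by omega), if_neg (by omega)]
        · rw [if_neg (by omega), hz]
          have : (i < r ∧ r < k + 1 ∧ c < D) ↔ (i < r ∧ r < k ∧ c < D) := by omega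
          simp only [this]
      · rw [if_neg hik, tick_real, i1]
        have : (i < r ∧ r < k + 1 ∧ c < D) ↔ (i < r ∧ r < k ∧ c < D) := by omega
        simp only [this])
  rw [key r c, if_pos ⟨hr, hrD, hc⟩, hd]

theorem run_labelProg (ω : ℕ → Fin 4) {s : State} {d : ℕ} (h3 : s.idx 3 = d) (a c : ℕ) :
    (run ω labelProg s).real 6 [a, c] =
      if c = d ∧ a < d then -s.real 1 [a] else s.real 6 [a, c] := by
  refine loop_induct ω (v := 14) (e := .reg 3) (s := s) d h3
    (fun k s' => ∀ a c, s'.real 6 [a, c] =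
      if c = d ∧ a < k then -s.real 1 [a] else s.real 6 [a, c])
    (fun a c => by simp) (fun _ _ _ h => h) ?_ a c
  intro k hk u hF hk' i1 a c
  have u3 : u.idx 3 = d := (hF.idx 3 (by decide)).trans h3
  have u1 : u.real 1 = s.real 1 := hF.real 1 (by decide)
  by_cases hac : a = k ∧ c = d
  · obtain ⟨rfl, rfl⟩ := hac
    simp [run, block, cell, State.getReal, Cell.eval, Arith.eval, u3, u1, hk']
  · have hz := i1 a c
    have : (c = d ∧ a ≤ k) ↔ (c = d ∧ a < k) := by omega
    simp [run, block, cell, Cell.eval, u3, hk', hac, this, hz]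

theorem run_eyeProg (ω : ℕ → Fin 4) {s : State} {D : ℕ} (h5 : s.idx 5 = D) (a c : ℕ) (ha : a < D)
    (hc : c < D) : (run ω eyeProg s).real 7 [a, c] = if a = c then 1 else 0 := by
  refine loop_induct ω (v := 14) (e := .reg 5) (s := s) D h5
    (fun k s' => ∀ a c, a < k → c < D → s'.real 7 [a, c] = if a = c then 1 else 0)
    (fun a c ha => absurd ha (by omega)) (fun _ _ _ h => h) ?_ a c ha hc
  intro k hk u hF hk' i1 a c ha hc
  have u5 : u.idx 5 = D := (hF.idx 5 (by decide)).trans h5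
  have key := loop_induct ω (v := 15) (e := .reg 5) (p := .const ⟨7, [.reg 14, .reg 15]⟩ 0)
    (s := u) D u5
    (fun t s' => ∀ a c, s'.real 7 [a, c] = if a = k ∧ c < t then 0 else u.real 7 [a, c])
    (fun a c => by simp) (fun _ _ _ h => h) (by
      intro t ht z hG ht' i2 a c
      have g14 : z.idx 14 = k := (hG.idx 14 (by decide)).trans hk'
      by_cases hac : a = k ∧ c = t
      · obtain ⟨rfl, rfl⟩ := hac
        simp [run, Cell.eval, g14, ht']
      · have hz := i2 a c
        have : (a = k ∧ c ≤ t) ↔ (a = k ∧ c < t) := by omega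
        simp [run, Cell.eval, g14, ht', hac, this, hz])
  rw [run_block_cons, run_block_cons, run_block_nil]
  have G := frame_run ω (.loop 15 (.reg 5) (.const ⟨7, [.reg 14, .reg 15]⟩ 0)) u
  set u1 := run ω (.loop 15 (.reg 5) (.const ⟨7, [.reg 14, .reg 15]⟩ 0)) u with hu1
  have g14 : u1.idx 14 = k := (G.idx 14 (by decide)).trans hk'
  by_cases hak : a = k
  · subst hak
    have hz := key a c
    rw [if_pos ⟨rfl, hc⟩] at hz
    by_cases hca : c = a
    · subst hca
      simp [run, Cell.eval, g14]
    · simp [run, Cell.eval, g14, hca, Ne.symm hca, hz]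
  · have hz := key a c
    rw [if_neg (by omega), i1 a c (by omega) hc] at hz
    simp [run, Cell.eval, g14, hak, hz]

/-- The solver is correct if the matrix in the first `d` rows and columns of the real array `6` is
positive definite. -/
theorem run_solveProg (ω : ℕ → Fin 4) {s : State} {d : ℕ} (h3 : s.idx 3 = d)
    (h5 : s.idx 5 = d + 1)
    (hA : (Matrix.of fun a b : Fin d => s.real 6 [(a : ℕ), (b : ℕ)]).PosDef) :
    (run ω solveProg s).real 2 [] = (fun c : Fin d => s.real 6 [d, (c : ℕ)]) ⬝ᵥ
      ((Matrix.of fun a b : Fin d => s.real 6 [(a : ℕ), (b : ℕ)])⁻¹ *ᵥ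
        fun a : Fin d => s.real 1 [(a : ℕ)]) := by
  rw [solveProg, run_block_cons, run_block_cons, run_block_cons, run_block_cons, run_block_nil]
  have l6 := fun a c => run_labelProg ω h3 a c
  have F1 := frame_run ω labelProg s
  set s1 := run ω labelProg s with hs1
  have a5 : s1.idx 5 = d + 1 := (F1.idx 5 (by decide)).trans h5
  have a3 : s1.idx 3 = d := (F1.idx 3 (by decide)).trans h3
  have w7 := fun a c => run_eyeProg ω a5 a c
  have F2 := frame_run ω eyeProg s1
  set s2 := run ω eyeProg s1 with hs2
  have b5 : s2.idx 5 = d + 1 := (F2.idx 5 (by decide)).trans a5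
  have b3 : s2.idx 3 = d := (F2.idx 3 (by decide)).trans a3
  have b6 : s2.real 6 = s1.real 6 := F2.real 6 (by decide)
  set G : ℕ → ℕ → ℝ := fun a c => s1.real 6 [a, c] with hG
  have hGA : (Matrix.of fun a b : Fin d => G a b) =
      Matrix.of fun a b : Fin d => s.real 6 [(a : ℕ), (b : ℕ)] := by
    ext a b
    simp only [hG, Matrix.of_apply]
    rw [l6, if_neg (by have := b.2; omega)]
  have key := loop_induct ω (v := 14) (e := .reg 3) (p := elimRound) (s := s2) d b3
    (fun i s' => Eliminated G (fun r c => s'.real 7 [r, c]) d i)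
    ⟨fun _ _ _ j hj => absurd hj (by omega), fun r _ hr => by
      simpa using w7 r r (by omega) (by omega), fun r _ hr c _ hc hcr => by
      simpa [Ne.symm hcr] using w7 r c (by omega) (by omega)⟩ (fun _ _ _ h => h) (by
      intro k hk u hF hk' i1
      have u6 : u.real 6 = s1.real 6 := (hF.real 6 (by decide)).trans b6
      have u5 : u.idx 5 = d + 1 := (hF.idx 5 (by decide)).trans b5
      refine i1.succ hk (i1.pivot_ne_zero hk (hGA ▸ hA)) fun r c hr hrd hcd => ?_
      rw [run_elimRound ω hk' u5 r c hr (by omega) (by omega), u6])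
  have F3 := frame_run ω (.loop 14 (.reg 3) elimRound) s2
  set s3 := run ω (.loop 14 (.reg 3) elimRound) s2 with hs3
  have c3 : s3.idx 3 = d := (F3.idx 3 (by decide)).trans b3
  have c6 : s3.real 6 = s1.real 6 := (F3.real 6 (by decide)).trans b6
  rw [run_dotProg ω (by norm_num) (by norm_num) (by norm_num) (by norm_num) (by norm_num) c3, c3, c6,
    ← Fin.sum_univ_eq_sum_range (fun c => s1.real 6 [d, c] * s3.real 7 [d, c])]
  have hsol : (Matrix.of fun a b : Fin d => s.real 6 [(a : ℕ), (b : ℕ)]) *ᵥ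
      (fun c : Fin d => s3.real 7 [d, (c : ℕ)]) = fun a : Fin d => s.real 1 [(a : ℕ)] := by
    funext j
    rw [← hGA, key.mulVec_eq j]
    simp only [hG]
    rw [l6, if_pos ⟨rfl, j.2⟩, neg_neg]
  have hdet : IsUnit (Matrix.of fun a b : Fin d => s.real 6 [(a : ℕ), (b : ℕ)]).det :=
    hA.det_pos.ne'.isUnit
  rw [← hsol, Matrix.mulVec_mulVec, Matrix.nonsing_inv_mul _ hdet, Matrix.one_mulVec, dotProduct]
  refine Finset.sum_congr rfl fun c _ => ?_
  rw [l6, if_neg (by have := c.2; omega)]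

/-! ### The whole program and its running time -/

/-- The part of the program after the register `5` has been set to `d + 1` and the samples have
been drawn. -/
def postProg : Prog := block [kernelProg, solveProg]

/-- The program that estimates the trained mean. -/
def estimateProg : Prog := block [
  .setIdx 5 (.reg 3),
  .incIdx 5,
  block [drawProg, postProg]]

theorem postProg_noDraw : postProg.NoDraw := by
  simp [postProg, kernelProg, solveProg, gradProg, accProg, accBody, bumpProg, flipProg, fillBody,
    subBody, evalProg, termProg, layerBody, cliffProg, cliffBody, copyBody, rotProg, quarterTurn,
    initProg, expProg, mulProg, mulBody, commProg, commBody, labelProg, eyeProg, elimRound, elimBody,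
    dotProg, block, Prog.NoDraw]

theorem boundsIn_block_draw_post : (block [drawProg, postProg]).BoundsIn [0, 1, 2, 3, 4, 5] := by
  simp [drawProg, postProg, kernelProg, solveProg, gradProg, accProg, accBody, bumpProg, flipProg,
    fillBody, subBody, evalProg, termProg, layerBody, cliffProg, cliffBody, copyBody, rotProg,
    quarterTurn, initProg, expProg, mulProg, mulBody, commProg, commBody, labelProg, eyeProg,
    elimRound, elimBody, dotProg, block, Prog.BoundsIn]

set_option maxRecDepth 20000 in
theorem disjoint_wIdx_block_draw_post :
    ∀ v ∈ [0, 1, 2, 3, 4, 5], v ∉ (block [drawProg, postProg]).wIdx := by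
  decide

section Cost

variable {f : ℕ → ℕ}

theorem cost_mulProg_le (hn : 1 ≤ f 0) (A : ℕ) (pre : List Ix) :
    (mulProg A pre).cost f ≤ 11 * f 0 := by
  simp only [mulProg, mulBody, block, Prog.cost]
  omega

theorem cost_commProg_le (hn : 1 ≤ f 0) (A : ℕ) (pre : List Ix) :
    (commProg A pre).cost f ≤ 7 * f 0 := by
  simp only [commProg, commBody, block, Prog.cost]
  omega

theorem cost_cliffProg_le (hn : 1 ≤ f 0) : cliffProg.cost f ≤ 46 * f 0 ^ 2 := by
  have hb : cliffBody.cost f ≤ 40 * f 0 := by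
    have h1 := cost_commProg_le hn 0 [.reg 8, .reg 11, .const 1, .reg 13]
    have h2 := cost_commProg_le hn 0 [.reg 8, .reg 11, .const 0, .reg 13]
    have h3 := cost_mulProg_le hn 0 [.reg 8, .reg 11, .const 1, .reg 13]
    have h4 := cost_mulProg_le hn 0 [.reg 8, .reg 11, .const 0, .reg 13]
    simp only [cliffBody, block, Prog.cost, Nat.max_zero]
    omega
  have h := Nat.mul_le_mul_left (f 0) hb
  simp only [cliffProg, copyBody, block, Prog.cost]
  nlinarith

theorem cost_layerBody_le (hn : 1 ≤ f 0) : layerBody.cost f ≤ 70 * f 0 ^ 2 := by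
  have hr : rotProg.cost f ≤ 23 * f 0 := by
    have h1 := cost_commProg_le hn 2 [.reg 11]
    have h2 := cost_mulProg_le hn 2 [.reg 11]
    simp only [rotProg, quarterTurn, block, Prog.cost, Nat.max_zero]
    omega
  have hc := cost_cliffProg_le hn
  simp only [layerBody, block, Prog.cost]
  nlinarith

theorem cost_termProg_le (hn : 1 ≤ f 0) (hL : 1 ≤ f 1) :
    termProg.cost f ≤ 144 * (f 1 * f 0 ^ 2) := by
  have h1 : initProg.cost f ≤ 6 * f 0 := by
    simp only [initProg, block, Prog.cost]
    omega
  have h2 : expProg.cost f ≤ 8 * f 0 := by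
    simp only [expProg, block, Prog.cost]
    omega
  have h3 := cost_mulProg_le hn 4 [.reg 9]
  have h4 := cost_cliffProg_le hn
  have h5 := Nat.mul_le_mul_left (f 1) (cost_layerBody_le hn)
  have h6 : f 0 ≤ f 0 ^ 2 := Nat.le_self_pow two_ne_zero _
  have h7 : f 0 ^ 2 ≤ f 1 * f 0 ^ 2 := Nat.le_mul_of_pos_left _ hL
  have h8 : f 1 ≤ f 1 * f 0 ^ 2 := Nat.le_mul_of_pos_right _ (by omega)
  simp only [termProg, block, Prog.cost, mul_add, mul_one]
  rw [mul_left_comm] at h5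
  omega

theorem cost_evalProg_le (hn : 1 ≤ f 0) (hL : 1 ≤ f 1) (hm : 1 ≤ f 2) :
    evalProg.cost f ≤ 147 * (f 2 * (f 1 * f 0 ^ 2)) := by
  have h1 := Nat.mul_le_mul_left (f 2) (cost_termProg_le hn hL)
  have h2 : 1 ≤ f 1 * f 0 ^ 2 := Nat.mul_pos hL (Nat.pow_pos hn)
  have h3 : f 2 ≤ f 2 * (f 1 * f 0 ^ 2) := Nat.le_mul_of_pos_right _ h2
  rw [mul_left_comm] at h1
  simp only [evalProg, block, Prog.cost, mul_add, mul_one]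
  omega

theorem cost_gradProg_le (hn : 1 ≤ f 0) (hL : 1 ≤ f 1) (hm : 1 ≤ f 2) (hd : 1 ≤ f 3)
    (hD : f 5 = f 3 + 1) : gradProg.cost f ≤ 605 * (f 3 * (f 2 * (f 1 * f 0 ^ 2))) := by
  have h1 := cost_evalProg_le hn hL hm
  have h2 : 1 ≤ f 2 * (f 1 * f 0 ^ 2) := Nat.mul_pos hm (Nat.mul_pos hL (Nat.pow_pos hn))
  set z := f 2 * (f 1 * f 0 ^ 2) with hz
  have h3 : (f 3 + 1) * (1 + (evalProg.cost f + 2)) ≤ (2 * f 3) * (150 * z) :=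
    Nat.mul_le_mul (by omega) (by omega)
  have h4 : (f 3 + 1) * (1 + (evalProg.cost f + 1)) ≤ (2 * f 3) * (149 * z) :=
    Nat.mul_le_mul (by omega) (by omega)
  have h5 : 1 ≤ f 3 * z := Nat.mul_pos hd h2
  rw [mul_mul_mul_comm] at h3 h4
  have e1 : fillBody.cost f = evalProg.cost f + 2 := rfl
  have e2 : subBody.cost f = evalProg.cost f + 1 := rfl
  simp only [gradProg, bumpProg, flipProg, block, Prog.cost, hD, e1, e2]
  omega

theorem cost_accProg_le (hd : 1 ≤ f 3) (hD : f 5 = f 3 + 1) : accProg.cost f ≤ 17 * f 3 ^ 2 := by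
  simp only [accProg, accBody, block, Prog.cost, hD]
  nlinarith

theorem cost_solveProg_le (hd : 1 ≤ f 3) (hD : f 5 = f 3 + 1) : solveProg.cost f ≤ 80 * f 3 ^ 3 := by
  have h1 : elimBody.cost f ≤ 16 * f 3 := by
    simp only [elimBody, dotProg, block, Prog.cost, hD]
    omega
  have h2 : elimRound.cost f ≤ 45 * f 3 ^ 2 := by
    have := Nat.mul_le_mul (show f 3 + 1 ≤ 2 * f 3 by omega)
      (show 1 + (1 + elimBody.cost f) ≤ 18 * f 3 by omega)
    simp only [elimRound, dotProg, block, Prog.cost, hD, Nat.max_zero]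
    nlinarith
  have h3 := Nat.mul_le_mul_left (f 3) h2
  have h4 : f 3 ≤ f 3 ^ 2 := Nat.le_self_pow two_ne_zero _
  have h5 : f 3 ^ 2 ≤ f 3 ^ 3 := Nat.pow_le_pow_right hd (by norm_num)
  have h6 : f 3 * (45 * f 3 ^ 2) = 45 * f 3 ^ 3 := by ring
  have h7 : (f 3 + 1) * (1 + (1 + (f 3 + 1) * (1 + 1) + (1 + 0))) =
      2 * f 3 ^ 2 + 7 * f 3 + 5 := by ring
  simp only [solveProg, labelProg, eyeProg, dotProg, block, Prog.cost, hD, h7]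
  rw [mul_add (f 3) 1 (elimRound.cost f)]
  omega

theorem cost_block_draw_post_le (hn : 1 ≤ f 0) (hL : 1 ≤ f 1) (hm : 1 ≤ f 2) (hd : 1 ≤ f 3)
    (hN : 1 ≤ f 4) (hD : f 5 = f 3 + 1) : (block [drawProg, postProg]).cost f ≤
      998 * (f 4 * f 1 ^ 2 * f 3 * (f 2 * f 0 ^ 2 + f 3 ^ 2)) := by
  have hg := cost_gradProg_le hn hL hm hd hD
  have ha := cost_accProg_le hd hD
  have hs := cost_solveProg_le hd hD
  set T := f 4 * f 1 ^ 2 * f 3 * (f 2 * f 0 ^ 2 + f 3 ^ 2) with hT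
  -- each summand of the cost is dominated by one of these monomials
  have h1 : f 4 * (f 1 * (f 3 * (f 2 * (f 1 * f 0 ^ 2)))) + f 4 * f 1 ^ 2 * f 3 ^ 3 = T := by
    rw [hT]; ring
  have h2 : f 3 ^ 3 ≤ f 4 * f 1 ^ 2 * f 3 ^ 3 :=
    Nat.le_mul_of_pos_left _ (Nat.mul_pos hN (Nat.pow_pos hL))
  have h3 : f 3 ^ 2 ≤ f 3 ^ 3 := Nat.pow_le_pow_right hd (by norm_num)
  have h4 : f 3 ≤ f 3 ^ 2 := Nat.le_self_pow two_ne_zero _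
  have h5 : f 4 * (f 1 * f 3 ^ 2) ≤ f 4 * f 1 ^ 2 * f 3 ^ 3 := by
    rw [← mul_assoc]
    exact Nat.mul_le_mul (Nat.mul_le_mul_left _ (Nat.le_self_pow two_ne_zero _)) h3
  have h6 : f 4 * f 1 ≤ f 4 * (f 1 * f 3 ^ 2) := by
    rw [← mul_assoc]
    exact Nat.le_mul_of_pos_right _ (Nat.pow_pos hd)
  have h7 : f 4 ≤ f 4 * f 1 := Nat.le_mul_of_pos_right _ hL
  have h8 : f 4 * (f 1 * gradProg.cost f) ≤
      605 * (f 4 * (f 1 * (f 3 * (f 2 * (f 1 * f 0 ^ 2))))) := by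
    refine (Nat.mul_le_mul_left _ (Nat.mul_le_mul_left _ hg)).trans_eq ?_
    ring
  have h9 : f 4 * (f 1 * accProg.cost f) ≤ 17 * (f 4 * (f 1 * f 3 ^ 2)) := by
    refine (Nat.mul_le_mul_left _ (Nat.mul_le_mul_left _ ha)).trans_eq ?_
    ring
  have h10 : (f 3 + 1) * (1 + (1 + (f 3 + 1) * (1 + 1))) = 2 * f 3 ^ 2 + 6 * f 3 + 4 := by ring
  have h11 : f 4 * (1 + (1 + f 1 * (1 + (gradProg.cost f + (accProg.cost f + 0))))) =
      2 * f 4 + f 4 * f 1 + f 4 * (f 1 * gradProg.cost f) + f 4 * (f 1 * accProg.cost f) := by ring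
  have h12 : f 4 * (1 + (1 + f 1 * (1 + 1))) = 2 * f 4 + 2 * (f 4 * f 1) := by ring
  simp only [drawProg, postProg, kernelProg, block, Prog.cost, hD, h10, h11, h12]
  omega

end Cost

section

variable {𝒳 : Type*} {n L m d N : ℕ} {W : Network 𝒳 n L m} {X : Fin d → 𝒳} {Y : Fin d → ℝ} {x : 𝒳}

theorem loaded_of_isInput (ω : ℕ → Fin 4) {μ : Mem} (h : IsInput W X Y N x μ) :
    Loaded W X Y N x (run ω (.incIdx 5) (run ω (.setIdx 5 (.reg 3)) μ.start)) := by
  refine ⟨h.size_n, h.size_L, h.size_m, h.size_d, h.size_N, ?_, h.tableau, h.gen, h.obs, h.coeff,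
    h.label⟩
  have : μ.start.idx 3 = d := h.size_d
  simp [run, this]

/-- The trained mean does not change if the kernel is multiplied by a positive number. -/
theorem meanInfty_smul (K : 𝒳 → 𝒳 → ℝ) {c : ℝ} (hc : c ≠ 0) (hK : IsUnit (trainMatrix K X)) :
    meanInfty (fun y y' => c * K y y') X Y x = meanInfty K X Y x := by
  have h1 : trainMatrix (fun y y' => c * K y y') X = c • trainMatrix K X := rfl
  have h2 : (c • trainMatrix K X)⁻¹ = c⁻¹ • (trainMatrix K X)⁻¹ := by
    refine Matrix.inv_eq_left_inv ?_
    rw [smul_mul_smul_comm, inv_mul_cancel₀ hc, one_smul,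
      Matrix.nonsing_inv_mul _ ((Matrix.isUnit_iff_isUnit_det _).1 hK)]
  have h3 : (fun i => c * K x (X i)) = c • fun i => K x (X i) := rfl
  rw [meanInfty, h1, h2, h3, Matrix.smul_mulVec, smul_dotProduct, dotProduct_smul, smul_smul,
    mul_inv_cancel₀ hc, one_smul, meanInfty]

end

end RealRAM

open RealRAM in
theorem estimates_estimateProg {𝒳 : Type*} {n L m d : ℕ} (W : Network 𝒳 n L m) (X : Fin d → 𝒳)
    (Y : Fin d → ℝ) : Estimates estimateProg 1000 W X Y := by
  intro N x μ ω hn hL hm hd hN hμ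
  have hl := loaded_of_isInput ω hμ
  have hrun : run ω estimateProg μ.start = run ω (block [drawProg, postProg])
      (run ω (.incIdx 5) (run ω (.setIdx 5 (.reg 3)) μ.start)) := rfl
  have hsteps : (run ω (.incIdx 5) (run ω (.setIdx 5 (.reg 3)) μ.start)).steps = 2 := rfl
  have hdraws : (run ω (.incIdx 5) (run ω (.setIdx 5 (.reg 3)) μ.start)).draws = 0 := rfl
  rw [hrun]
  set s := run ω (.incIdx 5) (run ω (.setIdx 5 (.reg 3)) μ.start) with hs
  obtain ⟨c1, c2⟩ := run_drawProg ω hl.size_N hl.size_L hdraws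
  have hrun2 : run ω (block [drawProg, postProg]) s =
      run ω solveProg (run ω kernelProg (run ω drawProg s)) := rfl
  refine ⟨?_, ?_, fun hU => ?_⟩
  · have h1 := run_steps_le ω s.idx [0, 1, 2, 3, 4, 5] boundsIn_block_draw_post
      disjoint_wIdx_block_draw_post s fun _ _ => rfl
    have h2 := cost_block_draw_post_le (f := s.idx) (hl.size_n.symm ▸ hn) (hl.size_L.symm ▸ hL)
      (hl.size_m.symm ▸ hm) (hl.size_d.symm ▸ hd) (hl.size_N.symm ▸ hN)
      (by rw [hl.size_D, hl.size_d])
    rw [hl.size_n, hl.size_L, hl.size_m, hl.size_d, hl.size_N] at h2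
    have h3 : 1 ≤ N * L ^ 2 * d * (m * n ^ 2 + d ^ 2) :=
      Nat.mul_pos (Nat.mul_pos (Nat.mul_pos hN (Nat.pow_pos hL)) hd)
        (Nat.add_pos_right _ (Nat.pow_pos hd))
    omega
  · rw [run_block_cons, run_block_cons, run_block_nil, run_draws ω postProg_noDraw, c1]
  · rw [hrun2]
    have F1 := frame_run ω drawProg s
    set s1 := run ω drawProg s with hs1
    have l1 : Loaded W X Y N x s1 := hl.of_frame F1 (by decide) (by decide) (by decide)
    set S := drawnSamples N L ω with hS
    have hk := run_kernelProg ω l1 c2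
    have hw : ∀ v < 6, v ∉ kernelProg.wIdx := fun v hv hm => by
      have := disjoint_wIdx_block_draw_post v (by simp; omega)
      exact this (by simp [block, postProg, Prog.wIdx, hm])
    have F2 := frame_run ω kernelProg s1
    have hr2 : ∀ v ∈ kernelProg.wReal, 2 ≤ v := by decide
    set s2 := run ω kernelProg s1 with hs2
    have i3 : s2.idx 3 = d := (F2.idx 3 (hw 3 (by norm_num))).trans l1.size_d
    have i5 : s2.idx 5 = d + 1 := (F2.idx 5 (hw 5 (by norm_num))).trans l1.size_D
    have r1 : (fun a : Fin d => s2.real 1 [(a : ℕ)]) = Y := by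
      funext a
      rw [F2.real 1 (fun h => by have := hr2 1 h; omega), l1.label]
    -- the accumulated matrix is the estimate of the kernel, times `4 N`
    have hc : (0 : ℝ) < 4 * N := by positivity
    have hgram : ∀ y y', gramSum W S y y' = 4 * N * W.ntkEstimate S y y' := by
      intro y y'
      rw [gramSum, Network.ntkEstimate, ← mul_assoc, mul_one_div_cancel hc.ne', one_mul]
    have hA : (Matrix.of fun a b : Fin d => s2.real 6 [(a : ℕ), (b : ℕ)]) =
        trainMatrix (fun y y' => 4 * N * W.ntkEstimate S y y') X := by
      ext a b
      have := hk a.castSucc b.castSucc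
      simp only [inputPoint, Fin.snoc_castSucc, Fin.val_castSucc, hgram] at this
      exact this
    have hB : (fun c : Fin d => s2.real 6 [d, (c : ℕ)]) =
        fun c => 4 * N * W.ntkEstimate S x (X c) := by
      funext c
      have := hk (Fin.last d) c.castSucc
      simp only [inputPoint, Fin.snoc_castSucc, Fin.snoc_last, Fin.val_castSucc, Fin.val_last,
        hgram] at this
      exact this
    have hpd : (Matrix.of fun a b : Fin d => s2.real 6 [(a : ℕ), (b : ℕ)]).PosDef := by
      rw [hA]
      exact ((W.posSemidef_trainMatrix_ntkEstimate S X).posDef_iff_isUnit.2 hU).smul hc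
    rw [run_solveProg ω i3 i5 hpd, hA, hB, r1, ← meanInfty_smul _ hc.ne' hU]
    rfl

/-! ### Failure probability for all queries at once -/

namespace Network

variable {𝒳 : Type*} {n L m : ℕ} (W : Network 𝒳 n L m)

theorem sampleLaw_forall_failure_le [Fintype 𝒳] {d : ℕ} (X : Fin d → 𝒳) (Y : Fin d → ℝ)
    (hK : IsUnit (trainMatrix W.ntk X)) {ε δ : ℝ} (hε : 0 < ε)
    (hεt : ε < accuracyThreshold L m (trainMatrix W.ntk X) Y) (hδ : 0 < δ) (hδ1 : δ < 1) {N : ℕ}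
    (hN : sampleCount L m (trainMatrix W.ntk X) Y ε (δ / (Fintype.card 𝒳 : ℝ)) ≤ N) :
    (sampleLaw N L).real {S | ¬ (IsUnit (trainMatrix (W.ntkEstimate S) X) ∧
      ∀ x, |meanInfty (W.ntkEstimate S) X Y x - meanInfty W.ntk X Y x| < ε)} ≤ δ := by
  -- the threshold vanishes without training inputs
  have hd : 0 < d := by
    rcases Nat.eq_zero_or_pos d with rfl | h
    · have := hε.trans hεt
      simp [accuracyThreshold] at this
    · exact h
  have : Nonempty 𝒳 := ⟨X ⟨0, hd⟩⟩
  have hc : (1 : ℝ) ≤ Fintype.card 𝒳 := by exact_mod_cast Fintype.card_pos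
  have hc0 : (0 : ℝ) < Fintype.card 𝒳 := by linarith
  have hsub : {S | ¬ (IsUnit (trainMatrix (W.ntkEstimate S) X) ∧
      ∀ x, |meanInfty (W.ntkEstimate S) X Y x - meanInfty W.ntk X Y x| < ε)} ⊆
      ⋃ x, {S : Samples N L | ¬ (IsUnit (trainMatrix (W.ntkEstimate S) X) ∧
        |meanInfty (W.ntkEstimate S) X Y x - meanInfty W.ntk X Y x| < ε)} := by
    intro S hS
    by_contra hn
    simp only [Set.mem_iUnion, Set.mem_ofPred_eq, not_exists, not_not] at hn
    exact hS ⟨(hn (X ⟨0, hd⟩)).1, fun x => (hn x).2⟩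
  refine (measureReal_mono hsub).trans ((measureReal_iUnion_fintype_le _).trans ?_)
  refine (Finset.sum_le_sum fun x _ => W.sampleLaw_failure_le X Y hK hε hεt (div_pos hδ hc0)
    ((div_le_self hδ.le hc).trans_lt hδ1) x hN).trans_eq ?_
  rw [Finset.sum_const, Finset.card_univ, nsmul_eq_mul, mul_div_cancel₀ _ hc0.ne']

end Network

end QNTK

end

theorem mainTheorem2 :
    ∃ (A : RealRAM.Prog) (C : ℕ),
      ∀ (𝒳 : Type*) [Fintype 𝒳] (n L m d : ℕ) (W : Network 𝒳 n L m)
        (X : Fin d → 𝒳) (Y : Fin d → ℝ),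
        (∀ x : 𝒳, ∫ θ, W.model θ x ∂(initLaw L) = 0) →
        IsUnit (trainMatrix W.ntk X) →
        Estimates A C W X Y ∧
        (∀ (η : ℝ) (x : 𝒳), 0 < η →
          Tendsto (fun t => meanAtTime W.ntk X Y η t x) atTop (𝓝 (meanInfty W.ntk X Y x))) ∧
        ∀ ε δ : ℝ, 0 < ε → ε < accuracyThreshold L m (trainMatrix W.ntk X) Y → 0 < δ →
          (∀ (x : 𝒳) (N : ℕ), sampleCount L m (trainMatrix W.ntk X) Y ε δ ≤ N →
            ENNReal.ofReal (1 - δ) ≤ sampleLaw N L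
              {S | IsUnit (trainMatrix (W.ntkEstimate S) X) ∧
                |meanInfty (W.ntkEstimate S) X Y x - meanInfty W.ntk X Y x| < ε}) ∧
          (∀ N : ℕ,
            sampleCount L m (trainMatrix W.ntk X) Y ε (δ / (Fintype.card 𝒳 : ℝ)) ≤ N →
            ENNReal.ofReal (1 - δ) ≤ sampleLaw N L
              {S | IsUnit (trainMatrix (W.ntkEstimate S) X) ∧
                ∀ x : 𝒳, |meanInfty (W.ntkEstimate S) X Y x - meanInfty W.ntk X Y x| < ε}) := by

  refine ⟨RealRAM.estimateProg, 1000, fun 𝒳 _ n L m d W X Y _ hK =>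
    ⟨estimates_estimateProg W X Y, fun η x hη => tendsto_meanAtTime
      ((W.posSemidef_trainMatrix_ntk X).posDef_iff_isUnit.2 hK) Y hη x,
      fun ε δ hε hεt hδ => ?_⟩⟩
  by_cases hδ1 : δ < 1
  · refine ⟨fun x N hN => Network.sampleLaw_ge_of_failure_le ?_,
      fun N hN => Network.sampleLaw_ge_of_failure_le ?_⟩
    · exact W.sampleLaw_failure_le X Y hK hε hεt hδ hδ1 x hN
    · exact W.sampleLaw_forall_failure_le X Y hK hε hεt hδ hδ1 hN
  · have h0 : ENNReal.ofReal (1 - δ) = 0 := ENNReal.ofReal_eq_zero.2 (by linarith)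
    simp only [h0, zero_le, implies_true, and_self]
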